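/- **Setting.** Let $q\ge 1$, $a_i\in\mathbb R$, $\sigma_i\ge 0$ ($1\le i\le q$), and let $\eta_{in}$ ($1\le i\le q$, $n\ge 1$) be real random variables with $\mathbf E\eta_{in}=0$, $\mathbf E\eta_{in}^2=1$. Put $\alpha_{in}=a_i+\sigma_i\eta_{in}$ and $$A_n=\begin{pmatrix}\alpha_{1n}\ \cdots\ \alpha_{qn}\\ I_{q-1}\qquad 0\end{pmatrix},\qquad \Pi_n=A_1\cdots A_n,\qquad S=\{x\in\mathbb R^q:|x|=1\},$$ where $|\cdot|$ is the Euclidean norm and $|A|^2=\operatorname{tr}AA'$ for matrices. (These are the coefficient matrices of the random coefficient autoregressive model $y_n=\alpha_{1n}y_{n-1}+\dots+\alpha_{qn}y_{n-q}+\xi_n$.) For $x\in S$ let $x_0=x$, $v_0=0$, and for $n\ge1$ $$x_n'=\frac{x_{n-1}'A_n}{|x_{n-1}'A_n|}=\frac{x'\Pi_n}{|x'\Pi_n|},\qquad u_n=\log|x_{n-1}'A_n|,\qquad v_n=\sum_{i=1}^n u_i=\log|x'\Pi_n|.$$ **Assumptions.** - (D0) All eigenvalues of $\mathbf E(A_1\otimes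 A_1)$ have modulus less than one. - (D1) The $\eta_{in}$ are i.i.d. with a symmetric continuous positive density which is nonincreasing on $[0,\infty)$, and they have moments of all orders. - (D2) $\mathbf E(\alpha_{11}-a_1)^{2m}\in(1,\infty)$ for some $m\in\mathbb N$, $m\ge 1$. - $a_q^2+\sigma_q^2>0$. **Tilted measure.** Let $\kappa(\lambda)=\lim_{n\to\infty}(\mathbf E|\Pi_n|^\lambda)^{1/n}$. There is exactly one $\lambda>0$ with $\kappa(\lambda)=1$. For this $\lambda$ there is a continuous $h:S\to(0,\infty)$ with $\mathbf E\,|x'A_1|^\lambda h\big(x'A_1/|x'A_1|\big)=h(x)$ for all $x\in S$. For every such $h$ there is exactly one family $(\tilde{\mathbf P}_x)_{x\in S}$ of laws of sequences $((x_n,u_n))_{n\ge1}$ in $S\times\mathbb R$, measurable in $x$, such that $$\tilde{\mathbf E}_xF(x_1,u_1,\dots,x_n,u_n)=\frac1{h(x)}\,\mathbf E\,|x'\Pi_n|^\lambda h(x_n)F(x_1,u_1,\dots,x_n,u_n)$$ for all $x\in S$, $n\ge0$ and all measurable $F\ge0$. **Proposition 4.3.** Under these assumptions $\tilde{\mathbf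 P}_x$ satisfies the following conditions, where $x_0=x$ and $v_n=u_1+\dots+u_n$ under $\tilde{\mathbf P}_x$. - (C1) For $n\ge0$ let $\mathcal F_n=\sigma\{x_0,x_1,u_1,\dots,x_n,u_n\}$. For every law of $x_0$ on $S$ (the conditional law of $((x_k,u_k))_{k\ge1}$ given $x_0$ being $\tilde{\mathbf P}_{x_0}$), every bounded measurable $f:\mathbb R\times(S\times\mathbb R)^{\mathbb N}\to\mathbb R$ and every real $\mathcal F_n$-measurable $\varrho$, almost surely $$\tilde{\mathbf E}\big(f(\varrho,x_{n+1},u_{n+1},x_{n+2},u_{n+2},\dots)\,\big|\,\mathcal F_n\big)=\Phi(x_n,\varrho),\qquad \Phi(x,a)=\tilde{\mathbf E}_xf(a,x_1,u_1,x_2,u_2,\dots).$$ Moreover, for every $m$ and every bounded continuous $f:(S\times\mathbb R)^m\to\mathbb R$, the function $x\mapsto\tilde{\mathbf E}_xf(x_1,u_1,\dots,x_m,u_m)$ is continuous on $S$. - (C2) There is a probability measure $\tilde\pi$ on $S$, equivalent to the Lebesgue (surface) measure on $S$ (for $q=1$: to the counting measure on $\{1,-1\}$), such that for all $x\in S$ $$\sup_{f\text{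 measurable},\,|f|\le1}\Big(\tilde{\mathbf E}_xf(x_n)-\int_S f\,d\tilde\pi\Big)\to0,\qquad n\to\infty.$$ Moreover, there is a constant $\beta>0$ such that for all $x\in S$, $\lim_{n\to\infty}v_n/n=\beta$ $\tilde{\mathbf P}_x$-a.s. - (C3) There is $m\ge1$ such that for all $\nu\in\mathbb R$ and $\delta>0$ there are $y\in S$ and $\varepsilon_0>0$ such that for all $0<\varepsilon<\varepsilon_0$ $$\inf_{x\in S,\,|x-y|<\delta}\tilde{\mathbf P}_x\big(|x_m-y|<\varepsilon,\ |v_m-\nu|<\delta\big)>0.$$ - (C4) There is $l\ge1$ such that for every bounded measurable $\Phi:S\times\mathbb R\times\mathbb R\to\mathbb R$ the function $\Phi_1(x,t)=\tilde{\mathbf E}_x\Phi(x_l,v_l,t)$ satisfies $$\sup_{|x-y|<\varepsilon}\ \sup_{t\in\mathbb R}|\Phi_1(x,t)-\Phi_1(y,t)|\to0,\qquad\varepsilon\to0.$$ -/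

import Mathlib

open MeasureTheory ProbabilityTheory Filter Topology

namespace RCA

/-- The unit sphere `S` of `ℝ^q` (Euclidean norm), with `q = d + 1 ≥ 1`. -/
abbrev Sph (d : ℕ) : Type := Metric.sphere (0 : EuclideanSpace ℝ (Fin (d + 1))) 1

/-- The row vector `x' A`, as a Euclidean vector. -/
noncomputable def rowMul {d : ℕ} (x : EuclideanSpace ℝ (Fin (d + 1)))
    (A : Matrix (Fin (d + 1)) (Fin (d + 1)) ℝ) : EuclideanSpace ℝ (Fin (d + 1)) :=
  WithLp.toLp 2 (Matrix.vecMul x.ofLp A)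

open Classical in
/-- The direction `z / |z|` of a nonzero vector `z`. The value `x` for `z = 0` is a convention; it
is only used on a null event, because the coefficient matrices are almost surely invertible. -/
noncomputable def direction {d : ℕ} (x : Sph d) (z : EuclideanSpace ℝ (Fin (d + 1))) : Sph d :=
  if hz : z = 0 then x
  else ⟨‖z‖⁻¹ • z, by
    rw [mem_sphere_zero_iff_norm, norm_smul, norm_inv, norm_norm,
      inv_mul_cancel₀ (norm_ne_zero_iff.mpr hz)]⟩

/-- The matrix norm `|A| = (tr A A')^{1/2}`. -/
noncomputable def matNorm {d : ℕ} (A : Matrix (Fin (d + 1)) (Fin (d + 1)) ℝ) : ℝ :=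
  Real.sqrt (A * A.transpose).trace

/-- The matrix with first row `(α_1, …, α_q)` above the block `(I_{q-1}, 0)`. -/
def companion {d : ℕ} (α : Fin (d + 1) → ℝ) : Matrix (Fin (d + 1)) (Fin (d + 1)) ℝ :=
  Matrix.of fun i j =>
    if i = 0 then α j else if (i : ℕ) = (j : ℕ) + 1 then 1 else 0

section Model

variable {Ω : Type*} {d : ℕ} (a σ : Fin (d + 1) → ℝ) (η : ℕ → Fin (d + 1) → Ω → ℝ)

/-- The random coefficients `α_i = a_i + σ_i η_i`. Time is shifted by one: the index `n : ℕ`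
stands for time `n + 1`, both here and in `coeffMat`. -/
def coeff (n : ℕ) (i : Fin (d + 1)) (ω : Ω) : ℝ := a i + σ i * η n i ω

/-- `coeffMat n` is the random coefficient matrix `A_{n+1}`. -/
def coeffMat (n : ℕ) (ω : Ω) : Matrix (Fin (d + 1)) (Fin (d + 1)) ℝ :=
  companion fun i => coeff a σ η n i ω

/-- `matProd n` is the product `Π_n = A_1 ⋯ A_n`. -/
def matProd : ℕ → Ω → Matrix (Fin (d + 1)) (Fin (d + 1)) ℝ
  | 0, _ => 1
  | n + 1, ω => matProd n ω * coeffMat a σ η n ω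

/-- `dirChain x n` is `x_n`: `x_0 = x` and `x_n' = x_{n-1}' A_n / |x_{n-1}' A_n|`. -/
noncomputable def dirChain (x : Sph d) : ℕ → Ω → Sph d
  | 0, _ => x
  | n + 1, ω =>
      direction (dirChain x n ω) (rowMul (dirChain x n ω : EuclideanSpace ℝ (Fin (d + 1)))
        (coeffMat a σ η n ω))

/-- `logIncr x n` is `u_{n+1} = log |x_n' A_{n+1}|`. -/
noncomputable def logIncr (x : Sph d) (n : ℕ) (ω : Ω) : ℝ :=
  Real.log ‖rowMul (dirChain a σ η x n ω : EuclideanSpace ℝ (Fin (d + 1))) (coeffMat a σ η n ω)‖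

variable [MeasurableSpace Ω] (P : Measure Ω)

/-- (D0): every (complex) eigenvalue of the matrix `E (A_1 ⊗ A_1)` has modulus less than one. -/
def CondD0 : Prop :=
  ∀ z : ℂ,
    Module.End.HasEigenvalue
      (Matrix.toLin' (Matrix.of fun r s : Fin (d + 1) × Fin (d + 1) =>
        ((∫ ω, Matrix.kronecker (coeffMat a σ η 0 ω) (coeffMat a σ η 0 ω) r s ∂P : ℝ) : ℂ))) z →
    ‖z‖ < 1

/-- (D1): the `η_{in}` are i.i.d. with a symmetric continuous positive density, nonincreasing on
`[0, ∞)`, and have moments of all orders. -/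
def CondD1 : Prop :=
  iIndepFun (fun p : ℕ × Fin (d + 1) => η p.1 p.2) P ∧
  (∃ φ : ℝ → ℝ, Continuous φ ∧ (∀ t, 0 < φ t) ∧ (∀ t, φ (-t) = φ t) ∧
    AntitoneOn φ (Set.Ici 0) ∧
    ∀ n i, P.map (η n i) = volume.withDensity fun t => ENNReal.ofReal (φ t)) ∧
  ∀ n i, ∀ k : ℕ, Integrable (fun ω => |η n i ω| ^ k) P

/-- (D2): `1 < E (α_{11} - a_1)^{2m} < ∞` for some `m ≥ 1`. -/
def CondD2 : Prop :=
  ∃ m : ℕ, 1 ≤ m ∧ Integrable (fun ω => (coeff a σ η 0 0 ω - a 0) ^ (2 * m)) P ∧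
    1 < ∫ ω, (coeff a σ η 0 0 ω - a 0) ^ (2 * m) ∂P

/-- `κ(lam) = c`, where `κ(lam) = lim_n (E |A_1 ⋯ A_n|^lam)^{1/n}`. -/
def KappaEq (lam c : ℝ) : Prop :=
  Tendsto (fun n : ℕ => (∫ ω, matNorm (matProd a σ η n ω) ^ lam ∂P) ^ (1 / (n : ℝ)))
    atTop (𝓝 c)

/-- `h` is a continuous positive function on `S` with `Q_lam h = h`, where
`Q_lam f (x) = E |x' A_1|^lam f (x' A_1 / |x' A_1|)`. -/
def IsTiltFunction (lam : ℝ) (h : Sph d → ℝ) : Prop :=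
  Continuous h ∧ (∀ x, 0 < h x) ∧
  ∀ x : Sph d,
    ∫ ω, ‖rowMul (x : EuclideanSpace ℝ (Fin (d + 1))) (coeffMat a σ η 0 ω)‖ ^ lam *
      h (direction x (rowMul (x : EuclideanSpace ℝ (Fin (d + 1))) (coeffMat a σ η 0 ω))) ∂P = h x

/-- `Pt` is the family `(P̃_x)` of exponentially tilted laws. `Pt x` is a probability measure on the
space of sequences `((x_1, u_1), (x_2, u_2), …)` such that, for all `n` and all measurable `F ≥ 0`,
`Ẽ_x F(x_1, u_1, …, x_n, u_n) = h(x)⁻¹ E |x' A_1 ⋯ A_n|^lam h(x_n) F(x_1, u_1, …, x_n, u_n)`. -/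
structure IsTiltedLaw (lam : ℝ) (h : Sph d → ℝ) (Pt : Kernel (Sph d) (ℕ → Sph d × ℝ)) : Prop where
  isMarkov : IsMarkovKernel Pt
  findim : ∀ (x : Sph d) (n : ℕ) (F : (Fin n → Sph d × ℝ) → ENNReal), Measurable F →
    ∫⁻ w, F (fun k => w k) ∂(Pt x) =
      ENNReal.ofReal (h x)⁻¹ *
        ∫⁻ ω, ENNReal.ofReal
            (‖rowMul (x : EuclideanSpace ℝ (Fin (d + 1))) (matProd a σ η n ω)‖ ^ lam *
              h (dirChain a σ η x n ω)) *
          F (fun k => (dirChain a σ η x (k + 1) ω, logIncr a σ η x k ω)) ∂P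

end Model

section Renewal

/-! Conditions on a family `(P_x)_{x ∈ S}` of laws of `((x_1, u_1), (x_2, u_2), …)`, where `x` is the
initial value `x_0`. An element `w` of the sequence space has `w k = (x_{k+1}, u_{k+1})`. -/

variable {d : ℕ}

/-- `x_n` as a function of the initial value and of the sequence. -/
def pathX (x : Sph d) (w : ℕ → Sph d × ℝ) : ℕ → Sph d
  | 0 => x
  | n + 1 => (w n).1

/-- `v_n = u_1 + ⋯ + u_n`. -/
noncomputable def pathV (w : ℕ → Sph d × ℝ) (n : ℕ) : ℝ := ∑ k ∈ Finset.range n, (w k).2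

/-- `F_n = σ(x_0, x_1, u_1, …, x_n, u_n)`, on the space of pairs `(x_0, w)`. -/
abbrev pathFil (d n : ℕ) : MeasurableSpace (Sph d × (ℕ → Sph d × ℝ)) :=
  MeasurableSpace.comap
    (fun p : Sph d × (ℕ → Sph d × ℝ) => (p.1, fun k : Fin n => p.2 k)) inferInstance

/-- (C1): the Markov property, for every law `μ` of `x_0` (so that `(x_0, w)` has law
`μ(dx) P_x(dw)`), every bounded measurable `f` and every `F_n`-measurable `ϱ`; and continuity
of `x ↦ E_x f(x_1, u_1, …, x_m, u_m)` for bounded continuous `f`. -/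
def CondC1 (Q : Kernel (Sph d) (ℕ → Sph d × ℝ)) : Prop :=
  (∀ (μ : Measure (Sph d)), IsProbabilityMeasure μ →
    ∀ (n : ℕ) (f : ℝ × (ℕ → Sph d × ℝ) → ℝ), Measurable f → (∃ C, ∀ z, |f z| ≤ C) →
    ∀ ϱ : Sph d × (ℕ → Sph d × ℝ) → ℝ, Measurable[pathFil d n] ϱ →
      (μ ⊗ₘ Q)[fun p => f (ϱ p, fun k => p.2 (n + k)) | pathFil d n]
        =ᵐ[μ ⊗ₘ Q] fun p => ∫ w, f (ϱ p, w) ∂(Q (pathX p.1 p.2 n))) ∧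
  ∀ (m : ℕ) (f : (Fin m → Sph d × ℝ) → ℝ), Continuous f → (∃ C, ∀ z, |f z| ≤ C) →
    Continuous fun x => ∫ w, f (fun k => w k) ∂(Q x)

/-- The total variation `sup_{|f| ≤ 1} (∫ f dμ - ∫ f dν)` of `μ - ν`. -/
noncomputable def tvDist (μ ν : Measure (Sph d)) : ℝ :=
  sSup {r : ℝ | ∃ f : Sph d → ℝ, Measurable f ∧ (∀ y, |f y| ≤ 1) ∧ r = ∫ y, f y ∂μ - ∫ y, f y ∂ν}

/-- (C2): convergence in total variation of the law of `x_n` under `P_x`, for every `x`, to a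
probability measure equivalent to the surface measure of `S` (for `q = 1` this is the counting
measure on `{1, -1}`), and `v_n / n → β > 0` almost surely under every `P_x`. -/
def CondC2 (Q : Kernel (Sph d) (ℕ → Sph d × ℝ)) : Prop :=
  (∃ π : Measure (Sph d), IsProbabilityMeasure π ∧
    π ≪ (volume : Measure (EuclideanSpace ℝ (Fin (d + 1)))).toSphere ∧
    (volume : Measure (EuclideanSpace ℝ (Fin (d + 1)))).toSphere ≪ π ∧
    ∀ x, Tendsto (fun n : ℕ => tvDist ((Q x).map fun w => pathX x w n) π) atTop (𝓝 0)) ∧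
  ∃ β : ℝ, 0 < β ∧
    ∀ x, ∀ᵐ w ∂(Q x), Tendsto (fun n : ℕ => pathV w n / n) atTop (𝓝 β)

/-- (C3): the reachability condition. -/
def CondC3 (Q : Kernel (Sph d) (ℕ → Sph d × ℝ)) : Prop :=
  ∃ m : ℕ, 1 ≤ m ∧ ∀ ν δ : ℝ, 0 < δ → ∃ y : Sph d, ∃ ε₀ : ℝ, 0 < ε₀ ∧
    ∀ ε : ℝ, 0 < ε → ε < ε₀ →
      0 < ⨅ x ∈ {x : Sph d | dist x y < δ},
        Q x {w | dist (pathX x w m) y < ε ∧ |pathV w m - ν| < δ}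

/-- (C4): for some `l`, all functions `(x, t) ↦ E_x Φ(x_l, v_l, t)` with `Φ` bounded measurable are
uniformly continuous in `x`, uniformly in `t`. -/
def CondC4 (Q : Kernel (Sph d) (ℕ → Sph d × ℝ)) : Prop :=
  ∃ l : ℕ, 1 ≤ l ∧ ∀ Φ : Sph d × ℝ × ℝ → ℝ, Measurable Φ → (∃ C, ∀ z, |Φ z| ≤ C) →
    ∀ e : ℝ, 0 < e → ∃ ε : ℝ, 0 < ε ∧ ∀ x y : Sph d, dist x y < ε → ∀ t : ℝ,
      |∫ w, Φ (pathX x w l, pathV w l, t) ∂(Q x) -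
        ∫ w, Φ (pathX y w l, pathV w l, t) ∂(Q y)| ≤ e

end Renewal

end RCA

/-!
# The exponentially tilted random recursion

Write `step z e = z' A` for the companion matrix `A` with first row `a i + σ i * e i`. The noise has
a positive density and `σ 0 > 0`, so that the first entry of `step z e` has a continuous positive
density whenever `z 0 ≠ 0`, while the other entries are the old ones shifted by one place, up to
multiples of `z 0`. Everything rests on two consequences for the recursion on `ℝ^q`, `q = d + 1`.

* Smoothing. By Scheffé's lemma in one dimension (`tendsto_integral_affine`), every step makes the
  expectation of a bounded measurable function equicontinuous in one more coordinate, and at most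
  `d` steps are needed to leave the hyperplane `z 0 = 0`. Hence `z ↦ E f (z' Π_l)` is continuous off
  the origin for `l ≥ 2 d + 1`, uniformly in `|f| ≤ 1` (`tendsto_transOp_iterate_sub`).
* Irreducibility. The vector can be steered from any nonzero point into any open set, and the step
  map preserves Lebesgue null sets because `a_q ^ 2 + σ_q ^ 2 > 0`. Hence, for `l ≥ 4 d + 2`, the
  law of `z' Π_l` has the null sets of Lebesgue measure (`transOp_iterate_eq_zero_iff`).

Both extend by truncation to functions of growth `|z| ^ lam`, thus to the operator
`Q_lam f (x) = E |x' A| ^ lam f (x' A / |x' A|)` and to the tilted laws, as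
`Ẽ_x G (x_n, v_n) = h(x)⁻¹ E g (x' Π_n)` with `g(z) = |z| ^ lam h(z / |z|) G (z / |z|, log |z|)`.

*The exponent.* The moments `E |Π_n| ^ lam` are submultiplicative up to a constant, because they are
comparable to `sup Q_lam ^ n 1`; so `κ` exists by Fekete's lemma. It is logarithmically convex by
Hölder's inequality, `κ(0) = 1`, and `κ(2) < 1` by Gelfand's formula for `E (A ⊗ A)`. Finally
`κ(2m) > 1`, since for a symmetric variable adding a constant does not decrease the moments. So
`κ = 1` at exactly one positive exponent, and this exponent is larger than two
(`IsNoise.existsUnique_exponent`, `IsNoise.two_lt_of_kappaEq_one`).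

*The tilt function.* If the resolvents `∑ r⁻ⁿ Q_lam ^ n 1` stayed bounded as `r ↓ 1`, then
`Q_lam ^ n 1` would decay exponentially, against `κ(lam) = 1`. After normalization they are almost
fixed by `Q_lam`. By smoothing and the Arzelà-Ascoli theorem a power of `Q_lam` is compact, so that
they have a limit point. It is a fixed function, and it is positive by irreducibility
(`IsNoise.exists_fixed`).

*The tilted laws.* The kernel of one tilted step is a Markov kernel because `Q_lam h = h`. The laws
of the corresponding Markov chain, constructed by the Ionescu-Tulcea theorem, have the required
finite-dimensional laws, which determine them (`IsFixedTilt.exists_tiltedLaw`). This also gives the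
Markov property, while the remaining continuity and reachability properties are smoothing and
irreducibility.

*Ergodicity.* The laws of `x_l` for different starting points are equivalent to each other and
depend continuously on the starting point in total variation. By compactness their total variation
distances are bounded away from the maximal value, so that `x_n` forgets its starting point
exponentially fast (`IsTiltedLaw.exists_contraction`). Its limit law is invariant, hence equivalent
to the surface measure (`IsTiltedLaw.exists_invariant`). Exponential ergodicity and the second
moments of the increments make the variance of `v_n` grow at most linearly
(`IsChain.exists_integral_sq_le`), which yields the law of large numbers. The limit of `v_n / n` is
positive because `Ẽ_x exp (-(lam - 2) v_n) ≤ C E |Π_n| ^ 2` decays exponentially and `lam > 2`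
(`IsTiltedLaw.exists_eventually_le_pathV`).
-/

namespace RCA

/-! ### One-dimensional smoothing -/

lemma integral_affine_mul_density {φ g : ℝ → ℝ} {b : ℝ} (hb : b ≠ 0) (c : ℝ) :
    ∫ t, g (b * t + c) * φ t = ∫ s, g s * (|b⁻¹| * φ ((s - c) / b)) := by
  have h1 := Measure.integral_comp_mul_left (fun s => g (s + c) * φ ((s + c - c) / b)) b
  have h2 := integral_add_right_eq_self (μ := volume) (fun s => g s * φ ((s - c) / b)) c
  rw [h2] at h1
  have h3 : ∀ t, (b * t + c - c) / b = t := fun t => by field_simp; ring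
  simp only [h3] at h1
  rw [h1, smul_eq_mul, ← integral_const_mul]
  congr 1; ext s; ring

lemma integrable_affine_density {φ : ℝ → ℝ} (hφ : Integrable φ) {b : ℝ} (hb : b ≠ 0) (c : ℝ) :
    Integrable fun s => |b⁻¹| * φ ((s - c) / b) := by
  have : Integrable fun s => φ (s / b) := hφ.comp_div hb
  exact (this.comp_sub_right c).const_mul _

/-- Scheffé's lemma for the affine images of a fixed density: their laws depend continuously, in
total variation, on the coefficients. -/
lemma tendsto_integral_affine {φ : ℝ → ℝ} (hφc : Continuous φ) (hφ0 : ∀ t, 0 ≤ φ t)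
    (hφ : Integrable φ) {b c : ℕ → ℝ} {b₀ c₀ C : ℝ} (hb : Tendsto b atTop (𝓝 b₀)) (hb₀ : b₀ ≠ 0)
    (hc : Tendsto c atTop (𝓝 c₀)) {g : ℕ → ℝ → ℝ} (hg : ∀ n, Measurable (g n))
    (hgC : ∀ n t, |g n t| ≤ C) :
    Tendsto (fun n => (∫ t, g n (b n * t + c n) * φ t) - ∫ t, g n (b₀ * t + c₀) * φ t)
      atTop (𝓝 0) := by
  set p : ℕ → ℝ → ℝ := fun n s => |(b n)⁻¹| * φ ((s - c n) / b n) with hp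
  set p₀ : ℝ → ℝ := fun s => |b₀⁻¹| * φ ((s - c₀) / b₀) with hp₀
  have hbn : ∀ᶠ n in atTop, b n ≠ 0 := hb.eventually_ne hb₀
  have hp₀i : Integrable p₀ := integrable_affine_density hφ hb₀ c₀
  have hp₀n : ∀ s, 0 ≤ p₀ s := fun s => mul_nonneg (abs_nonneg _) (hφ0 _)
  have hpn : ∀ n s, 0 ≤ p n s := fun n s => mul_nonneg (abs_nonneg _) (hφ0 _)
  have hpm : ∀ n, Measurable (p n) := fun n => by
    have := hφc.measurable
    fun_prop
  have hpt : ∀ s, Tendsto (fun n => p n s) atTop (𝓝 (p₀ s)) := fun s => by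
    refine ((hb.inv₀ hb₀).abs).mul ((hφc.tendsto _).comp ?_)
    exact (tendsto_const_nhds.sub hc).div hb hb₀
  have hmass : ∀ {b : ℝ} (_ : b ≠ 0) (c : ℝ), ∫ s, |b⁻¹| * φ ((s - c) / b) = ∫ t, φ t := by
    intro b hb c
    have := integral_affine_mul_density (φ := φ) (g := fun _ => 1) hb c
    simpa using this.symm
  -- the positive part of `p₀ - p n` tends to `0` in `L¹`, and both have the same mass
  have hpos : Tendsto (fun n => ∫ s, max (p₀ s - p n s) 0) atTop (𝓝 0) := by
    rw [show 𝓝 (0 : ℝ) = 𝓝 (∫ _ : ℝ, (0 : ℝ)) by simp]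
    refine tendsto_integral_of_dominated_convergence p₀ (fun n => ?_) hp₀i (fun n => ?_) ?_
    · have := hpm n
      have h2 : Measurable p₀ := by have := hφc.measurable; fun_prop
      exact ((h2.sub this).max measurable_const).aestronglyMeasurable
    · refine ae_of_all _ fun s => ?_
      have h3 : 0 ≤ max (p₀ s - p n s) 0 := le_max_right _ _
      rw [Real.norm_eq_abs, abs_of_nonneg h3]
      exact max_le (by linarith [hpn n s]) (hp₀n s)
    · refine ae_of_all _ fun s => ?_
      have := (tendsto_const_nhds (x := p₀ s)).sub (hpt s)
      simpa using this.max (tendsto_const_nhds (x := (0 : ℝ)))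
  have hL1 : Tendsto (fun n => ∫ s, |p n s - p₀ s|) atTop (𝓝 0) := by
    have h2 : Tendsto (fun n => 2 * ∫ s, max (p₀ s - p n s) 0) atTop (𝓝 0) := by
      simpa using hpos.const_mul 2
    refine h2.congr' ?_
    filter_upwards [hbn] with n hn
    have hpi : Integrable (p n) := integrable_affine_density hφ hn (c n)
    have e1 : ∀ s, |p n s - p₀ s| = 2 * max (p₀ s - p n s) 0 - (p₀ s - p n s) := fun s => by
      rcases le_total (p₀ s) (p n s) with h | h
      · rw [abs_of_nonneg (by linarith), max_eq_right (by linarith)]; ring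
      · rw [abs_of_nonpos (by linarith), max_eq_left (by linarith)]; ring
    have e2 : Integrable fun s => p₀ s - p n s := hp₀i.sub hpi
    simp_rw [e1]
    rw [integral_sub (e2.pos_part.const_mul 2) e2, integral_const_mul,
      integral_sub hp₀i hpi, hmass hn, hmass hb₀]
    simp
  have hC : Tendsto (fun n => C * ∫ s, |p n s - p₀ s|) atTop (𝓝 0) := by
    simpa using hL1.const_mul C
  refine squeeze_zero_norm' ?_ hC
  filter_upwards [hbn] with n hn
  have hpi : Integrable (p n) := integrable_affine_density hφ hn (c n)
  have hgi : ∀ {q : ℝ → ℝ}, Integrable q → Integrable fun s => g n s * q s := fun hq =>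
    hq.bdd_mul (hg n).aestronglyMeasurable (ae_of_all _ fun s => hgC n s)
  rw [integral_affine_mul_density (g := g n) hn, integral_affine_mul_density (g := g n) hb₀,
      ← integral_sub (hgi hpi) (hgi hp₀i), ← integral_const_mul]
  refine norm_integral_le_of_norm_le ((hpi.sub hp₀i).abs.const_mul C) (ae_of_all _ fun s => ?_)
  rw [← mul_sub, norm_mul]
  exact mul_le_mul_of_nonneg_right (hgC n s) (abs_nonneg _)

variable {d : ℕ}

/-! ### The one-step map and its transition operator -/

/-- One step of the linear recursion: `z' A` for the companion matrix `A` with first row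
`a + σ e`. -/
noncomputable def step (a σ : Fin (d + 1) → ℝ) (z : EuclideanSpace ℝ (Fin (d + 1)))
    (e : Fin (d + 1) → ℝ) : EuclideanSpace ℝ (Fin (d + 1)) :=
  rowMul z (companion fun i => a i + σ i * e i)

/-- The entry of `z` that follows the `j`-th one, with `0` after the last one. -/
noncomputable def nextCoord (z : EuclideanSpace ℝ (Fin (d + 1))) (j : Fin (d + 1)) : ℝ :=
  if h : (j : ℕ) + 1 < d + 1 then z ⟨j + 1, h⟩ else 0

lemma rowMul_companion_apply (α : Fin (d + 1) → ℝ) (z : EuclideanSpace ℝ (Fin (d + 1)))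
    (j : Fin (d + 1)) : rowMul z (companion α) j = z 0 * α j + nextCoord z j := by
  simp only [rowMul, companion, Matrix.vecMul, dotProduct, Matrix.of_apply, nextCoord]
  rw [Fin.sum_univ_succ]
  congr 1
  split_ifs with h
  · rw [Finset.sum_eq_single (⟨j, by omega⟩ : Fin d)]
    · simp
    · intro b _ hb
      have : ¬ ((b : ℕ) = j) := fun h' => hb (Fin.ext h')
      simp [this]
    · simp
  · refine Finset.sum_eq_zero fun i _ => ?_
    have : ¬ ((i : ℕ) = j) := by omega
    simp [this]

variable (a σ : Fin (d + 1) → ℝ)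

lemma step_apply (z : EuclideanSpace ℝ (Fin (d + 1))) (e : Fin (d + 1) → ℝ) (j : Fin (d + 1)) :
    step a σ z e j = z 0 * (a j + σ j * e j) + nextCoord z j :=
  rowMul_companion_apply _ z j

lemma continuous_nextCoord (j : Fin (d + 1)) :
    Continuous fun z : EuclideanSpace ℝ (Fin (d + 1)) => nextCoord z j := by
  unfold nextCoord
  split_ifs <;> fun_prop

lemma continuous_step :
    Continuous fun p : EuclideanSpace ℝ (Fin (d + 1)) × (Fin (d + 1) → ℝ) => step a σ p.1 p.2 := by
  have : (fun p : EuclideanSpace ℝ (Fin (d + 1)) × (Fin (d + 1) → ℝ) => step a σ p.1 p.2) =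
      fun p => WithLp.toLp 2 fun j => p.1 0 * (a j + σ j * p.2 j) + nextCoord p.1 j := by
    ext p j; exact step_apply a σ p.1 p.2 j
  rw [this]
  refine (PiLp.continuous_toLp 2 _).comp (continuous_pi fun j => ?_)
  have := (continuous_nextCoord j).comp (continuous_fst (X := EuclideanSpace ℝ (Fin (d + 1)))
    (Y := Fin (d + 1) → ℝ))
  simp only [Function.comp_def] at this
  fun_prop

lemma measurable_step :
    Measurable fun p : EuclideanSpace ℝ (Fin (d + 1)) × (Fin (d + 1) → ℝ) => step a σ p.1 p.2 :=
  (continuous_step a σ).measurable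

/-- The standing assumptions on the common law `ρ` of the noise variables and on the coefficients:
`ρ` has a symmetric continuous positive density and moments of all orders, the first coefficient
is random, and the last one is not identically zero. -/
structure NoiseLaw (a σ : Fin (d + 1) → ℝ) (ρ : Measure ℝ) : Prop where
  prob : IsProbabilityMeasure ρ
  density : ∃ φ : ℝ → ℝ, Continuous φ ∧ (∀ t, 0 < φ t) ∧ (∀ t, φ (-t) = φ t) ∧
    ρ = volume.withDensity fun t => ENNReal.ofReal (φ t)
  moments : ∀ k : ℕ, Integrable (fun t : ℝ => |t| ^ k) ρ
  first : 0 < σ 0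
  last : a (Fin.last d) ≠ 0 ∨ σ (Fin.last d) ≠ 0

/-- The transition operator of the linear recursion on bounded functions. -/
noncomputable def transOp (ρ : Measure ℝ) (f : EuclideanSpace ℝ (Fin (d + 1)) → ℝ)
    (z : EuclideanSpace ℝ (Fin (d + 1))) : ℝ :=
  ∫ e, f (step a σ z e) ∂(Measure.pi fun _ => ρ)

variable {a σ} {ρ : Measure ℝ}

lemma NoiseLaw.integral_eq (H : NoiseLaw a σ ρ) : ∃ φ : ℝ → ℝ, Continuous φ ∧ (∀ t, 0 < φ t) ∧
    Integrable φ ∧ ∀ f : ℝ → ℝ, ∫ t, f t ∂ρ = ∫ t, f t * φ t := by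
  obtain ⟨φ, hc, hpos, -, hρ⟩ := H.density
  have hm : Measurable φ := hc.measurable
  refine ⟨φ, hc, hpos, ?_, fun f => ?_⟩
  · refine ⟨hm.aestronglyMeasurable, ?_⟩
    have h1 : ∫⁻ t, ENNReal.ofReal (φ t) = 1 := by
      have := H.prob.measure_univ
      rwa [hρ, withDensity_apply _ MeasurableSet.univ, Measure.restrict_univ] at this
    rw [hasFiniteIntegral_iff_ofReal (ae_of_all _ fun t => (hpos t).le), h1]
    exact ENNReal.one_lt_top
  · rw [hρ, integral_withDensity_eq_integral_toReal_smul (by fun_prop)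
      (ae_of_all _ fun t => ENNReal.ofReal_lt_top)]
    refine integral_congr_ae (ae_of_all _ fun t => ?_)
    simp [ENNReal.toReal_ofReal (hpos t).le, mul_comm]

lemma NoiseLaw.absolutelyContinuous (H : NoiseLaw a σ ρ) : ρ ≪ volume := by
  obtain ⟨φ, -, -, -, hρ⟩ := H.density
  rw [hρ]; exact withDensity_absolutelyContinuous _ _

lemma NoiseLaw.nullSingletonClass (H : NoiseLaw a σ ρ) : NullSingletonClass ρ :=
  ⟨fun x => H.absolutelyContinuous (by simp)⟩

lemma NoiseLaw.isOpenPosMeasure (H : NoiseLaw a σ ρ) : ρ.IsOpenPosMeasure := by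
  obtain ⟨φ, hc, hpos, -, hρ⟩ := H.density
  have h : (volume : Measure ℝ) ≪ ρ := by
    rw [hρ]
    exact withDensity_absolutelyContinuous' (by fun_prop)
      (ae_of_all _ fun t => by simpa using hpos t)
  exact h.isOpenPosMeasure

lemma measurable_transOp [SigmaFinite ρ] {f : EuclideanSpace ℝ (Fin (d + 1)) → ℝ}
    (hf : Measurable f) :
    Measurable (transOp a σ ρ f) := by
  have h : StronglyMeasurable fun p : EuclideanSpace ℝ (Fin (d + 1)) × (Fin (d + 1) → ℝ) =>
      f (step a σ p.1 p.2) := (hf.comp (measurable_step a σ)).stronglyMeasurable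
  exact h.integral_prod_right'.measurable

lemma abs_transOp_le [IsProbabilityMeasure ρ] {f : EuclideanSpace ℝ (Fin (d + 1)) → ℝ} {C : ℝ}
    (hf : ∀ z, |f z| ≤ C) (z : EuclideanSpace ℝ (Fin (d + 1))) : |transOp a σ ρ f z| ≤ C := by
  have := norm_integral_le_of_norm_le_const (μ := Measure.pi fun _ : Fin (d + 1) => ρ)
    (f := fun e => f (step a σ z e)) (ae_of_all _ fun e => hf (step a σ z e))
  simpa [transOp] using this

lemma measurable_transOp_iterate [SigmaFinite ρ] {f : EuclideanSpace ℝ (Fin (d + 1)) → ℝ}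
    (hf : Measurable f) (n : ℕ) : Measurable ((transOp a σ ρ)^[n] f) := by
  induction n with
  | zero => exact hf
  | succ n ih => rw [Function.iterate_succ_apply']; exact measurable_transOp ih

lemma abs_transOp_iterate_le [IsProbabilityMeasure ρ] {f : EuclideanSpace ℝ (Fin (d + 1)) → ℝ}
    {C : ℝ} (hf : ∀ z, |f z| ≤ C) (n : ℕ) (z : EuclideanSpace ℝ (Fin (d + 1))) :
    |(transOp a σ ρ)^[n] f z| ≤ C := by
  induction n generalizing z with
  | zero => exact hf z
  | succ n ih => rw [Function.iterate_succ_apply']; exact abs_transOp_le ih z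

lemma integrable_comp_step [IsProbabilityMeasure ρ] {f : EuclideanSpace ℝ (Fin (d + 1)) → ℝ}
    (hf : Measurable f) {C : ℝ} (hC : ∀ z, |f z| ≤ C) (z : EuclideanSpace ℝ (Fin (d + 1))) :
    Integrable (fun e => f (step a σ z e)) (Measure.pi fun _ : Fin (d + 1) => ρ) :=
  Integrable.of_bound ((hf.comp ((measurable_step a σ).comp
    measurable_prodMk_left)).aestronglyMeasurable) C (ae_of_all _ fun _ => hC _)

/-- The vector with first entry `s` and remaining entries `w`. -/
noncomputable def consVec (s : ℝ) (w : Fin d → ℝ) : EuclideanSpace ℝ (Fin (d + 1)) :=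
  WithLp.toLp 2 (Fin.cons s w)

lemma measurable_consVec : Measurable fun p : ℝ × (Fin d → ℝ) => consVec p.1 p.2 := by
  have : Continuous fun p : ℝ × (Fin d → ℝ) => consVec p.1 p.2 := by
    refine (PiLp.continuous_toLp 2 _).comp (continuous_pi fun j => ?_)
    refine Fin.cases ?_ (fun i => ?_) j
    · simpa using continuous_fst
    · simp only [Fin.cons_succ]; fun_prop
  exact this.measurable

lemma step_cons (z : EuclideanSpace ℝ (Fin (d + 1))) (t : ℝ) (θ : Fin d → ℝ) :
    step a σ z (Fin.cons t θ) = consVec (z 0 * σ 0 * t + (z 0 * a 0 + nextCoord z 0))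
      fun i => z 0 * (a i.succ + σ i.succ * θ i) + nextCoord z i.succ := by
  ext j
  rw [step_apply]
  refine Fin.cases ?_ (fun i => ?_) j
  · simp [consVec]; ring
  · simp [consVec]

lemma integral_pi_cons [SigmaFinite ρ] {f : (Fin (d + 1) → ℝ) → ℝ}
    (hf : Integrable f (Measure.pi fun _ => ρ)) :
    ∫ e, f e ∂(Measure.pi fun _ => ρ) =
      ∫ θ, ∫ t, f (Fin.cons t θ) ∂ρ ∂(Measure.pi fun _ : Fin d => ρ) := by
  have h := (measurePreserving_piFinSuccAbove (fun _ : Fin (d + 1) => ρ) 0).symm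
  have e : ∀ p : ℝ × (Fin d → ℝ),
      (MeasurableEquiv.piFinSuccAbove (fun _ : Fin (d + 1) => ℝ) 0).symm p = Fin.cons p.1 p.2 :=
    fun p => by simp [MeasurableEquiv.piFinSuccAbove, Fin.insertNthEquiv]
  rw [← h.integral_comp (MeasurableEquiv.measurableEmbedding _)]
  have hi : Integrable (fun p : ℝ × (Fin d → ℝ) => f (Fin.cons p.1 p.2))
      (ρ.prod (Measure.pi fun _ : Fin d => ρ)) := by
    have := h.integrable_comp_of_integrable hf
    simpa only [Function.comp_def, e] using this
  simp only [e]
  exact integral_prod_symm _ hi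

end RCA

namespace RCA
variable {d : ℕ} {a σ : Fin (d + 1) → ℝ} {ρ : Measure ℝ}

/-! ### Smoothing by the transition operator -/

/-- One application of the transition operator gains one coordinate of equicontinuity. If the
functions `F n` are equicontinuous, off the hyperplane `z 0 = 0`, in the coordinates `1, …, k`, then
the functions `transOp (F n)` are so in the coordinates `1, …, k + 1`, and in all coordinates
if `k = d`. The new coordinate enters only through the first entry of the next state, which has a
density. -/
lemma tendsto_transOp_sub (H : NoiseLaw a σ ρ) {k : ℕ}
    {F : ℕ → EuclideanSpace ℝ (Fin (d + 1)) → ℝ} (hF : ∀ n, Measurable (F n)) {C : ℝ}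
    (hC : ∀ n z, |F n z| ≤ C)
    (hT : ∀ z : EuclideanSpace ℝ (Fin (d + 1)), z 0 ≠ 0 →
      ∀ zs : ℕ → EuclideanSpace ℝ (Fin (d + 1)), Tendsto zs atTop (𝓝 z) →
      (∀ n (j : Fin (d + 1)), j = 0 ∨ k < (j : ℕ) → zs n j = z j) →
      Tendsto (fun n => F n (zs n) - F n z) atTop (𝓝 0))
    {z : EuclideanSpace ℝ (Fin (d + 1))} (hz : z 0 ≠ 0)
    {zs : ℕ → EuclideanSpace ℝ (Fin (d + 1))} (hzs : Tendsto zs atTop (𝓝 z))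
    (hco : ∀ n (j : Fin (d + 1)), k + 1 < (j : ℕ) → zs n j = z j)
    (h0 : (∀ n, zs n 0 = z 0) ∨ d ≤ k) :
    Tendsto (fun n => transOp a σ ρ (F n) (zs n) - transOp a σ ρ (F n) z) atTop (𝓝 0) := by
  have := H.prob
  obtain ⟨φ, hφc, hφ0, hφ, hρ⟩ := H.integral_eq
  -- The next state has first entry `b y * t + c y`, where `t` is the first noise variable, and
  -- remaining entries `W y θ`, where `θ` consists of the other noise variables.
  set b : EuclideanSpace ℝ (Fin (d + 1)) → ℝ := fun y => y 0 * σ 0 with hb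
  set c : EuclideanSpace ℝ (Fin (d + 1)) → ℝ := fun y => y 0 * a 0 + nextCoord y 0 with hc
  set W : EuclideanSpace ℝ (Fin (d + 1)) → (Fin d → ℝ) → (Fin d → ℝ) := fun y θ i =>
    y 0 * (a i.succ + σ i.succ * θ i) + nextCoord y i.succ with hW
  have hcoord : ∀ j, Tendsto (fun n => zs n j) atTop (𝓝 (z j)) := fun j =>
    ((by fun_prop : Continuous fun y : EuclideanSpace ℝ (Fin (d + 1)) => y j).tendsto z).comp hzs
  have hnext : ∀ j, Tendsto (fun n => nextCoord (zs n) j) atTop (𝓝 (nextCoord z j)) := fun j =>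
    ((continuous_nextCoord j).tendsto z).comp hzs
  have hWn : ∀ θ i, Tendsto (fun n => W (zs n) θ i) atTop (𝓝 (W z θ i)) := fun θ i =>
    ((hcoord 0).mul_const _).add (hnext _)
  have hmeas : ∀ n w, Measurable fun s => F n (consVec s w) := fun n w =>
    (hF n).comp (measurable_consVec.comp measurable_prodMk_right)
  have hcons_cont : ∀ s : ℝ, Continuous fun w : Fin d → ℝ => consVec s w := fun s => by
    refine (PiLp.continuous_toLp 2 _).comp (continuous_pi fun j => ?_)
    refine Fin.cases ?_ (fun i => ?_) j
    · simpa using continuous_const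
    · simp only [Fin.cons_succ]; fun_prop
  have hb0 : b z ≠ 0 := mul_ne_zero hz H.first.ne'
  have hinner : ∀ θ : Fin d → ℝ, Tendsto (fun n =>
      ∫ t, F n (consVec (b (zs n) * t + c (zs n)) (W (zs n) θ)) ∂ρ -
      ∫ t, F n (consVec (b z * t + c z) (W z θ)) ∂ρ) atTop (𝓝 0) := by
    intro θ
    -- The law of the first entry converges in total variation.
    have h1 : Tendsto (fun n =>
        ∫ t, F n (consVec (b (zs n) * t + c (zs n)) (W (zs n) θ)) ∂ρ -
        ∫ t, F n (consVec (b z * t + c z) (W (zs n) θ)) ∂ρ) atTop (𝓝 0) := by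
      simp only [hρ]
      exact tendsto_integral_affine (g := fun n s => F n (consVec s (W (zs n) θ))) hφc
        (fun t => (hφ0 t).le) hφ ((hcoord 0).mul_const _) hb0
        (((hcoord 0).mul_const _).add (hnext 0)) (fun n => hmeas n _) (fun n t => hC n _)
    -- The other entries converge pointwise, so that the equicontinuity of `F` applies.
    have h2 : Tendsto (fun n =>
        ∫ t, (F n (consVec (b z * t + c z) (W (zs n) θ)) -
        F n (consVec (b z * t + c z) (W z θ))) ∂ρ) atTop (𝓝 (∫ _, (0 : ℝ) ∂ρ)) := by
      refine tendsto_integral_of_dominated_convergence (fun _ => C + C) (fun n => ?_)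
        (integrable_const _) (fun n => ae_of_all _ fun t => ?_) ?_
      · exact (((hmeas n _).comp (by fun_prop)).sub
          ((hmeas n _).comp (by fun_prop))).aestronglyMeasurable
      · exact (norm_sub_le _ _).trans (add_le_add (hC n _) (hC n _))
      · have hne : ∀ᵐ t ∂ρ, t ≠ -c z / b z := by
          have := H.nullSingletonClass
          exact ae_iff.2 (by simp)
        filter_upwards [hne] with t ht
        refine hT _ ?_ _ (((hcons_cont _).tendsto _).comp (tendsto_pi_nhds.2 (hWn θ))) ?_
        · intro h
          apply ht
          simp only [consVec, Fin.cons_zero] at h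
          field_simp
          linarith
        · intro n j hj
          rcases Fin.eq_zero_or_eq_succ j with rfl | ⟨i, rfl⟩
          · simp [consVec]
          · have hi : k < (i : ℕ) + 1 := by simpa using hj
            have hzs0 : zs n 0 = z 0 := by
              rcases h0 with h0 | h0
              · exact h0 n
              · exact absurd i.2 (by omega)
            have : nextCoord (zs n) i.succ = nextCoord z i.succ := by
              unfold nextCoord
              split_ifs with h
              · exact hco n _ (by simpa using hi)
              · rfl
            simp [consVec, hW, hzs0, this]
    simp only [integral_zero] at h2
    have h12 := h1.add h2
    rw [add_zero] at h12
    refine h12.congr fun n => ?_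
    rw [integral_sub]
    · ring
    · exact Integrable.of_bound (((hmeas n _).comp (by fun_prop)).aestronglyMeasurable) C
        (ae_of_all _ fun t => hC n _)
    · exact Integrable.of_bound (((hmeas n _).comp (by fun_prop)).aestronglyMeasurable) C
        (ae_of_all _ fun t => hC n _)
  have hexp : ∀ n y, transOp a σ ρ (F n) y =
      ∫ θ, ∫ t, F n (consVec (b y * t + c y) (W y θ)) ∂ρ ∂(Measure.pi fun _ : Fin d => ρ) := by
    intro n y
    rw [transOp, integral_pi_cons (integrable_comp_step (hF n) (hC n) y)]
    simp only [step_cons, hb, hc, hW]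
  have hWc : ∀ y, Continuous (W y) := fun y => by
    refine continuous_pi fun i => ?_
    simp only [hW]; fun_prop
  have hjm : ∀ n y, Measurable fun p : (Fin d → ℝ) × ℝ =>
      F n (consVec (b y * p.2 + c y) (W y p.1)) := fun n y =>
    (hF n).comp (measurable_consVec.comp (Measurable.prodMk (by fun_prop)
      ((hWc y).measurable.comp measurable_fst)))
  have him : ∀ n y, Measurable fun θ => ∫ t, F n (consVec (b y * t + c y) (W y θ)) ∂ρ :=
    fun n y => (hjm n y).stronglyMeasurable.integral_prod_right'.measurable
  have hib : ∀ n y θ, |∫ t, F n (consVec (b y * t + c y) (W y θ)) ∂ρ| ≤ C := fun n y θ => by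
    have := norm_integral_le_of_norm_le_const (μ := ρ)
      (f := fun t => F n (consVec (b y * t + c y) (W y θ))) (ae_of_all _ fun t => hC n _)
    simpa using this
  have hii : ∀ n y, Integrable (fun θ => ∫ t, F n (consVec (b y * t + c y) (W y θ)) ∂ρ)
      (Measure.pi fun _ : Fin d => ρ) := fun n y =>
    Integrable.of_bound (him n y).aestronglyMeasurable C (ae_of_all _ (hib n y))
  have h3 : Tendsto (fun n => ∫ θ,
      ((∫ t, F n (consVec (b (zs n) * t + c (zs n)) (W (zs n) θ)) ∂ρ) -
      ∫ t, F n (consVec (b z * t + c z) (W z θ)) ∂ρ) ∂(Measure.pi fun _ : Fin d => ρ)) atTop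
      (𝓝 (∫ _, (0 : ℝ) ∂(Measure.pi fun _ : Fin d => ρ))) := by
    refine tendsto_integral_of_dominated_convergence (fun _ => C + C) (fun n => ?_)
      (integrable_const _) (fun n => ae_of_all _ fun θ => ?_) (ae_of_all _ hinner)
    · exact ((him n _).sub (him n _)).aestronglyMeasurable
    · exact (norm_sub_le _ _).trans (add_le_add (hib n _ θ) (hib n _ θ))
  simp only [integral_zero] at h3
  refine h3.congr fun n => ?_
  rw [hexp, hexp, integral_sub (hii n _) (hii n _)]

/-- After `d + 1` steps the transition operator maps bounded measurable functions to functions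
that are equicontinuous off the hyperplane `z 0 = 0`. -/
lemma tendsto_transOp_iterate_sub_of_first_ne_zero (H : NoiseLaw a σ ρ)
    {F : ℕ → EuclideanSpace ℝ (Fin (d + 1)) → ℝ} (hF : ∀ n, Measurable (F n)) {C : ℝ}
    (hC : ∀ n z, |F n z| ≤ C)
    {z : EuclideanSpace ℝ (Fin (d + 1))} (hz : z 0 ≠ 0)
    {zs : ℕ → EuclideanSpace ℝ (Fin (d + 1))} (hzs : Tendsto zs atTop (𝓝 z)) :
    Tendsto (fun n => (transOp a σ ρ)^[d + 1] (F n) (zs n) - (transOp a σ ρ)^[d + 1] (F n) z)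
      atTop (𝓝 0) := by
  have := H.prob
  have key : ∀ k : ℕ, ∀ z : EuclideanSpace ℝ (Fin (d + 1)), z 0 ≠ 0 →
      ∀ zs : ℕ → EuclideanSpace ℝ (Fin (d + 1)), Tendsto zs atTop (𝓝 z) →
      (∀ n (j : Fin (d + 1)), j = 0 ∨ k < (j : ℕ) → zs n j = z j) →
      Tendsto (fun n => (transOp a σ ρ)^[k] (F n) (zs n) - (transOp a σ ρ)^[k] (F n) z)
        atTop (𝓝 0) := by
    intro k
    induction k with
    | zero =>
      intro z _ zs _ hco
      have : ∀ n, zs n = z := fun n => by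
        ext j
        refine hco n j ?_
        rcases Fin.eq_zero_or_eq_succ j with rfl | ⟨i, rfl⟩
        · exact Or.inl rfl
        · right; simp
      simp [this]
    | succ k ih =>
      intro z hz zs hzs hco
      simp only [Function.iterate_succ_apply']
      exact tendsto_transOp_sub H (fun n => measurable_transOp_iterate (hF n) k)
        (fun n => abs_transOp_iterate_le (hC n) k) ih hz hzs (fun n j hj => hco n j (Or.inr hj))
        (Or.inl fun n => hco n 0 (Or.inl rfl))
  simp only [Function.iterate_succ_apply']
  exact tendsto_transOp_sub H (fun n => measurable_transOp_iterate (hF n) d)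
    (fun n => abs_transOp_iterate_le (hC n) d) (key d) hz hzs
    (fun n j hj => absurd j.2 (by omega)) (Or.inr le_rfl)

lemma ae_affine_ne_zero (H : NoiseLaw a σ ρ) {z : EuclideanSpace ℝ (Fin (d + 1))}
    (hz : z 0 ≠ 0) : ∀ᵐ e ∂(Measure.pi fun _ : Fin (d + 1) => ρ), step a σ z e 0 ≠ 0 := by
  have := H.prob
  have := H.nullSingletonClass
  set r : ℝ := (-nextCoord z 0 / z 0 - a 0) / σ 0
  have h1 : ∀ᵐ t ∂ρ, t ≠ r := ae_iff.2 (by simp)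
  have h2 := (measurePreserving_eval (fun _ : Fin (d + 1) => ρ) 0).quasiMeasurePreserving.ae h1
  filter_upwards [h2] with e he h
  apply he
  have hσ := H.first.ne'
  rw [step_apply] at h
  simp only [Function.eval, r]
  field_simp
  linarith

/-- Equicontinuity near every nonzero vector after `2 d + 1` steps: from a vector whose first
nonzero entry is the `i`-th one, the hyperplane `z 0 = 0` is left after `i ≤ d` steps. -/
theorem tendsto_transOp_iterate_sub (H : NoiseLaw a σ ρ)
    {F : ℕ → EuclideanSpace ℝ (Fin (d + 1)) → ℝ} (hF : ∀ n, Measurable (F n)) {C : ℝ}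
    (hC : ∀ n z, |F n z| ≤ C)
    {z : EuclideanSpace ℝ (Fin (d + 1))} (hz : z ≠ 0)
    {zs : ℕ → EuclideanSpace ℝ (Fin (d + 1))} (hzs : Tendsto zs atTop (𝓝 z)) {l : ℕ}
    (hl : 2 * d + 1 ≤ l) :
    Tendsto (fun n => (transOp a σ ρ)^[l] (F n) (zs n) - (transOp a σ ρ)^[l] (F n) z)
      atTop (𝓝 0) := by
  have := H.prob
  obtain ⟨r, rfl⟩ := Nat.exists_eq_add_of_le hl
  have key : ∀ k : ℕ, ∀ z : EuclideanSpace ℝ (Fin (d + 1)),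
      (∃ i : Fin (d + 1), (i : ℕ) ≤ k ∧ z i ≠ 0) →
      ∀ zs : ℕ → EuclideanSpace ℝ (Fin (d + 1)), Tendsto zs atTop (𝓝 z) →
      Tendsto (fun n => (transOp a σ ρ)^[k + (d + 1 + r)] (F n) (zs n) -
        (transOp a σ ρ)^[k + (d + 1 + r)] (F n) z) atTop (𝓝 0) := by
    intro k
    induction k with
    | zero =>
      rintro z ⟨i, hi, hzi⟩ zs hzs
      obtain rfl : i = 0 := Fin.ext (by simpa using hi)
      simp only [zero_add, Function.iterate_add_apply]
      exact tendsto_transOp_iterate_sub_of_first_ne_zero H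
        (fun n => measurable_transOp_iterate (hF n) r) (fun n => abs_transOp_iterate_le (hC n) r)
        hzi hzs
    | succ k ih =>
      rintro z ⟨i, hi, hzi⟩ zs hzs
      have hmeas := fun n => measurable_transOp_iterate (a := a) (σ := σ) (ρ := ρ) (hF n)
        (k + (d + 1 + r))
      have hbd := fun n => abs_transOp_iterate_le (a := a) (σ := σ) (ρ := ρ) (hC n)
        (k + (d + 1 + r))
      have h3 : Tendsto (fun n => ∫ e,
          ((transOp a σ ρ)^[k + (d + 1 + r)] (F n) (step a σ (zs n) e) -
          (transOp a σ ρ)^[k + (d + 1 + r)] (F n) (step a σ z e))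
            ∂(Measure.pi fun _ : Fin (d + 1) => ρ)) atTop
          (𝓝 (∫ _, (0 : ℝ) ∂(Measure.pi fun _ : Fin (d + 1) => ρ))) := by
        refine tendsto_integral_of_dominated_convergence (fun _ => C + C) (fun n => ?_)
          (integrable_const _) (fun n => ae_of_all _ fun θ => ?_) ?_
        · exact ((integrable_comp_step (hmeas n) (hbd n) _).sub
            (integrable_comp_step (hmeas n) (hbd n) _)).aestronglyMeasurable
        · exact (norm_sub_le _ _).trans (add_le_add (hbd n _) (hbd n _))
        · have hcs : ∀ e, Tendsto (fun n => step a σ (zs n) e) atTop (𝓝 (step a σ z e)) :=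
            fun e => (((continuous_step a σ).comp
              (continuous_id.prodMk continuous_const)).tendsto z).comp hzs
          -- If `z 0 = 0`, then the step is a shift, which moves the nonzero entry one place up.
          by_cases hz0 : z 0 = 0
          · refine ae_of_all _ fun e => ih _ ?_ _ (hcs e)
            rcases Fin.eq_zero_or_eq_succ i with rfl | ⟨j, rfl⟩
            · exact absurd hz0 hzi
            · refine ⟨j.castSucc, by simpa using hi, ?_⟩
              rw [step_apply, hz0, zero_mul, zero_add, nextCoord, dif_pos (by simp)]
              exact hzi
          · filter_upwards [ae_affine_ne_zero H hz0] with e he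
            exact ih _ ⟨0, by simp, he⟩ _ (hcs e)
      simp only [integral_zero] at h3
      refine h3.congr fun n => ?_
      rw [show k + 1 + (d + 1 + r) = (k + (d + 1 + r)) + 1 by ring,
        Function.iterate_succ_apply', transOp, transOp,
        integral_sub (integrable_comp_step (hmeas n) (hbd n) _)
          (integrable_comp_step (hmeas n) (hbd n) _)]
  have hex : ∃ i : Fin (d + 1), (i : ℕ) ≤ d ∧ z i ≠ 0 := by
    by_contra! h
    exact hz (by ext i; simpa using h i (by omega))
  have := key d z hex zs hzs
  rwa [show d + (d + 1 + r) = 2 * d + 1 + r by ring] at this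

end RCA

namespace RCA
variable {d : ℕ} {a σ : Fin (d + 1) → ℝ} {ρ : Measure ℝ}

/-! ### Irreducibility and null sets -/

lemma transOp_nonneg {f : EuclideanSpace ℝ (Fin (d + 1)) → ℝ} (hf : ∀ z, 0 ≤ f z)
    (z : EuclideanSpace ℝ (Fin (d + 1))) : 0 ≤ transOp a σ ρ f z :=
  integral_nonneg fun _ => hf _

lemma transOp_iterate_nonneg {f : EuclideanSpace ℝ (Fin (d + 1)) → ℝ} (hf : ∀ z, 0 ≤ f z) (n : ℕ)
    (z : EuclideanSpace ℝ (Fin (d + 1))) : 0 ≤ (transOp a σ ρ)^[n] f z := by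
  induction n generalizing z with
  | zero => exact hf z
  | succ n ih => rw [Function.iterate_succ_apply']; exact transOp_nonneg ih z

lemma transOp_pos_of_step_mem (H : NoiseLaw a σ ρ) {f : EuclideanSpace ℝ (Fin (d + 1)) → ℝ}
    (hfm : Measurable f) (hf : ∀ z, 0 ≤ f z) {C : ℝ} (hC : ∀ z, |f z| ≤ C)
    {W : Set (EuclideanSpace ℝ (Fin (d + 1)))} (hW : IsOpen W) (hfW : ∀ z ∈ W, 0 < f z)
    {z : EuclideanSpace ℝ (Fin (d + 1))} {e : Fin (d + 1) → ℝ} (he : step a σ z e ∈ W) :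
    0 < transOp a σ ρ f z := by
  have := H.prob
  have := H.isOpenPosMeasure
  rw [transOp, integral_pos_iff_support_of_nonneg (fun _ => hf _) (integrable_comp_step hfm hC z)]
  have hcs : Continuous fun e => step a σ z e :=
    (continuous_step a σ).comp (continuous_const.prodMk continuous_id)
  refine lt_of_lt_of_le ((hW.preimage hcs).measure_pos _ ⟨e, he⟩) (measure_mono fun x hx => ?_)
  exact (hfW _ hx).ne'

lemma exists_last_coeff_ne_zero (h : a (Fin.last d) ≠ 0 ∨ σ (Fin.last d) ≠ 0) :
    ∃ t : ℝ, a (Fin.last d) + σ (Fin.last d) * t ≠ 0 := by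
  by_cases hs : σ (Fin.last d) = 0
  · exact ⟨0, by simpa [hs] using h⟩
  · exact ⟨(1 - a (Fin.last d)) / σ (Fin.last d), by field_simp; simp⟩

lemma nextCoord_castSucc (z : EuclideanSpace ℝ (Fin (d + 1))) (i : Fin d) :
    nextCoord z i.castSucc = z i.succ := by
  rw [nextCoord, dif_pos (by simp)]
  rfl

lemma nextCoord_last (z : EuclideanSpace ℝ (Fin (d + 1))) : nextCoord z (Fin.last d) = 0 := by
  rw [nextCoord, dif_neg (by simp)]

/-- Steering backwards in time: a nonempty open target is reached in `k` steps from a nonempty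
open set that is a cylinder over the coordinates other than `1, …, k`. -/
lemma exists_open_transOp_iterate_pos (H : NoiseLaw a σ ρ)
    {f : EuclideanSpace ℝ (Fin (d + 1)) → ℝ} (hfm : Measurable f) (hf : ∀ z, 0 ≤ f z) {C : ℝ}
    (hC : ∀ z, |f z| ≤ C) {U : Set (EuclideanSpace ℝ (Fin (d + 1)))} (hU : IsOpen U)
    (hne : U.Nonempty) (hfU : ∀ z ∈ U, 0 < f z) (k : ℕ) (hk : k ≤ d) :
    ∃ W : Set (EuclideanSpace ℝ (Fin (d + 1))), IsOpen W ∧ W.Nonempty ∧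
      (∀ z ∈ W, ∀ z' : EuclideanSpace ℝ (Fin (d + 1)),
        (∀ j : Fin (d + 1), j = 0 ∨ k < (j : ℕ) → z' j = z j) → z' ∈ W) ∧
      ∀ z ∈ W, 0 < (transOp a σ ρ)^[k] f z := by
  have := H.prob
  induction k with
  | zero =>
    refine ⟨U, hU, hne, fun z hz z' h => ?_, fun z hz => hfU z hz⟩
    have : z' = z := by
      ext j
      refine h j ?_
      rcases Fin.eq_zero_or_eq_succ j with rfl | ⟨i, rfl⟩
      · exact Or.inl rfl
      · right; simp
    rwa [this]
  | succ k ih =>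
    obtain ⟨W, hWo, ⟨w, hw⟩, hWi, hWp⟩ := ih (by omega)
    obtain ⟨r, hr⟩ := exists_last_coeff_ne_zero H.last
    have hlast : Fin.last d ≠ 0 := by
      intro h
      have := congrArg Fin.val h
      simp at this
      omega
    -- all noise variables but the first one are kept at the value `r`
    set e : ℝ → Fin (d + 1) → ℝ := fun t => Function.update (fun _ => r) 0 t with he
    have he0 : ∀ t, e t 0 = t := fun t => by simp [he]
    have hej : ∀ t j, j ≠ 0 → e t j = r := fun t j hj => by simp [he, hj]
    have hcs : ∀ t, Continuous fun z => step a σ z (e t) := fun t =>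
      (continuous_step a σ).comp (continuous_id.prodMk continuous_const)
    -- The union over `t` makes the new set invariant in the coordinate `1`, since a change of that
    -- coordinate can be compensated by the first noise variable.
    refine ⟨{z | z 0 ≠ 0} ∩ ⋃ t, (fun z => step a σ z (e t)) ⁻¹' W, ?_, ?_, ?_, ?_⟩
    · refine IsOpen.inter ?_ (isOpen_iUnion fun t => hWo.preimage (hcs t))
      exact isOpen_ne_fun (by fun_prop) continuous_const
    · -- a point of `W` with nonzero last entry has a preimage with nonzero first entry
      obtain ⟨w', hw', hw'0⟩ : ∃ w' ∈ W, w' (Fin.last d) ≠ 0 := by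
        by_contra! hcon
        have hc : Continuous fun s : ℝ => w + s • EuclideanSpace.single (Fin.last d) (1 : ℝ) := by
          fun_prop
        have h0 : ∀ᶠ s in 𝓝 (0 : ℝ), w + s • EuclideanSpace.single (Fin.last d) (1 : ℝ) ∈ W :=
          hc.continuousAt.eventually_mem (hWo.mem_nhds (by simpa using hw))
        obtain ⟨s, hs, hs0⟩ :=
          ((h0.filter_mono nhdsWithin_le_nhds).and
            (self_mem_nhdsWithin : {(0 : ℝ)}ᶜ ∈ 𝓝[≠] (0 : ℝ))).exists
        have h1 := hcon _ hs
        have h2 := hcon _ hw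
        simp [h2] at h1
        exact hs0 h1
      refine ⟨consVec (w' (Fin.last d) / (a (Fin.last d) + σ (Fin.last d) * r)) fun i =>
        w' i.castSucc - w' (Fin.last d) / (a (Fin.last d) + σ (Fin.last d) * r) *
          (a i.castSucc + σ i.castSucc * r), ?_, Set.mem_iUnion.2 ⟨r, ?_⟩⟩
      · simp only [Set.mem_ofPred_eq, consVec, Fin.cons_zero]
        exact div_ne_zero hw'0 hr
      · have : step a σ (consVec (w' (Fin.last d) / (a (Fin.last d) + σ (Fin.last d) * r)) fun i =>
            w' i.castSucc - w' (Fin.last d) / (a (Fin.last d) + σ (Fin.last d) * r) *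
            (a i.castSucc + σ i.castSucc * r)) (e r) = w' := by
          have her : ∀ j, e r j = r := fun j => by
            by_cases hj : j = 0
            · rw [hj, he0]
            · exact hej r j hj
          ext j
          rw [step_apply, her]
          refine Fin.lastCases ?_ (fun i => ?_) j
          · rw [nextCoord_last]
            simp only [consVec, Fin.cons_zero]
            field_simp
            simp
          · rw [nextCoord_castSucc]
            simp only [consVec, Fin.cons_zero, Fin.cons_succ]
            ring
        rw [Set.mem_preimage, this]
        exact hw'
    · rintro z ⟨hz0, hzW⟩ z' hzz'
      obtain ⟨t, ht⟩ := Set.mem_iUnion.1 hzW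
      have h0 : z' 0 = z 0 := hzz' 0 (Or.inl rfl)
      have hz0' : z 0 ≠ 0 := hz0
      have hσ := H.first.ne'
      refine ⟨by simpa [h0] using hz0, Set.mem_iUnion.2
        ⟨t + (nextCoord z 0 - nextCoord z' 0) / (z 0 * σ 0), hWi _ ht _ fun j hj => ?_⟩⟩
      rw [step_apply, step_apply, h0]
      by_cases hj0 : j = 0
      · subst hj0
        rw [he0, he0]
        field_simp
        ring
      · have hkj : k < (j : ℕ) := by tauto
        rw [hej _ _ hj0, hej _ _ hj0]
        congr 1
        unfold nextCoord
        split_ifs with h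
        · exact hzz' _ (Or.inr (by simpa using hkj))
        · rfl
    · rintro z ⟨-, hzW⟩
      obtain ⟨t, ht⟩ := Set.mem_iUnion.1 hzW
      rw [Function.iterate_succ_apply']
      exact transOp_pos_of_step_mem H (measurable_transOp_iterate hfm k)
        (transOp_iterate_nonneg hf k) (abs_transOp_iterate_le hC k) hWo hWp ht

/-- Every nonempty open set is reached with positive probability from every nonzero vector, after
any number of steps that is at least `2 d + 1`. -/
theorem transOp_iterate_pos (H : NoiseLaw a σ ρ)
    {f : EuclideanSpace ℝ (Fin (d + 1)) → ℝ} (hfm : Measurable f) (hf : ∀ z, 0 ≤ f z) {C : ℝ}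
    (hC : ∀ z, |f z| ≤ C) {U : Set (EuclideanSpace ℝ (Fin (d + 1)))} (hU : IsOpen U)
    (hne : U.Nonempty) (hfU : ∀ z ∈ U, 0 < f z) {z : EuclideanSpace ℝ (Fin (d + 1))} (hz : z ≠ 0)
    {l : ℕ} (hl : 2 * d + 1 ≤ l) : 0 < (transOp a σ ρ)^[l] f z := by
  have := H.prob
  have hσ := H.first.ne'
  have hm := measurable_transOp_iterate (a := a) (σ := σ) (ρ := ρ) hfm
  have h0 := transOp_iterate_nonneg (a := a) (σ := σ) (ρ := ρ) hf
  have hb := abs_transOp_iterate_le (a := a) (σ := σ) (ρ := ρ) hC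
  have hstep0 : ∀ z : EuclideanSpace ℝ (Fin (d + 1)), z 0 ≠ 0 → ∀ s, ∃ e, step a σ z e 0 = s :=
    fun z hz s => ⟨fun _ => ((s - nextCoord z 0) / z 0 - a 0) / σ 0, by
      rw [step_apply]; field_simp; ring⟩
  -- The cylinder from which the target is reached in `d` steps only restricts the first entry,
  -- which can be steered to any value in one step.
  have hstart : ∀ z : EuclideanSpace ℝ (Fin (d + 1)), z 0 ≠ 0 →
      0 < (transOp a σ ρ)^[d + 1] f z := by
    intro z hz
    obtain ⟨W, hWo, ⟨w, hw⟩, hWi, hWp⟩ :=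
      exists_open_transOp_iterate_pos H hfm hf hC hU hne hfU d le_rfl
    obtain ⟨e, he⟩ := hstep0 z hz (w 0)
    rw [Function.iterate_succ_apply']
    refine transOp_pos_of_step_mem H (hm d) (h0 d) (hb d) hWo hWp (e := e) (hWi w hw _ ?_)
    rintro j (rfl | hj)
    · exact he
    · exact absurd j.2 (by omega)
  -- From a vector with a nonzero entry among the first `k + 1`, the hyperplane `z 0 = 0` can be
  -- left within `k` steps.
  have key : ∀ k : ℕ, ∀ z : EuclideanSpace ℝ (Fin (d + 1)),
      (∃ i : Fin (d + 1), (i : ℕ) ≤ k ∧ z i ≠ 0) → 0 < (transOp a σ ρ)^[k + (d + 1)] f z := by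
    intro k
    induction k with
    | zero =>
      rintro z ⟨i, hi, hzi⟩
      obtain rfl : i = 0 := Fin.ext (by simpa using hi)
      rw [zero_add]
      exact hstart z hzi
    | succ k ih =>
      rintro z ⟨i, hi, hzi⟩
      rw [show k + 1 + (d + 1) = (k + (d + 1)) + 1 by ring, Function.iterate_succ_apply']
      have hopen : IsOpen {z : EuclideanSpace ℝ (Fin (d + 1)) |
          ∃ i : Fin (d + 1), (i : ℕ) ≤ k ∧ z i ≠ 0} := by
        have : {z : EuclideanSpace ℝ (Fin (d + 1)) | ∃ i : Fin (d + 1), (i : ℕ) ≤ k ∧ z i ≠ 0} =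
            ⋃ i : Fin (d + 1), ⋃ _ : (i : ℕ) ≤ k, {z | z i ≠ 0} := by
          ext; simp
        rw [this]
        exact isOpen_iUnion fun i => isOpen_iUnion fun _ =>
          isOpen_ne_fun (by fun_prop) continuous_const
      have hex : ∃ e, step a σ z e ∈ {z : EuclideanSpace ℝ (Fin (d + 1)) |
          ∃ i : Fin (d + 1), (i : ℕ) ≤ k ∧ z i ≠ 0} := by
        by_cases hz0 : z 0 = 0
        · rcases Fin.eq_zero_or_eq_succ i with rfl | ⟨j, rfl⟩
          · exact absurd hz0 hzi
          · refine ⟨0, j.castSucc, by simpa using hi, ?_⟩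
            rw [step_apply, hz0, zero_mul, zero_add, nextCoord_castSucc]
            exact hzi
        · obtain ⟨e, he⟩ := hstep0 z hz0 1
          exact ⟨e, 0, by simp, by rw [he]; exact one_ne_zero⟩
      obtain ⟨e, he⟩ := hex
      exact transOp_pos_of_step_mem H (hm _) (h0 _) (hb _) hopen (fun z hz => ih z hz) he
  have hex : ∀ z : EuclideanSpace ℝ (Fin (d + 1)), z ≠ 0 →
      ∃ i : Fin (d + 1), (i : ℕ) ≤ d ∧ z i ≠ 0 := by
    intro z hz
    by_contra! h
    exact hz (by ext i; simpa using h i (by omega))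
  induction l, hl using Nat.le_induction generalizing z with
  | base =>
    have := key d z (hex z hz)
    rwa [show d + (d + 1) = 2 * d + 1 by ring] at this
  | succ l hl ih =>
    rw [Function.iterate_succ_apply']
    have hexs : ∃ e, step a σ z e ≠ 0 := by
      by_cases hz0 : z 0 = 0
      · obtain ⟨i, -, hzi⟩ := hex z hz
        rcases Fin.eq_zero_or_eq_succ i with rfl | ⟨j, rfl⟩
        · exact absurd hz0 hzi
        · refine ⟨0, fun h => hzi ?_⟩
          have := congrArg (fun v : EuclideanSpace ℝ (Fin (d + 1)) => v j.castSucc) h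
          simpa [step_apply, hz0, nextCoord_castSucc] using this
      · obtain ⟨e, he⟩ := hstep0 z hz0 1
        exact ⟨e, fun h => by simp [h] at he⟩
    obtain ⟨e, he⟩ := hexs
    exact transOp_pos_of_step_mem H (hm _) (h0 _) (hb _) isOpen_ne (fun z hz => ih hz) he

lemma step_eq_zero {z : EuclideanSpace ℝ (Fin (d + 1))} {e : Fin (d + 1) → ℝ}
    (he : a (Fin.last d) + σ (Fin.last d) * e (Fin.last d) ≠ 0) (h : step a σ z e = 0) : z = 0 := by
  have hj : ∀ j, z 0 * (a j + σ j * e j) + nextCoord z j = 0 := fun j => by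
    rw [← step_apply, h]; rfl
  have h0 : z 0 = 0 := by
    have := hj (Fin.last d)
    rw [nextCoord_last, add_zero] at this
    exact (mul_eq_zero.1 this).resolve_right he
  ext j
  rcases Fin.eq_zero_or_eq_succ j with rfl | ⟨i, rfl⟩
  · exact h0
  · simpa [h0, nextCoord_castSucc] using hj i.castSucc

lemma ae_last_coeff_ne_zero (H : NoiseLaw a σ ρ) :
    ∀ᵐ e ∂(Measure.pi fun _ : Fin (d + 1) => ρ),
      a (Fin.last d) + σ (Fin.last d) * e (Fin.last d) ≠ 0 := by
  have := H.prob
  have := H.nullSingletonClass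
  have h1 : ∀ᵐ t ∂ρ, a (Fin.last d) + σ (Fin.last d) * t ≠ 0 := by
    by_cases hs : σ (Fin.last d) = 0
    · exact ae_of_all _ fun t => by simpa [hs] using H.last
    · have h1 : ∀ᵐ t ∂ρ, t ≠ -a (Fin.last d) / σ (Fin.last d) := ae_iff.2 (by simp)
      filter_upwards [h1] with t ht h
      exact ht (by field_simp; linarith)
  exact (measurePreserving_eval (fun _ : Fin (d + 1) => ρ)
    (Fin.last d)).quasiMeasurePreserving.ae h1

/-- The step map with nonzero last coefficient is a linear bijection, so that it preserves null
sets in both directions. -/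
lemma volume_preimage_step_eq_zero_iff {e : Fin (d + 1) → ℝ}
    (he : a (Fin.last d) + σ (Fin.last d) * e (Fin.last d) ≠ 0)
    (s : Set (EuclideanSpace ℝ (Fin (d + 1)))) :
    volume ((fun z => step a σ z e) ⁻¹' s) = 0 ↔ volume s = 0 := by
  set L : EuclideanSpace ℝ (Fin (d + 1)) →ₗ[ℝ] EuclideanSpace ℝ (Fin (d + 1)) :=
    { toFun := fun z => step a σ z e
      map_add' := fun x y => by
        simp only [step, rowMul, WithLp.ofLp_add, Matrix.add_vecMul, WithLp.toLp_add]
      map_smul' := fun c x => by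
        simp only [step, rowMul, WithLp.ofLp_smul, Matrix.smul_vecMul, WithLp.toLp_smul,
          RingHom.id_apply] } with hL
  have hdet : LinearMap.det L ≠ 0 := by
    have : IsUnit L := by
      rw [LinearMap.isUnit_iff_ker_eq_bot, LinearMap.ker_eq_bot']
      exact fun z hz => step_eq_zero he hz
    exact (LinearMap.isUnit_det L this).ne_zero
  have h := Measure.addHaar_preimage_linearMap volume hdet s
  change volume (L ⁻¹' s) = 0 ↔ _
  rw [h, mul_eq_zero, ENNReal.ofReal_eq_zero]
  have : 0 < |(LinearMap.det L)⁻¹| := abs_pos.2 (inv_ne_zero hdet)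
  constructor
  · rintro (h | h)
    · linarith
    · exact h
  · exact Or.inr

lemma transOp_ae_eq_zero_iff (H : NoiseLaw a σ ρ)
    {f : EuclideanSpace ℝ (Fin (d + 1)) → ℝ} (hfm : Measurable f) (hf : ∀ z, 0 ≤ f z) {C : ℝ}
    (hC : ∀ z, |f z| ≤ C) :
    (∀ᵐ z, transOp a σ ρ f z = 0) ↔ ∀ᵐ z, f z = 0 := by
  have := H.prob
  have hms : MeasurableSet {z | f z = 0} := hfm (measurableSet_singleton 0)
  have h1 : (∀ᵐ z, transOp a σ ρ f z = 0) ↔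
      ∀ᵐ z, ∀ᵐ e ∂(Measure.pi fun _ : Fin (d + 1) => ρ), f (step a σ z e) = 0 := by
    refine eventually_congr (Eventually.of_forall fun z => ?_)
    rw [transOp, integral_eq_zero_iff_of_nonneg (fun _ => hf _) (integrable_comp_step hfm hC z)]
    rfl
  rw [h1]
  have h2 := Measure.ae_ae_comm (μ := (volume : Measure (EuclideanSpace ℝ (Fin (d + 1)))))
    (ν := Measure.pi fun _ : Fin (d + 1) => ρ) (p := fun z e => f (step a σ z e) = 0)
    ((hfm.comp (measurable_step a σ)) (measurableSet_singleton 0))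
  rw [h2]
  have h3 : ∀ᵐ e ∂(Measure.pi fun _ : Fin (d + 1) => ρ),
      (∀ᵐ z, f (step a σ z e) = 0) ↔ ∀ᵐ z, f z = 0 := by
    filter_upwards [ae_last_coeff_ne_zero H] with e he
    rw [ae_iff, ae_iff, ← volume_preimage_step_eq_zero_iff he {z | ¬ f z = 0}]
    rfl
  rw [eventually_congr h3]
  simp

lemma transOp_iterate_ae_eq_zero_iff (H : NoiseLaw a σ ρ)
    {f : EuclideanSpace ℝ (Fin (d + 1)) → ℝ} (hfm : Measurable f) (hf : ∀ z, 0 ≤ f z) {C : ℝ}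
    (hC : ∀ z, |f z| ≤ C) (n : ℕ) :
    (∀ᵐ z, (transOp a σ ρ)^[n] f z = 0) ↔ ∀ᵐ z, f z = 0 := by
  have := H.prob
  induction n with
  | zero => rfl
  | succ n ih =>
    refine Iff.trans ?_ ih
    simp only [Function.iterate_succ_apply']
    exact transOp_ae_eq_zero_iff H (measurable_transOp_iterate hfm n) (transOp_iterate_nonneg hf n)
      (abs_transOp_iterate_le hC n)

lemma continuousAt_transOp_iterate (H : NoiseLaw a σ ρ)
    {f : EuclideanSpace ℝ (Fin (d + 1)) → ℝ} (hfm : Measurable f) {C : ℝ} (hC : ∀ z, |f z| ≤ C)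
    {z : EuclideanSpace ℝ (Fin (d + 1))} (hz : z ≠ 0) {l : ℕ} (hl : 2 * d + 1 ≤ l) :
    ContinuousAt ((transOp a σ ρ)^[l] f) z := by
  refine tendsto_of_seq_tendsto fun u hu => ?_
  exact tendsto_sub_nhds_zero_iff.1
    (tendsto_transOp_iterate_sub H (F := fun _ => f) (fun _ => hfm) (fun _ => hC) hz hu hl)

/-- The laws of the recursion after `l ≥ 4 d + 2` steps, started from any nonzero vector, have the
same null sets as Lebesgue measure. A null function stays null by `transOp_iterate_ae_eq_zero_iff`
and vanishes by continuity; a function that is not null becomes positive on an open set. -/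
theorem transOp_iterate_eq_zero_iff (H : NoiseLaw a σ ρ)
    {f : EuclideanSpace ℝ (Fin (d + 1)) → ℝ} (hfm : Measurable f) (hf : ∀ z, 0 ≤ f z) {C : ℝ}
    (hC : ∀ z, |f z| ≤ C) {z : EuclideanSpace ℝ (Fin (d + 1))} (hz : z ≠ 0) {l : ℕ}
    (hl : 4 * d + 2 ≤ l) : (transOp a σ ρ)^[l] f z = 0 ↔ ∀ᵐ y, f y = 0 := by
  have := H.prob
  constructor
  · intro h
    by_contra hcon
    rw [← transOp_iterate_ae_eq_zero_iff H hfm hf hC (2 * d + 1)] at hcon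
    have h1 : ∃ y : EuclideanSpace ℝ (Fin (d + 1)),
        y ≠ 0 ∧ (transOp a σ ρ)^[2 * d + 1] f y ≠ 0 := by
      by_contra! hall
      refine hcon ?_
      have : ∀ᵐ y : EuclideanSpace ℝ (Fin (d + 1)), y ≠ 0 := ae_iff.2 (by simp)
      filter_upwards [this] with y hy using hall y hy
    obtain ⟨y, hy, hfy⟩ := h1
    have hpos : 0 < (transOp a σ ρ)^[2 * d + 1] f y :=
      lt_of_le_of_ne (transOp_iterate_nonneg hf _ _) hfy.symm
    obtain ⟨U, hU, hUo, hyU⟩ := eventually_nhds_iff.1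
      ((continuousAt_transOp_iterate H hfm hC hy le_rfl).eventually_const_lt hpos)
    obtain ⟨r, rfl⟩ := Nat.exists_eq_add_of_le hl
    rw [show 4 * d + 2 + r = (2 * d + 1 + r) + (2 * d + 1) by ring,
      Function.iterate_add_apply] at h
    exact (transOp_iterate_pos H (measurable_transOp_iterate hfm _) (transOp_iterate_nonneg hf _)
      (abs_transOp_iterate_le hC _) hUo ⟨y, hyU⟩ hU hz (by omega)).ne' h
  · intro h
    rw [← transOp_iterate_ae_eq_zero_iff H hfm hf hC l] at h
    by_contra hne
    have hpos : 0 < (transOp a σ ρ)^[l] f z :=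
      lt_of_le_of_ne (transOp_iterate_nonneg hf _ _) (Ne.symm hne)
    obtain ⟨U, hU, hUo, hyU⟩ := eventually_nhds_iff.1
      ((continuousAt_transOp_iterate H hfm hC hz (by omega)).eventually_const_lt hpos)
    refine (hUo.measure_pos volume ⟨z, hyU⟩).ne' (measure_mono_null (fun y hy => ?_) (ae_iff.1 h))
    exact (hU y hy).ne'

end RCA

namespace RCA
variable {d : ℕ}

/-! ### The matrix norm and directions -/

lemma matNorm_nonneg (A : Matrix (Fin (d + 1)) (Fin (d + 1)) ℝ) :
    0 ≤ matNorm A := Real.sqrt_nonneg _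

lemma matNorm_sq (A : Matrix (Fin (d + 1)) (Fin (d + 1)) ℝ) :
    matNorm A ^ 2 = ∑ i, ∑ j, A i j ^ 2 := by
  have h : (A * A.transpose).trace = ∑ i, ∑ j, A i j ^ 2 := by
    simp [Matrix.trace, Matrix.mul_apply, sq]
  rw [matNorm, Real.sq_sqrt, h]
  rw [h]; positivity

lemma norm_rowMul_sq (z : EuclideanSpace ℝ (Fin (d + 1)))
    (A : Matrix (Fin (d + 1)) (Fin (d + 1)) ℝ) :
    ‖rowMul z A‖ ^ 2 = ∑ j, (∑ i, z i * A i j) ^ 2 := by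
  rw [EuclideanSpace.real_norm_sq_eq]; rfl

lemma norm_rowMul_le (z : EuclideanSpace ℝ (Fin (d + 1)))
    (A : Matrix (Fin (d + 1)) (Fin (d + 1)) ℝ) : ‖rowMul z A‖ ≤ ‖z‖ * matNorm A := by
  refine abs_le_of_sq_le_sq' ?_ (mul_nonneg (norm_nonneg _) (matNorm_nonneg _)) |>.2
  rw [norm_rowMul_sq, mul_pow, matNorm_sq, EuclideanSpace.real_norm_sq_eq, Finset.sum_comm,
    Finset.mul_sum]
  exact Finset.sum_le_sum fun j _ => Finset.sum_mul_sq_le_sq_mul_sq _ _ _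

lemma rowMul_mul (z : EuclideanSpace ℝ (Fin (d + 1))) (A B : Matrix (Fin (d + 1)) (Fin (d + 1)) ℝ) :
    rowMul z (A * B) = rowMul (rowMul z A) B := by
  simp [rowMul, Matrix.vecMul_vecMul]

lemma rowMul_smul (c : ℝ) (z : EuclideanSpace ℝ (Fin (d + 1)))
    (A : Matrix (Fin (d + 1)) (Fin (d + 1)) ℝ) : rowMul (c • z) A = c • rowMul z A := by
  simp [rowMul, Matrix.smul_vecMul]

lemma matNorm_sq_eq_sum_rows (A : Matrix (Fin (d + 1)) (Fin (d + 1)) ℝ) :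
    matNorm A ^ 2 = ∑ i, ‖rowMul (EuclideanSpace.single i 1) A‖ ^ 2 := by
  rw [matNorm_sq]
  refine Finset.sum_congr rfl fun i _ => ?_
  rw [norm_rowMul_sq]
  refine Finset.sum_congr rfl fun j _ => ?_
  simp

lemma matNorm_mul_le (A B : Matrix (Fin (d + 1)) (Fin (d + 1)) ℝ) :
    matNorm (A * B) ≤ matNorm A * matNorm B := by
  refine abs_le_of_sq_le_sq' ?_ (mul_nonneg (matNorm_nonneg _) (matNorm_nonneg _)) |>.2
  rw [mul_pow, matNorm_sq_eq_sum_rows (A * B), matNorm_sq_eq_sum_rows A, Finset.sum_mul]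
  refine Finset.sum_le_sum fun i _ => ?_
  rw [← mul_pow, rowMul_mul]
  exact pow_le_pow_left₀ (norm_nonneg _) (norm_rowMul_le _ _) 2

lemma matNorm_le_sum (A : Matrix (Fin (d + 1)) (Fin (d + 1)) ℝ) :
    matNorm A ≤ ∑ i, ∑ j, |A i j| := by
  refine abs_le_of_sq_le_sq' ?_ (by positivity) |>.2
  rw [matNorm_sq]
  calc ∑ i, ∑ j, A i j ^ 2 = ∑ i, ∑ j, |A i j| ^ 2 := by simp
    _ ≤ ∑ i, (∑ j, |A i j|) ^ 2 :=
        Finset.sum_le_sum fun i _ => Finset.sum_sq_le_sq_sum_of_nonneg fun _ _ => abs_nonneg _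
    _ ≤ _ := Finset.sum_sq_le_sq_sum_of_nonneg fun _ _ =>
        Finset.sum_nonneg fun _ _ => abs_nonneg _

lemma continuous_matNorm : Continuous (matNorm (d := d)) := by
  unfold matNorm
  exact Real.continuous_sqrt.comp
    (Continuous.matrix_trace (continuous_id.matrix_mul continuous_id.matrix_transpose))

lemma norm_smul_direction (x : Sph d) (z : EuclideanSpace ℝ (Fin (d + 1))) :
    ‖z‖ • (direction x z : EuclideanSpace ℝ (Fin (d + 1))) = z := by
  unfold direction
  split_ifs with h
  · simp [h]
  · simp [smul_smul, mul_inv_cancel₀ (norm_ne_zero_iff.2 h)]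

lemma direction_smul (x : Sph d) {c : ℝ} (hc : 0 < c) (z : EuclideanSpace ℝ (Fin (d + 1))) :
    direction x (c • z) = direction x z := by
  unfold direction
  by_cases h : z = 0
  · simp [h]
  · have h' : c • z ≠ 0 := smul_ne_zero hc.ne' h
    rw [dif_neg h, dif_neg h']
    ext1
    simp only [norm_smul, Real.norm_eq_abs, abs_of_pos hc, smul_smul]
    congr 1
    have := norm_ne_zero_iff.2 h
    field_simp

lemma direction_eq_of_ne_zero (x y : Sph d) {z : EuclideanSpace ℝ (Fin (d + 1))} (hz : z ≠ 0) :
    direction x z = direction y z := by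
  unfold direction
  rw [dif_neg hz, dif_neg hz]

lemma direction_coe (x y : Sph d) : direction x (y : EuclideanSpace ℝ (Fin (d + 1))) = y := by
  have h : (y : EuclideanSpace ℝ (Fin (d + 1))) ≠ 0 := ne_zero_of_mem_unit_sphere y
  unfold direction
  rw [dif_neg h]
  ext1
  simp

lemma measurable_direction : Measurable fun p : Sph d × EuclideanSpace ℝ (Fin (d + 1)) =>
    direction p.1 p.2 := by
  classical
  have : (fun p : Sph d × EuclideanSpace ℝ (Fin (d + 1)) =>
      (direction p.1 p.2 : EuclideanSpace ℝ (Fin (d + 1)))) =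
      fun p => if p.2 = 0 then (p.1 : EuclideanSpace ℝ (Fin (d + 1))) else ‖p.2‖⁻¹ • p.2 := by
    ext1 p
    unfold direction
    split_ifs <;> rfl
  have h2 : Measurable fun p : Sph d × EuclideanSpace ℝ (Fin (d + 1)) =>
      (direction p.1 p.2 : EuclideanSpace ℝ (Fin (d + 1))) := by
    rw [this]
    refine Measurable.ite (measurable_snd (measurableSet_singleton 0)) (by fun_prop) ?_
    exact (measurable_snd.norm.inv).smul measurable_snd
  exact h2.subtype_mk

lemma continuousAt_direction (x : Sph d) {z : EuclideanSpace ℝ (Fin (d + 1))} (hz : z ≠ 0) :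
    ContinuousAt (direction x) z := by
  have h : ContinuousAt (fun z : EuclideanSpace ℝ (Fin (d + 1)) => ‖z‖⁻¹ • z) z :=
    (continuousAt_id.norm.inv₀ (norm_ne_zero_iff.2 hz)).smul continuousAt_id
  rw [Topology.IsEmbedding.subtypeVal.continuousAt_iff]
  refine h.congr ?_
  filter_upwards [isOpen_ne.mem_nhds hz] with y hy
  simp only [Function.comp_def, direction]
  rw [dif_neg hy]

/-! ### The random recursion as a Markov chain -/

variable {Ω : Type*} {a σ : Fin (d + 1) → ℝ} {η : ℕ → Fin (d + 1) → Ω → ℝ}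

lemma rowMul_matProd_succ (z : EuclideanSpace ℝ (Fin (d + 1))) (n : ℕ) (ω : Ω) :
    rowMul z (matProd a σ η (n + 1) ω) =
      step a σ (rowMul z (matProd a σ η n ω)) fun i => η n i ω :=
  rowMul_mul _ _ _

lemma step_smul (c : ℝ) (z : EuclideanSpace ℝ (Fin (d + 1))) (e : Fin (d + 1) → ℝ) :
    step a σ (c • z) e = c • step a σ z e := rowMul_smul _ _ _

lemma dirChain_succ (x : Sph d) (n : ℕ) (ω : Ω) :
    dirChain a σ η x (n + 1) ω = direction (dirChain a σ η x n ω)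
      (step a σ (dirChain a σ η x n ω : EuclideanSpace ℝ (Fin (d + 1))) fun i => η n i ω) := rfl

/-- The polar decomposition of `x' Π_n`, which also holds when `x' Π_n = 0`. -/
lemma norm_smul_dirChain (x : Sph d) (n : ℕ) (ω : Ω) :
    ‖rowMul (x : EuclideanSpace ℝ (Fin (d + 1))) (matProd a σ η n ω)‖ •
      (dirChain a σ η x n ω : EuclideanSpace ℝ (Fin (d + 1))) =
      rowMul (x : EuclideanSpace ℝ (Fin (d + 1))) (matProd a σ η n ω) := by
  induction n with
  | zero => simp [rowMul, matProd, dirChain]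
  | succ n ih =>
    rw [rowMul_matProd_succ, ← ih, step_smul, norm_smul, norm_norm, mul_smul, dirChain_succ,
      norm_smul_direction]

lemma norm_rowMul_matProd_succ (x : Sph d) (n : ℕ) (ω : Ω) :
    ‖rowMul (x : EuclideanSpace ℝ (Fin (d + 1))) (matProd a σ η (n + 1) ω)‖ =
      ‖rowMul (x : EuclideanSpace ℝ (Fin (d + 1))) (matProd a σ η n ω)‖ *
      ‖step a σ (dirChain a σ η x n ω : EuclideanSpace ℝ (Fin (d + 1))) fun i => η n i ω‖ := by
  conv_lhs => rw [rowMul_matProd_succ, ← norm_smul_dirChain, step_smul, norm_smul, norm_norm]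

lemma measurable_step_comp {m : MeasurableSpace Ω} {f : Ω → EuclideanSpace ℝ (Fin (d + 1))}
    {g : Ω → Fin (d + 1) → ℝ} (hf : Measurable f) (hg : Measurable g) :
    Measurable fun ω => step a σ (f ω) (g ω) :=
  (measurable_step a σ).comp (hf.prodMk hg)

lemma measurable_direction_comp {m : MeasurableSpace Ω} {f : Ω → Sph d}
    {g : Ω → EuclideanSpace ℝ (Fin (d + 1))} (hf : Measurable f) (hg : Measurable g) :
    Measurable fun ω => direction (f ω) (g ω) :=
  measurable_direction.comp (hf.prodMk hg)

/-- The σ-algebra generated by the noise variables of the first `n` steps. -/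
abbrev pastAlg (η : ℕ → Fin (d + 1) → Ω → ℝ) (n : ℕ) : MeasurableSpace Ω :=
  ⨆ p ∈ {p : ℕ × Fin (d + 1) | p.1 < n}, MeasurableSpace.comap (η p.1 p.2) inferInstance

lemma pastAlg_mono : Monotone (pastAlg η) := fun _ _ h =>
  biSup_mono fun _ hp => lt_of_lt_of_le hp h

lemma measurable_noise_pastAlg {k n : ℕ} (hk : k < n) (i : Fin (d + 1)) :
    Measurable[pastAlg η n] (η k i) := by
  have h : MeasurableSpace.comap (η k i) inferInstance ≤ pastAlg η n :=
    le_biSup (f := fun p : ℕ × Fin (d + 1) => MeasurableSpace.comap (η p.1 p.2) inferInstance)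
      (show (k, i) ∈ {p : ℕ × Fin (d + 1) | p.1 < n} from hk)
  exact (comap_measurable (η k i)).mono h le_rfl

lemma measurable_noiseVec_pastAlg {k n : ℕ} (hk : k < n) :
    Measurable[pastAlg η n] fun ω i => η k i ω :=
  @measurable_pi_lambda _ _ _ (pastAlg η n) _ _ fun i => measurable_noise_pastAlg hk i

lemma measurable_rowMul_matProd_pastAlg (z : EuclideanSpace ℝ (Fin (d + 1))) (n : ℕ) :
    Measurable[pastAlg η n] fun ω => rowMul z (matProd a σ η n ω) := by
  induction n with
  | zero =>
    simp only [matProd]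
    exact @measurable_const _ _ _ (pastAlg η 0) _
  | succ n ih =>
    simp only [rowMul_matProd_succ]
    exact measurable_step_comp (ih.mono (pastAlg_mono n.le_succ) le_rfl)
      (measurable_noiseVec_pastAlg n.lt_succ_self)

lemma measurable_dirChain_pastAlg (x : Sph d) {k n : ℕ} (hk : k ≤ n) :
    Measurable[pastAlg η n] (dirChain a σ η x k) := by
  induction k with
  | zero => exact @measurable_const _ _ _ (pastAlg η n) _
  | succ k ih =>
    have hk' := ih (by omega)
    have hkn : k < n := by omega
    exact measurable_direction_comp hk'
      (measurable_step_comp (measurable_subtype_coe.comp hk') (measurable_noiseVec_pastAlg hkn))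

lemma measurable_logIncr_pastAlg (x : Sph d) {k n : ℕ} (hk : k < n) :
    Measurable[pastAlg η n] (logIncr a σ η x k) := by
  have h : Measurable[pastAlg η n] fun ω =>
      step a σ (dirChain a σ η x k ω : EuclideanSpace ℝ (Fin (d + 1))) fun i => η k i ω :=
    measurable_step_comp
      (measurable_subtype_coe.comp (measurable_dirChain_pastAlg x hk.le))
      (measurable_noiseVec_pastAlg hk)
  exact (Real.measurable_log.comp measurable_norm).comp h

lemma measurable_matProd_pastAlg (n : ℕ) (i j : Fin (d + 1)) :
    Measurable[pastAlg η n] fun ω => matProd a σ η n ω i j := by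
  have h1 := measurable_rowMul_matProd_pastAlg (a := a) (σ := σ) (η := η)
    (EuclideanSpace.single i 1) n
  have h2 : Measurable fun v : EuclideanSpace ℝ (Fin (d + 1)) => v j := by fun_prop
  have h4 : (fun ω => matProd a σ η n ω i j) = (fun v : EuclideanSpace ℝ (Fin (d + 1)) => v j) ∘
      fun ω => rowMul (EuclideanSpace.single i 1) (matProd a σ η n ω) := by
    ext ω
    simp [rowMul]
  rw [h4]
  exact h2.comp h1

lemma measurable_matProd_fun_pastAlg (n : ℕ) :
    Measurable[pastAlg η n] fun ω => (fun i j => matProd a σ η n ω i j) :=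
  @measurable_pi_lambda _ _ _ (pastAlg η n) _ _ fun i =>
    @measurable_pi_lambda _ _ _ (pastAlg η n) _ _ fun j => measurable_matProd_pastAlg n i j

variable [MeasurableSpace Ω]

/-- The variables `η n i` are measurable and i.i.d. with law `ρ`. -/
structure IsNoise (η : ℕ → Fin (d + 1) → Ω → ℝ) (P : Measure Ω) (ρ : Measure ℝ) : Prop where
  meas : ∀ n i, Measurable (η n i)
  indep : iIndepFun (fun p : ℕ × Fin (d + 1) => η p.1 p.2) P
  law : ∀ n i, P.map (η n i) = ρ

variable {P : Measure Ω} {ρ : Measure ℝ}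

lemma IsNoise.pastAlg_le (N : IsNoise η P ρ) (n : ℕ) : pastAlg η n ≤ ‹MeasurableSpace Ω› :=
  iSup₂_le fun p _ => (N.meas p.1 p.2).comap_le

/-- The noise vector at time `n` is independent of the past, with law `ρ ⊗ ⋯ ⊗ ρ`. -/
lemma IsNoise.map_prodMk [IsProbabilityMeasure P] (N : IsNoise η P ρ) {X : Type*}
    [MeasurableSpace X] {n : ℕ} {Z : Ω → X} (hZ : Measurable[pastAlg η n] Z) :
    P.map (fun ω => (Z ω, fun i => η n i ω)) = (P.map Z).prod (Measure.pi fun _ => ρ) := by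
  have hlaw : P.map (fun ω i => η n i ω) = Measure.pi fun _ => ρ := by
    have h1 : iIndepFun (fun i => η n i) P :=
      N.indep.precomp (g := fun i : Fin (d + 1) => (n, i)) (fun i j h => (Prod.ext_iff.1 h).2)
    rw [h1.map_fun_eq_pi_map fun i => (N.meas n i).aemeasurable]
    simp [N.law]
  have hind : IndepFun Z (fun ω i => η n i ω) P := by
    rw [IndepFun_iff_Indep]
    have h2 := indep_iSup_of_disjoint (m := fun p : ℕ × Fin (d + 1) =>
      MeasurableSpace.comap (η p.1 p.2) inferInstance) (μ := P)
      (fun p => (N.meas p.1 p.2).comap_le) N.indep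
      (S := {p : ℕ × Fin (d + 1) | p.1 < n}) (T := {p | p.1 = n})
      (Set.disjoint_left.2 fun p hp hq => by simp at hp hq; omega)
    refine indep_of_indep_of_le_left (indep_of_indep_of_le_right h2 ?_) hZ.comap_le
    refine Measurable.comap_le ?_
    refine @measurable_pi_lambda _ _ _ (_) _ _ fun i => ?_
    exact (comap_measurable (η n i)).mono
      (le_biSup (f := fun p : ℕ × Fin (d + 1) => MeasurableSpace.comap (η p.1 p.2) inferInstance)
        (show (n, i) ∈ {p : ℕ × Fin (d + 1) | p.1 = n} from rfl)) le_rfl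
  rw [hind.map_prod_eq_prod_map_map (hZ.mono (N.pastAlg_le n) le_rfl).aemeasurable
    (measurable_pi_lambda _ fun i => N.meas n i).aemeasurable, hlaw]

lemma IsNoise.lintegral_past [IsProbabilityMeasure P] (N : IsNoise η P ρ) [SigmaFinite ρ]
    {X : Type*} [MeasurableSpace X] {n : ℕ} {Z : Ω → X} (hZ : Measurable[pastAlg η n] Z)
    {G : X × (Fin (d + 1) → ℝ) → ENNReal} (hG : Measurable G) :
    ∫⁻ ω, G (Z ω, fun i => η n i ω) ∂P =
      ∫⁻ ω, ∫⁻ e, G (Z ω, e) ∂(Measure.pi fun _ => ρ) ∂P := by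
  have hZ' : Measurable Z := hZ.mono (N.pastAlg_le n) le_rfl
  rw [← lintegral_map (f := G) hG (hZ'.prodMk (measurable_pi_lambda _ fun i => N.meas n i)),
    N.map_prodMk hZ, lintegral_prod _ hG.aemeasurable, lintegral_map hG.lintegral_prod_right' hZ']

lemma IsNoise.integral_past [IsProbabilityMeasure P] (N : IsNoise η P ρ) [SigmaFinite ρ]
    {X : Type*} [MeasurableSpace X] {n : ℕ} {Z : Ω → X} (hZ : Measurable[pastAlg η n] Z)
    {G : X × (Fin (d + 1) → ℝ) → ℝ} (hG : Measurable G)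
    (hGi : Integrable (fun ω => G (Z ω, fun i => η n i ω)) P) :
    ∫ ω, G (Z ω, fun i => η n i ω) ∂P =
      ∫ ω, ∫ e, G (Z ω, e) ∂(Measure.pi fun _ => ρ) ∂P := by
  have hZ' : Measurable Z := hZ.mono (N.pastAlg_le n) le_rfl
  have hpm := hZ'.prodMk (measurable_pi_lambda _ fun i => N.meas n i)
  rw [← integral_map (f := G) hpm.aemeasurable hG.aestronglyMeasurable, N.map_prodMk hZ,
    integral_prod, integral_map hZ'.aemeasurable
      hG.stronglyMeasurable.integral_prod_right'.aestronglyMeasurable]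
  rw [← N.map_prodMk hZ, integrable_map_measure hG.aestronglyMeasurable hpm.aemeasurable]
  exact hGi

lemma IsNoise.integrable_past_mul [IsProbabilityMeasure P] (N : IsNoise η P ρ) [SigmaFinite ρ]
    {X : Type*} [MeasurableSpace X] {n : ℕ} {Z : Ω → X} (hZ : Measurable[pastAlg η n] Z)
    {f : X → ℝ} (hf : Measurable f) (hfi : Integrable (fun ω => f (Z ω)) P)
    {g : (Fin (d + 1) → ℝ) → ℝ} (hg : Integrable g (Measure.pi fun _ => ρ)) :
    Integrable (fun ω => f (Z ω) * g fun i => η n i ω) P := by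
  have hZ' : Measurable Z := hZ.mono (N.pastAlg_le n) le_rfl
  have hpm := hZ'.prodMk (measurable_pi_lambda _ fun i => N.meas n i)
  have h1 : Integrable (fun p : X × (Fin (d + 1) → ℝ) => f p.1 * g p.2)
      ((P.map Z).prod (Measure.pi fun _ => ρ)) :=
    Integrable.mul_prod ((integrable_map_measure hf.aestronglyMeasurable hZ'.aemeasurable).2 hfi) hg
  rw [← N.map_prodMk hZ] at h1
  exact h1.comp_measurable hpm

/-- The law of `z' Π_n` is the `n`-step transition law. -/
lemma IsNoise.integral_rowMul_matProd [IsProbabilityMeasure P] (N : IsNoise η P ρ)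
    [IsProbabilityMeasure ρ] {f : EuclideanSpace ℝ (Fin (d + 1)) → ℝ} (hf : Measurable f) {C : ℝ}
    (hC : ∀ z, |f z| ≤ C) (z : EuclideanSpace ℝ (Fin (d + 1))) (n : ℕ) :
    ∫ ω, f (rowMul z (matProd a σ η n ω)) ∂P = (transOp a σ ρ)^[n] f z := by
  induction n generalizing f with
  | zero => simp [matProd, rowMul]
  | succ n ih =>
    rw [Function.iterate_succ_apply, ← ih (measurable_transOp hf) (abs_transOp_le hC)]
    simp only [rowMul_matProd_succ]
    have hZ := measurable_rowMul_matProd_pastAlg (a := a) (σ := σ) (η := η) z n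
    refine N.integral_past hZ (G := fun p => f (step a σ p.1 p.2))
      (hf.comp (measurable_step a σ)) ?_
    refine Integrable.of_bound (Measurable.aestronglyMeasurable ?_) C (ae_of_all _ fun ω => hC _)
    exact (hf.comp (measurable_step a σ)).comp ((hZ.mono (N.pastAlg_le n) le_rfl).prodMk
      (measurable_pi_lambda _ fun i => N.meas n i))

/-! ### Moments -/

lemma NoiseLaw.memLp (H : NoiseLaw a σ ρ) (k : ℕ) : MemLp (fun t : ℝ => t) k ρ := by
  have := H.prob
  rcases Nat.eq_zero_or_pos k with rfl | hk
  · rw [Nat.cast_zero]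
    exact memLp_zero_iff_aestronglyMeasurable.2 measurable_id.aestronglyMeasurable
  · rw [← integrable_norm_rpow_iff (f := fun t : ℝ => t) (p := (k : ENNReal))
      measurable_id.aestronglyMeasurable
      (by simpa using hk.ne') (by simp)]
    simpa using H.moments k

lemma measurable_matNorm_companion :
    Measurable fun e : Fin (d + 1) → ℝ => matNorm (companion fun i => a i + σ i * e i) := by
  refine (continuous_matNorm.comp ?_).measurable
  refine continuous_matrix fun i j => ?_
  simp only [companion, Matrix.of_apply]
  split_ifs <;> fun_prop

/-- All moments of the norm of the random companion matrix are finite. -/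
lemma NoiseLaw.integrable_matNorm_rpow (H : NoiseLaw a σ ρ) {p : ℝ} (hp : 0 ≤ p) :
    Integrable (fun e : Fin (d + 1) → ℝ => matNorm (companion fun i => a i + σ i * e i) ^ p)
      (Measure.pi fun _ => ρ) := by
  have := H.prob
  set k := ⌈p⌉₊ with hk
  have hcoord : ∀ i : Fin (d + 1), MemLp (fun e : Fin (d + 1) → ℝ => e i) k
      (Measure.pi fun _ => ρ) :=
    fun i => (H.memLp k).comp_measurePreserving (measurePreserving_eval (fun _ => ρ) i)
  have hent : ∀ i j : Fin (d + 1), MemLp (fun e : Fin (d + 1) → ℝ =>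
      |companion (fun i => a i + σ i * e i) i j|) k (Measure.pi fun _ => ρ) := by
    intro i j
    simp only [companion, Matrix.of_apply]
    split_ifs
    · exact ((memLp_const (a j)).add ((hcoord j).const_mul (σ j))).abs
    · exact memLp_const _
    · exact memLp_const _
  have hsum : MemLp (fun e : Fin (d + 1) → ℝ => ∑ i, ∑ j,
      |companion (fun i => a i + σ i * e i) i j|) k (Measure.pi fun _ => ρ) :=
    memLp_finsetSum _ fun i _ => memLp_finsetSum _ fun j _ => hent i j
  have hM : MemLp (fun e : Fin (d + 1) → ℝ => matNorm (companion fun i => a i + σ i * e i)) k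
      (Measure.pi fun _ => ρ) := by
    refine hsum.mono measurable_matNorm_companion.aestronglyMeasurable (ae_of_all _ fun e => ?_)
    rw [Real.norm_of_nonneg (matNorm_nonneg _)]
    exact (matNorm_le_sum _).trans (le_abs_self _)
  have hMk := hM.integrable_norm_pow'
  refine ((integrable_const (1 : ℝ)).add hMk).mono'
    (measurable_matNorm_companion.pow_const p).aestronglyMeasurable (ae_of_all _ fun e => ?_)
  have h0 := matNorm_nonneg (companion fun i => a i + σ i * e i)
  rw [Real.norm_of_nonneg (Real.rpow_nonneg h0 _)]
  simp only [Pi.add_apply, Real.norm_of_nonneg h0]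
  rcases le_total (matNorm (companion fun i => a i + σ i * e i)) 1 with h1 | h1
  · have := Real.rpow_le_one h0 h1 hp
    have := pow_nonneg h0 k
    linarith
  · have := Real.rpow_le_rpow_of_exponent_le h1 (Nat.le_ceil p)
    rw [Real.rpow_natCast] at this
    linarith

lemma measurable_matNorm_of :
    Measurable fun A : Fin (d + 1) → Fin (d + 1) → ℝ => matNorm (Matrix.of A) := by
  refine (continuous_matNorm.comp ?_).measurable
  exact continuous_matrix fun i j => by simp only [Matrix.of_apply]; fun_prop

lemma IsNoise.integrable_matNorm_matProd [IsProbabilityMeasure P] (N : IsNoise η P ρ)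
    (H : NoiseLaw a σ ρ) {p : ℝ} (hp : 0 ≤ p) (n : ℕ) :
    Integrable (fun ω => matNorm (matProd a σ η n ω) ^ p) P := by
  have := H.prob
  have hm : Measurable fun A : Fin (d + 1) → Fin (d + 1) → ℝ => matNorm (Matrix.of A) ^ p :=
    measurable_matNorm_of.pow_const p
  induction n with
  | zero => simp only [matProd]; exact integrable_const _
  | succ n ih =>
    refine (N.integrable_past_mul (measurable_matProd_fun_pastAlg n) hm ih
      (H.integrable_matNorm_rpow hp)).mono' (hm.comp ((measurable_matProd_fun_pastAlg
        (n + 1)).mono (N.pastAlg_le _) le_rfl)).aestronglyMeasurable (ae_of_all _ fun ω => ?_)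
    have e1 : ∀ n, (Matrix.of fun i j => matProd a σ η n ω i j) = matProd a σ η n ω := fun _ => rfl
    simp only [e1]
    rw [Real.norm_of_nonneg (Real.rpow_nonneg (matNorm_nonneg _) _),
      ← Real.mul_rpow (matNorm_nonneg _) (matNorm_nonneg _)]
    exact Real.rpow_le_rpow (matNorm_nonneg _) (matNorm_mul_le _ _) hp

end RCA

namespace RCA
variable {d : ℕ} {a σ : Fin (d + 1) → ℝ} {ρ : Measure ℝ}

/-! ### The operator `Q_lam` on functions on the sphere -/

/-- The operator `Q_lam f (x) = E |x' A|^lam f (x' A / |x' A|)` on functions on the sphere. -/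
noncomputable def tiltOp (a σ : Fin (d + 1) → ℝ) (ρ : Measure ℝ) (lam : ℝ) (f : Sph d → ℝ)
    (x : Sph d) : ℝ :=
  ∫ e, ‖step a σ (x : EuclideanSpace ℝ (Fin (d + 1))) e‖ ^ lam *
    f (direction x (step a σ (x : EuclideanSpace ℝ (Fin (d + 1))) e)) ∂(Measure.pi fun _ => ρ)

lemma norm_step_le (x : Sph d) (e : Fin (d + 1) → ℝ) :
    ‖step a σ (x : EuclideanSpace ℝ (Fin (d + 1))) e‖ ≤
      matNorm (companion fun i => a i + σ i * e i) := by
  simpa [step] using norm_rowMul_le (x : EuclideanSpace ℝ (Fin (d + 1)))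
    (companion fun i => a i + σ i * e i)

lemma measurable_tilt_integrand (lam : ℝ) {f : Sph d → ℝ} (hf : Measurable f) :
    Measurable fun p : Sph d × (Fin (d + 1) → ℝ) =>
      ‖step a σ (p.1 : EuclideanSpace ℝ (Fin (d + 1))) p.2‖ ^ lam *
      f (direction p.1 (step a σ (p.1 : EuclideanSpace ℝ (Fin (d + 1))) p.2)) := by
  have h1 : Measurable fun p : Sph d × (Fin (d + 1) → ℝ) =>
      step a σ (p.1 : EuclideanSpace ℝ (Fin (d + 1))) p.2 :=
    measurable_step_comp (measurable_subtype_coe.comp measurable_fst) measurable_snd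
  exact (h1.norm.pow_const lam).mul (hf.comp (measurable_direction_comp measurable_fst h1))

lemma NoiseLaw.integrable_tilt (H : NoiseLaw a σ ρ) {lam : ℝ} (hlam : 0 ≤ lam) {f : Sph d → ℝ}
    (hf : Measurable f) {C : ℝ} (hC : ∀ x, |f x| ≤ C) (x : Sph d) :
    Integrable (fun e => ‖step a σ (x : EuclideanSpace ℝ (Fin (d + 1))) e‖ ^ lam *
      f (direction x (step a σ (x : EuclideanSpace ℝ (Fin (d + 1))) e)))
      (Measure.pi fun _ => ρ) := by
  refine ((H.integrable_matNorm_rpow hlam).mul_const C).mono'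
    ((measurable_tilt_integrand lam hf).comp measurable_prodMk_left).aestronglyMeasurable
    (ae_of_all _ fun e => ?_)
  rw [norm_mul, Real.norm_of_nonneg (Real.rpow_nonneg (norm_nonneg _) _)]
  exact mul_le_mul (Real.rpow_le_rpow (norm_nonneg _) (norm_step_le x e) hlam) (hC _)
    (abs_nonneg _) (Real.rpow_nonneg (matNorm_nonneg _) _)

lemma NoiseLaw.abs_tiltOp_le (H : NoiseLaw a σ ρ) {lam : ℝ} (hlam : 0 ≤ lam) {f : Sph d → ℝ}
    {C : ℝ} (hC : ∀ x, |f x| ≤ C) (x : Sph d) :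
    |tiltOp a σ ρ lam f x| ≤
      (∫ e : Fin (d + 1) → ℝ, matNorm (companion fun i => a i + σ i * e i) ^ lam
        ∂(Measure.pi fun _ => ρ)) * C := by
  rw [← integral_mul_const, ← Real.norm_eq_abs]
  refine norm_integral_le_of_norm_le ((H.integrable_matNorm_rpow hlam).mul_const C)
    (ae_of_all _ fun e => ?_)
  rw [norm_mul, Real.norm_of_nonneg (Real.rpow_nonneg (norm_nonneg _) _)]
  exact mul_le_mul (Real.rpow_le_rpow (norm_nonneg _) (norm_step_le x e) hlam) (hC _)
    (abs_nonneg _) (Real.rpow_nonneg (matNorm_nonneg _) _)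

lemma measurable_tiltOp [SigmaFinite ρ] (lam : ℝ) {f : Sph d → ℝ} (hf : Measurable f) :
    Measurable (tiltOp a σ ρ lam f) :=
  (measurable_tilt_integrand lam hf).stronglyMeasurable.integral_prod_right'.measurable

lemma NoiseLaw.bounded_tiltOp_iterate (H : NoiseLaw a σ ρ) {lam : ℝ} (hlam : 0 ≤ lam)
    {f : Sph d → ℝ} {C : ℝ} (hC : ∀ x, |f x| ≤ C) (n : ℕ) :
    ∃ C', ∀ x, |(tiltOp a σ ρ lam)^[n] f x| ≤ C' := by
  induction n with
  | zero => exact ⟨C, hC⟩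
  | succ n ih =>
    obtain ⟨C', h⟩ := ih
    simp only [Function.iterate_succ_apply']
    exact ⟨_, H.abs_tiltOp_le hlam h⟩

lemma measurable_tiltOp_iterate [SigmaFinite ρ] (lam : ℝ) {f : Sph d → ℝ} (hf : Measurable f)
    (n : ℕ) : Measurable ((tiltOp a σ ρ lam)^[n] f) := by
  induction n with
  | zero => exact hf
  | succ n ih => rw [Function.iterate_succ_apply']; exact measurable_tiltOp lam ih

lemma NoiseLaw.tiltOp_mono (H : NoiseLaw a σ ρ) {lam : ℝ} (hlam : 0 ≤ lam) {f g : Sph d → ℝ}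
    (hf : Measurable f) (hg : Measurable g) {C : ℝ} (hfC : ∀ x, |f x| ≤ C) {C' : ℝ}
    (hgC : ∀ x, |g x| ≤ C') (hfg : ∀ x, f x ≤ g x) (x : Sph d) :
    tiltOp a σ ρ lam f x ≤ tiltOp a σ ρ lam g x :=
  integral_mono (H.integrable_tilt hlam hf hfC x) (H.integrable_tilt hlam hg hgC x) fun _ =>
    mul_le_mul_of_nonneg_left (hfg _) (Real.rpow_nonneg (norm_nonneg _) _)

lemma NoiseLaw.tiltOp_iterate_mono (H : NoiseLaw a σ ρ) {lam : ℝ} (hlam : 0 ≤ lam)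
    {f g : Sph d → ℝ} (hf : Measurable f) (hg : Measurable g) {C : ℝ} (hfC : ∀ x, |f x| ≤ C)
    {C' : ℝ} (hgC : ∀ x, |g x| ≤ C') (hfg : ∀ x, f x ≤ g x) (n : ℕ) (x : Sph d) :
    (tiltOp a σ ρ lam)^[n] f x ≤ (tiltOp a σ ρ lam)^[n] g x := by
  have := H.prob
  induction n generalizing x with
  | zero => exact hfg x
  | succ n ih =>
    obtain ⟨D, hD⟩ := H.bounded_tiltOp_iterate hlam hfC n
    obtain ⟨D', hD'⟩ := H.bounded_tiltOp_iterate hlam hgC n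
    simp only [Function.iterate_succ_apply']
    exact H.tiltOp_mono hlam (measurable_tiltOp_iterate lam hf n)
      (measurable_tiltOp_iterate lam hg n) hD hD' ih x

lemma tiltOp_const_mul (lam c : ℝ) (f : Sph d → ℝ) :
    tiltOp a σ ρ lam (fun x => c * f x) = fun x => c * tiltOp a σ ρ lam f x := by
  ext x
  simp only [tiltOp, ← integral_const_mul]
  congr 1; ext e; ring

lemma tiltOp_iterate_const_mul (lam c : ℝ) (f : Sph d → ℝ) (n : ℕ) :
    (tiltOp a σ ρ lam)^[n] (fun x => c * f x) = fun x => c * (tiltOp a σ ρ lam)^[n] f x := by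
  induction n with
  | zero => rfl
  | succ n ih => simp only [Function.iterate_succ_apply']; rw [ih, tiltOp_const_mul]

section Omega

lemma norm_rowMul_matProd_le {Ω : Type*} {η : ℕ → Fin (d + 1) → Ω → ℝ} (x : Sph d) (n : ℕ) (ω : Ω) :
    ‖rowMul (x : EuclideanSpace ℝ (Fin (d + 1))) (matProd a σ η n ω)‖ ≤
      matNorm (matProd a σ η n ω) := by
  simpa using norm_rowMul_le (x : EuclideanSpace ℝ (Fin (d + 1))) (matProd a σ η n ω)

variable {Ω : Type*} [MeasurableSpace Ω] {η : ℕ → Fin (d + 1) → Ω → ℝ} {P : Measure Ω}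

lemma IsNoise.measurable_rowMul_matProd (N : IsNoise η P ρ) (z : EuclideanSpace ℝ (Fin (d + 1)))
    (n : ℕ) : Measurable fun ω => rowMul z (matProd a σ η n ω) :=
  (measurable_rowMul_matProd_pastAlg z n).mono (N.pastAlg_le n) le_rfl

lemma IsNoise.measurable_dirChain (N : IsNoise η P ρ) (x : Sph d) (n : ℕ) :
    Measurable (dirChain a σ η x n) :=
  (measurable_dirChain_pastAlg x le_rfl).mono (N.pastAlg_le n) le_rfl

variable [IsProbabilityMeasure P]

lemma IsNoise.integrable_tilt (N : IsNoise η P ρ) (H : NoiseLaw a σ ρ) {lam : ℝ} (hlam : 0 ≤ lam)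
    {f : Sph d → ℝ} (hf : Measurable f) {C : ℝ} (hC : ∀ x, |f x| ≤ C) (x : Sph d) (n : ℕ) :
    Integrable (fun ω =>
      ‖rowMul (x : EuclideanSpace ℝ (Fin (d + 1))) (matProd a σ η n ω)‖ ^ lam *
        f (dirChain a σ η x n ω)) P := by
  refine ((N.integrable_matNorm_matProd H hlam n).mul_const C).mono'
    (((N.measurable_rowMul_matProd _ n).norm.pow_const lam).mul
      (hf.comp (N.measurable_dirChain x n))).aestronglyMeasurable (ae_of_all _ fun ω => ?_)
  rw [norm_mul, Real.norm_of_nonneg (Real.rpow_nonneg (norm_nonneg _) _)]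
  exact mul_le_mul (Real.rpow_le_rpow (norm_nonneg _) (norm_rowMul_matProd_le x n ω) hlam) (hC _)
    (abs_nonneg _) (Real.rpow_nonneg (matNorm_nonneg _) _)

/-- The iterates of `Q_lam` are expectations over the products `Π_n`. -/
lemma IsNoise.integral_tilt (N : IsNoise η P ρ) (H : NoiseLaw a σ ρ) {lam : ℝ} (hlam : 0 ≤ lam)
    {f : Sph d → ℝ} (hf : Measurable f) {C : ℝ} (hC : ∀ x, |f x| ≤ C) (x : Sph d) (n : ℕ) :
    ∫ ω, ‖rowMul (x : EuclideanSpace ℝ (Fin (d + 1))) (matProd a σ η n ω)‖ ^ lam *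
        f (dirChain a σ η x n ω) ∂P = (tiltOp a σ ρ lam)^[n] f x := by
  have := H.prob
  induction n generalizing f C with
  | zero => simp [matProd, rowMul, dirChain]
  | succ n ih =>
    rw [Function.iterate_succ_apply,
      ← ih (measurable_tiltOp lam hf) (H.abs_tiltOp_le hlam hC)]
    have hZ := measurable_rowMul_matProd_pastAlg (a := a) (σ := σ) (η := η)
      (x : EuclideanSpace ℝ (Fin (d + 1))) n
    have hX := measurable_dirChain_pastAlg (a := a) (σ := σ) (η := η) x (le_refl n)
    have hint := N.integrable_tilt H hlam hf hC x (n + 1)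
    have e1 : ∀ ω, ‖rowMul (x : EuclideanSpace ℝ (Fin (d + 1))) (matProd a σ η (n + 1) ω)‖ ^ lam *
        f (dirChain a σ η x (n + 1) ω) =
        ‖rowMul (x : EuclideanSpace ℝ (Fin (d + 1))) (matProd a σ η n ω)‖ ^ lam *
        (‖step a σ (dirChain a σ η x n ω : EuclideanSpace ℝ (Fin (d + 1))) fun i => η n i ω‖ ^ lam *
          f (direction (dirChain a σ η x n ω)
            (step a σ (dirChain a σ η x n ω : EuclideanSpace ℝ (Fin (d + 1)))
              fun i => η n i ω))) := fun ω => by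
      rw [norm_rowMul_matProd_succ, Real.mul_rpow (norm_nonneg _) (norm_nonneg _), dirChain_succ,
        mul_assoc]
    simp only [e1] at hint ⊢
    have hA : Measurable fun p : (EuclideanSpace ℝ (Fin (d + 1)) × Sph d) × (Fin (d + 1) → ℝ) =>
        ‖p.1.1‖ ^ lam := (measurable_fst.comp measurable_fst).norm.pow_const lam
    have hB : Measurable fun p : (EuclideanSpace ℝ (Fin (d + 1)) × Sph d) × (Fin (d + 1) → ℝ) =>
        (p.1.2, p.2) := (measurable_snd.comp measurable_fst).prodMk measurable_snd
    have hG := hA.mul ((measurable_tilt_integrand (a := a) (σ := σ) lam hf).comp hB)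
    refine (N.integral_past (hZ.prodMk hX) hG hint).trans ?_
    refine integral_congr_ae (ae_of_all _ fun ω => ?_)
    exact integral_const_mul (‖rowMul (x : EuclideanSpace ℝ (Fin (d + 1)))
      (matProd a σ η n ω)‖ ^ lam) _

/-! ### Moments of the matrix products -/

lemma IsNoise.tiltOp_iterate_one_le (N : IsNoise η P ρ) (H : NoiseLaw a σ ρ) {lam : ℝ}
    (hlam : 0 ≤ lam) (n : ℕ) (x : Sph d) :
    (tiltOp a σ ρ lam)^[n] (fun _ => 1) x ≤ ∫ ω, matNorm (matProd a σ η n ω) ^ lam ∂P := by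
  rw [← N.integral_tilt H hlam measurable_const (C := 1) (by simp)]
  refine integral_mono (N.integrable_tilt H hlam measurable_const (C := 1) (by simp) x n)
    (N.integrable_matNorm_matProd H hlam n) fun ω => ?_
  simp only [mul_one]
  exact Real.rpow_le_rpow (norm_nonneg _) (norm_rowMul_matProd_le x n ω) hlam

/-- The moments of the norm of `Π_n` are comparable to the maximal moment of `x' Π_n`. -/
lemma IsNoise.integral_matNorm_le (N : IsNoise η P ρ) (H : NoiseLaw a σ ρ) {lam : ℝ}
    (hlam : 0 ≤ lam) (n : ℕ) {B : ℝ} (hB : ∀ x, (tiltOp a σ ρ lam)^[n] (fun _ => 1) x ≤ B) :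
    ∫ ω, matNorm (matProd a σ η n ω) ^ lam ∂P ≤ ((d + 1 : ℝ) ^ lam * (d + 1)) * B := by
  set b : Fin (d + 1) → Sph d := fun i => ⟨EuclideanSpace.single i 1, by simp⟩ with hb
  have hint : ∀ i, Integrable (fun ω =>
      ‖rowMul (b i : EuclideanSpace ℝ (Fin (d + 1))) (matProd a σ η n ω)‖ ^ lam) P := fun i => by
    simpa using N.integrable_tilt H hlam (f := fun _ => 1) measurable_const (C := 1) (by simp)
        (b i) n
  have h1 : ∀ ω, matNorm (matProd a σ η n ω) ^ lam ≤ (d + 1 : ℝ) ^ lam *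
      ∑ i, ‖rowMul (b i : EuclideanSpace ℝ (Fin (d + 1))) (matProd a σ η n ω)‖ ^ lam := by
    intro ω
    obtain ⟨k, -, hk⟩ := Finset.exists_max_image Finset.univ (fun i =>
      ‖rowMul (b i : EuclideanSpace ℝ (Fin (d + 1))) (matProd a σ η n ω)‖) ⟨0, Finset.mem_univ _⟩
    have h2 : matNorm (matProd a σ η n ω) ≤
        (d + 1) * ‖rowMul (b k : EuclideanSpace ℝ (Fin (d + 1))) (matProd a σ η n ω)‖ := by
      refine abs_le_of_sq_le_sq' ?_ (by positivity) |>.2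
      rw [matNorm_sq_eq_sum_rows]
      calc ∑ i, ‖rowMul (EuclideanSpace.single i 1) (matProd a σ η n ω)‖ ^ 2
          ≤ ∑ _i : Fin (d + 1),
            ‖rowMul (b k : EuclideanSpace ℝ (Fin (d + 1))) (matProd a σ η n ω)‖ ^ 2 :=
            Finset.sum_le_sum fun i hi => pow_le_pow_left₀ (norm_nonneg _) (hk i hi) 2
        _ = (d + 1) * ‖rowMul (b k : EuclideanSpace ℝ (Fin (d + 1))) (matProd a σ η n ω)‖ ^ 2 := by
            simp
        _ ≤ _ := by
            rw [mul_pow]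
            refine mul_le_mul_of_nonneg_right ?_ (by positivity)
            nlinarith [Nat.cast_nonneg (α := ℝ) d]
    calc matNorm (matProd a σ η n ω) ^ lam
        ≤ ((d + 1) * ‖rowMul (b k : EuclideanSpace ℝ (Fin (d + 1))) (matProd a σ η n ω)‖) ^ lam :=
          Real.rpow_le_rpow (matNorm_nonneg _) h2 hlam
      _ = (d + 1) ^ lam *
          ‖rowMul (b k : EuclideanSpace ℝ (Fin (d + 1))) (matProd a σ η n ω)‖ ^ lam :=
          Real.mul_rpow (by positivity) (norm_nonneg _)
      _ ≤ _ := by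
          refine mul_le_mul_of_nonneg_left ?_ (by positivity)
          exact Finset.single_le_sum (f := fun i =>
            ‖rowMul (b i : EuclideanSpace ℝ (Fin (d + 1))) (matProd a σ η n ω)‖ ^ lam)
            (fun i _ => Real.rpow_nonneg (norm_nonneg _) _) (Finset.mem_univ k)
  calc ∫ ω, matNorm (matProd a σ η n ω) ^ lam ∂P
      ≤ ∫ ω, (d + 1 : ℝ) ^ lam *
        ∑ i, ‖rowMul (b i : EuclideanSpace ℝ (Fin (d + 1))) (matProd a σ η n ω)‖ ^ lam ∂P :=
        integral_mono (N.integrable_matNorm_matProd H hlam n)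
          ((integrable_finsetSum _ fun i _ => hint i).const_mul _) h1
    _ = (d + 1 : ℝ) ^ lam * ∑ i, (tiltOp a σ ρ lam)^[n] (fun _ => 1) (b i) := by
        rw [integral_const_mul, integral_finsetSum _ fun i _ => hint i]
        congr 1
        refine Finset.sum_congr rfl fun i _ => ?_
        rw [← N.integral_tilt H hlam measurable_const (C := 1) (by simp)]
        simp
    _ ≤ (d + 1 : ℝ) ^ lam * ∑ _i : Fin (d + 1), B := by
        gcongr with i
        exact hB _
    _ = _ := by simp; ring

lemma IsNoise.integral_matNorm_add_le (N : IsNoise η P ρ) (H : NoiseLaw a σ ρ) {lam : ℝ}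
    (hlam : 0 ≤ lam) (n m : ℕ) :
    ∫ ω, matNorm (matProd a σ η (n + m) ω) ^ lam ∂P ≤ ((d + 1 : ℝ) ^ lam * (d + 1)) *
      ((∫ ω, matNorm (matProd a σ η n ω) ^ lam ∂P) *
        ∫ ω, matNorm (matProd a σ η m ω) ^ lam ∂P) := by
  have := H.prob
  refine N.integral_matNorm_le H hlam _ fun x => ?_
  rw [Function.iterate_add_apply]
  have hm0 : 0 ≤ ∫ ω, matNorm (matProd a σ η m ω) ^ lam ∂P :=
    integral_nonneg fun _ => Real.rpow_nonneg (matNorm_nonneg _) _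
  obtain ⟨D, hD⟩ := H.bounded_tiltOp_iterate hlam (f := fun _ => 1) (C := 1) (by simp) m
  have h1 := H.tiltOp_iterate_mono hlam (measurable_tiltOp_iterate lam measurable_const m)
    (g := fun _ => (∫ ω, matNorm (matProd a σ η m ω) ^ lam ∂P) * 1) measurable_const hD
    (C' := ∫ ω, matNorm (matProd a σ η m ω) ^ lam ∂P) (by simp [abs_of_nonneg hm0])
    (fun y => by simpa using N.tiltOp_iterate_one_le H hlam m y) n x
  rw [tiltOp_iterate_const_mul] at h1
  calc _ ≤ _ := h1
    _ ≤ (∫ ω, matNorm (matProd a σ η m ω) ^ lam ∂P) *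
        ∫ ω, matNorm (matProd a σ η n ω) ^ lam ∂P :=
        mul_le_mul_of_nonneg_left (N.tiltOp_iterate_one_le H hlam n x) hm0
    _ = _ := mul_comm _ _

end Omega

/-- The Lyapunov inequality: moments are logarithmically convex in the exponent. -/
lemma integral_rpow_le_mul {Ω : Type*} [MeasurableSpace Ω] {P : Measure Ω} [IsProbabilityMeasure P]
    {X : Ω → ℝ}
    (hX : ∀ ω, 0 ≤ X ω) (hXm : Measurable X) {p q s t : ℝ} (hp : 0 ≤ p) (hq : 0 ≤ q)
    (hs : 0 < s) (ht : 0 < t) (hst : s + t = 1) (hXp : Integrable (fun ω => X ω ^ p) P)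
    (hXq : Integrable (fun ω => X ω ^ q) P) :
    ∫ ω, X ω ^ (s * p + t * q) ∂P ≤ (∫ ω, X ω ^ p ∂P) ^ s * (∫ ω, X ω ^ q ∂P) ^ t := by
  have hpq : (1 / s).HolderConjugate (1 / t) := by
    refine Real.holderConjugate_iff.2 ⟨?_, ?_⟩
    · rw [lt_div_iff₀ hs]; linarith
    · simpa using hst
  have e1 : ∀ {c p : ℝ}, 0 < c → ∀ ω, (X ω ^ (c * p)) ^ (1 / c) = X ω ^ p := fun {c p} hc ω => by
    rw [← Real.rpow_mul (hX ω)]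
    congr 1
    field_simp
  have hmem : ∀ {c p : ℝ}, 0 < c → Integrable (fun ω => X ω ^ p) P →
      MemLp (fun ω => X ω ^ (c * p)) (ENNReal.ofReal (1 / c)) P := fun {c p} hc hi => by
    have hc' : 0 < 1 / c := by positivity
    rw [← integrable_norm_rpow_iff (hXm.pow_const _).aestronglyMeasurable (by simpa using hc)
      ENNReal.ofReal_ne_top, ENNReal.toReal_ofReal hc'.le]
    refine hi.congr (ae_of_all _ fun ω => ?_)
    simp only
    rw [Real.norm_of_nonneg (Real.rpow_nonneg (hX ω) _), e1 hc]
  have h := integral_mul_le_Lp_mul_Lq_of_nonneg hpq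
    (ae_of_all P fun ω => Real.rpow_nonneg (hX ω) (s * p))
    (ae_of_all P fun ω => Real.rpow_nonneg (hX ω) (t * q)) (hmem hs hXp) (hmem ht hXq)
  simp only [e1 hs, e1 ht, one_div_one_div] at h
  refine le_trans (le_of_eq ?_) h
  congr 1
  ext ω
  exact Real.rpow_add_of_nonneg (hX ω) (by positivity) (by positivity)

/-- For a symmetric law, adding a constant does not decrease the moments of order `p ≥ 1`. -/
lemma NoiseLaw.mul_le_integral_abs_rpow (H : NoiseLaw a σ ρ) {p : ℝ} (hp : 1 ≤ p) (c s : ℝ) :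
    |s| ^ p * ∫ t, |t| ^ p ∂ρ ≤ ∫ t, |c + s * t| ^ p ∂ρ := by
  have := H.prob
  obtain ⟨φ, hc, hpos, hsym, hρ⟩ := H.density
  have hneg : MeasurePreserving (fun t : ℝ => -t) ρ ρ := by
    refine ⟨measurable_neg, ?_⟩
    ext B hB
    rw [Measure.map_apply measurable_neg hB, hρ, withDensity_apply _ hB,
      withDensity_apply _ (measurable_neg hB)]
    have := (Measure.measurePreserving_neg (volume : Measure ℝ)).setLIntegral_comp_preimage hB
      (f := fun t => ENNReal.ofReal (φ t)) (by fun_prop)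
    simpa [hsym] using this
  have hint : ∀ c s : ℝ, Integrable (fun t => |c + s * t| ^ p) ρ := by
    intro c s
    have hp0 : 0 < p := by linarith
    have hmem : MemLp (fun t : ℝ => c + s * t) (ENNReal.ofReal p) ρ := by
      have h1 : MemLp (fun t : ℝ => t) (ENNReal.ofReal p) ρ := by
        refine (H.memLp ⌈p⌉₊).mono_exponent ?_
        rw [← ENNReal.ofReal_natCast]
        exact ENNReal.ofReal_le_ofReal (Nat.le_ceil p)
      exact (memLp_const c).add (h1.const_mul s)
    have := (integrable_norm_rpow_iff hmem.1 (by simpa using hp0) ENNReal.ofReal_ne_top).2 hmem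
    simpa [ENNReal.toReal_ofReal hp0.le] using this
  have h1 : ∫ t, |c + s * t| ^ p ∂ρ = ∫ t, |c - s * t| ^ p ∂ρ := by
    have h2 : MeasurableEmbedding (fun t : ℝ => -t) := (MeasurableEquiv.neg ℝ).measurableEmbedding
    have := hneg.integral_comp h2 (fun t => |c + s * t| ^ p)
    rw [← this]
    simp [sub_eq_add_neg]
  have hint' : Integrable (fun t => |c - s * t| ^ p) ρ := by
    simpa [sub_eq_add_neg] using hint c (-s)
  have h2 : ∫ t, |c + s * t| ^ p ∂ρ =
      ∫ t, ((1 / 2 : ℝ) * |c + s * t| ^ p + (1 / 2) * |c - s * t| ^ p) ∂ρ := by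
    rw [integral_add ((hint c s).const_mul _) (hint'.const_mul _), integral_const_mul,
      integral_const_mul, ← h1]
    ring
  rw [h2, ← integral_const_mul]
  have hint0 := hint 0 s
  refine integral_mono ?_ (((hint c s).const_mul _).add (hint'.const_mul _)) fun t => ?_
  · refine hint0.congr (ae_of_all _ fun t => ?_)
    simp only [zero_add, abs_mul]
    exact Real.mul_rpow (abs_nonneg _) (abs_nonneg _)
  · simp only
    rw [← Real.mul_rpow (abs_nonneg _) (abs_nonneg _), ← abs_mul]
    have hconv := (convexOn_rpow hp).2
      (Set.mem_Ici.2 (abs_nonneg (c + s * t))) (Set.mem_Ici.2 (abs_nonneg (c - s * t)))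
      (show (0 : ℝ) ≤ 1 / 2 by norm_num) (show (0 : ℝ) ≤ 1 / 2 by norm_num) (by norm_num)
    simp only [smul_eq_mul] at hconv
    refine le_trans (Real.rpow_le_rpow (abs_nonneg _) ?_ (by linarith)) hconv
    have : s * t = 1 / 2 * (c + s * t) - 1 / 2 * (c - s * t) := by ring
    calc |s * t| = |1 / 2 * (c + s * t) - 1 / 2 * (c - s * t)| := by rw [← this]
      _ ≤ |1 / 2 * (c + s * t)| + |1 / 2 * (c - s * t)| := abs_sub _ _
      _ = _ := by rw [abs_mul, abs_mul]; norm_num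

end RCA

namespace RCA
variable {d : ℕ} {a σ : Fin (d + 1) → ℝ} {ρ : Measure ℝ}

/-! ### Decay of second moments -/

section MatrixPowers

attribute [local instance] Matrix.linftyOpNormedRing Matrix.linftyOpNormedAlgebra

/-- By Gelfand's formula, the powers of a matrix whose eigenvalues all have modulus less than one
decay exponentially. -/
lemma exists_norm_pow_apply_le {ι : Type*} [Fintype ι] [DecidableEq ι] [Nonempty ι]
    (B : Matrix ι ι ℂ) (hB : ∀ z : ℂ, Module.End.HasEigenvalue (Matrix.toLin' B) z → ‖z‖ < 1) :
    ∃ r C : ℝ, 0 < r ∧ r < 1 ∧ ∀ n i j, ‖(B ^ n) i j‖ ≤ C * r ^ n := by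
  have hsr : spectralRadius ℂ B < ((1 : NNReal) : ENNReal) := by
    refine spectrum.spectralRadius_lt_of_forall_lt B fun z hz => ?_
    rw [← Matrix.spectrum_toLin', ← Module.End.hasEigenvalue_iff_mem_spectrum] at hz
    exact_mod_cast hB z hz
  obtain ⟨r, hr1, hr2⟩ := ENNReal.lt_iff_exists_nnreal_btwn.1 hsr
  have hr0 : 0 < r := by
    by_contra h
    have : r = 0 := le_antisymm (not_lt.1 h) zero_le
    rw [this] at hr1
    exact not_lt_bot hr1
  have hev := (spectrum.pow_nnnorm_pow_one_div_tendsto_nhds_spectralRadius B).eventually_lt_const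
      hr1
  obtain ⟨N, hN⟩ := eventually_atTop.1 hev
  have hN' : ∀ n, N ≤ n → ‖B ^ n‖ ≤ (r : ℝ) ^ n := by
    intro n hn
    rcases Nat.eq_zero_or_pos n with rfl | hpos
    · simp
    have h1 := (hN n hn).le
    have hn' : (0 : ℝ) < n := by exact_mod_cast hpos
    have h2 := ENNReal.rpow_le_rpow h1 hn'.le
    rw [← ENNReal.rpow_mul, one_div_mul_cancel hn'.ne', ENNReal.rpow_one,
        ENNReal.rpow_natCast] at h2
    exact_mod_cast h2
  have hentry : ∀ (M : Matrix ι ι ℂ) i j, ‖M i j‖ ≤ ‖M‖ := by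
    intro M i j
    have h1 : ‖M i j‖₊ ≤ ‖M‖₊ := by
      rw [Matrix.linfty_opNNNorm_def]
      calc ‖M i j‖₊ ≤ ∑ j, ‖M i j‖₊ :=
            Finset.single_le_sum (f := fun j => ‖M i j‖₊) (fun _ _ => zero_le) (Finset.mem_univ j)
        _ ≤ _ := Finset.le_sup (f := fun i => ∑ j, ‖M i j‖₊) (Finset.mem_univ i)
    exact_mod_cast h1
  refine ⟨r, 1 + ∑ k ∈ Finset.range N, ‖B ^ k‖ / (r : ℝ) ^ k, hr0, by exact_mod_cast hr2,
    fun n i j => (hentry _ i j).trans ?_⟩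
  have hrn : (0 : ℝ) < (r : ℝ) ^ n := pow_pos (by exact_mod_cast hr0) n
  have hs : ∀ k, (0 : ℝ) ≤ ‖B ^ k‖ / (r : ℝ) ^ k := fun k => by positivity
  rcases le_or_gt N n with h | h
  · have h1 := hN' n h
    have h2 : (0 : ℝ) ≤ ∑ k ∈ Finset.range N, ‖B ^ k‖ / (r : ℝ) ^ k :=
      Finset.sum_nonneg fun k _ => hs k
    nlinarith
  · have h2 := Finset.single_le_sum (f := fun k => ‖B ^ k‖ / (r : ℝ) ^ k) (fun k _ => hs k)
      (Finset.mem_range.2 h)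
    rw [← div_le_iff₀ hrn]
    linarith

end MatrixPowers

section Omega

variable {Ω : Type*} [MeasurableSpace Ω] {η : ℕ → Fin (d + 1) → Ω → ℝ} {P : Measure Ω}
  [IsProbabilityMeasure P]

lemma abs_apply_le_matNorm (A : Matrix (Fin (d + 1)) (Fin (d + 1)) ℝ) (i j : Fin (d + 1)) :
    |A i j| ≤ matNorm A := by
  refine Real.abs_le_sqrt ?_ |>.trans_eq (Real.sqrt_sq (matNorm_nonneg A))
  rw [matNorm_sq]
  calc A i j ^ 2 ≤ ∑ j, A i j ^ 2 :=
        Finset.single_le_sum (f := fun j => A i j ^ 2) (fun _ _ => sq_nonneg _) (Finset.mem_univ j)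
    _ ≤ _ := Finset.single_le_sum (f := fun i => ∑ j, A i j ^ 2)
        (fun _ _ => Finset.sum_nonneg fun _ _ => sq_nonneg _) (Finset.mem_univ i)

lemma abs_mul_apply_le_matNorm (A : Matrix (Fin (d + 1)) (Fin (d + 1)) ℝ)
    (i j k l : Fin (d + 1)) : |A i j * A k l| ≤ matNorm A ^ (2 : ℝ) := by
  rw [abs_mul, Real.rpow_two, sq]
  exact mul_le_mul (abs_apply_le_matNorm A i j) (abs_apply_le_matNorm A k l) (abs_nonneg _)
    (matNorm_nonneg A)

/-- The second moments of the entries of `Π_n` are the entries of the powers of `E (A ⊗ A)`. -/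
lemma IsNoise.integral_matProd_mul (N : IsNoise η P ρ) (H : NoiseLaw a σ ρ) (n : ℕ)
    (i i' j j' : Fin (d + 1)) :
    Integrable (fun ω => matProd a σ η n ω i j * matProd a σ η n ω i' j') P ∧
    ∫ ω, matProd a σ η n ω i j * matProd a σ η n ω i' j' ∂P =
      ((Matrix.of fun r s : Fin (d + 1) × Fin (d + 1) =>
        ∫ ω, Matrix.kronecker (coeffMat a σ η 0 ω) (coeffMat a σ η 0 ω) r s ∂P) ^ n)
        (i, i') (j, j') := by
  have := H.prob
  set M : Matrix (Fin (d + 1) × Fin (d + 1)) (Fin (d + 1) × Fin (d + 1)) ℝ :=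
    Matrix.of fun r s => ∫ ω, Matrix.kronecker (coeffMat a σ η 0 ω) (coeffMat a σ η 0 ω) r s ∂P
    with hM
  have hcm : ∀ k l, Measurable fun e : Fin (d + 1) → ℝ =>
      companion (fun i => a i + σ i * e i) k l := by
    intro k l
    simp only [companion, Matrix.of_apply]
    split_ifs <;> fun_prop
  have hci : ∀ k k' l l', Integrable (fun e : Fin (d + 1) → ℝ =>
      companion (fun i => a i + σ i * e i) k l * companion (fun i => a i + σ i * e i) k' l')
      (Measure.pi fun _ => ρ) := fun k k' l l' =>
    (H.integrable_matNorm_rpow (p := 2) (by norm_num)).mono'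
      ((hcm k l).mul (hcm k' l')).aestronglyMeasurable
      (ae_of_all _ fun e => abs_mul_apply_le_matNorm _ _ _ _ _)
  have hpi : ∀ n k k' l l',
      Integrable (fun ω => matProd a σ η n ω k l * matProd a σ η n ω k' l') P :=
    fun n k k' l l' => (N.integrable_matNorm_matProd H (p := 2) (by norm_num) n).mono'
      (((measurable_matProd_pastAlg n k l).mul (measurable_matProd_pastAlg n k' l')).mono
        (N.pastAlg_le n) le_rfl).aestronglyMeasurable
      (ae_of_all _ fun ω => abs_mul_apply_le_matNorm _ _ _ _ _)
  refine ⟨hpi n i i' j j', ?_⟩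
  have hMe : ∀ k k' l l', M (k, k') (l, l') = ∫ e : Fin (d + 1) → ℝ,
      companion (fun i => a i + σ i * e i) k l * companion (fun i => a i + σ i * e i) k' l'
        ∂(Measure.pi fun _ => ρ) := by
    intro k k' l l'
    have hG : Measurable fun p : Unit × (Fin (d + 1) → ℝ) =>
        companion (fun i => a i + σ i * p.2 i) k l * companion (fun i => a i + σ i * p.2 i) k' l' :=
      ((hcm k l).mul (hcm k' l')).comp measurable_snd
    have h := N.integral_past (n := 0) (Z := fun _ => ()) (@measurable_const _ _ _ (pastAlg η 0) _)
      hG (by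
        have h2 := N.integrable_past_mul (n := 0) (Z := fun _ => ())
          (@measurable_const _ _ _ (pastAlg η 0) _) (f := fun _ => 1) measurable_const
          (integrable_const _) (hci k k' l l')
        simpa using h2)
    simp only [integral_const, probReal_univ, one_smul] at h
    rw [← h]
    rfl
  induction n generalizing j j' with
  | zero =>
    simp only [matProd, pow_zero, Matrix.one_apply, Prod.mk.injEq, integral_const, probReal_univ,
      one_smul]
    split_ifs <;> simp_all
  | succ n ih =>
    have e1 : ∀ ω, matProd a σ η (n + 1) ω i j * matProd a σ η (n + 1) ω i' j' =
        ∑ k, ∑ k', (matProd a σ η n ω i k * matProd a σ η n ω i' k') *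
          (coeffMat a σ η n ω k j * coeffMat a σ η n ω k' j') := by
      intro ω
      simp only [matProd, Matrix.mul_apply]
      rw [Finset.sum_mul_sum]
      refine Finset.sum_congr rfl fun k _ => Finset.sum_congr rfl fun k' _ => by ring
    have hZ := measurable_matProd_fun_pastAlg (a := a) (σ := σ) (η := η) n
    have hf : ∀ k k', Measurable fun B : Fin (d + 1) → Fin (d + 1) → ℝ => B i k * B i' k' :=
      fun k k' => by fun_prop
    have hint : ∀ k k', Integrable (fun ω => (matProd a σ η n ω i k * matProd a σ η n ω i' k') *
        (coeffMat a σ η n ω k j * coeffMat a σ η n ω k' j')) P := fun k k' =>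
      N.integrable_past_mul hZ (hf k k') (hpi n i i' k k') (hci k k' j j')
    simp only [e1]
    rw [integral_finsetSum _ fun k _ => integrable_finsetSum _ fun k' _ => hint k k', pow_succ,
      Matrix.mul_apply, Fintype.sum_prod_type]
    refine Finset.sum_congr rfl fun k _ => ?_
    rw [integral_finsetSum _ fun k' _ => hint k k']
    refine Finset.sum_congr rfl fun k' _ => ?_
    rw [← ih, hMe, ← integral_mul_const]
    have hG := ((hf k k').comp measurable_fst).mul (((hcm k j).mul (hcm k' j')).comp
      (measurable_snd (α := Fin (d + 1) → Fin (d + 1) → ℝ)))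
    refine (N.integral_past hZ hG (hint k k')).trans ?_
    refine integral_congr_ae (ae_of_all _ fun ω => ?_)
    exact integral_const_mul (matProd a σ η n ω i k * matProd a σ η n ω i' k') _

lemma IsNoise.exists_second_moment_le (N : IsNoise η P ρ) (H : NoiseLaw a σ ρ)
    (hD0 : CondD0 a σ η P) : ∃ r C : ℝ, 0 < r ∧ r < 1 ∧
      ∀ n, ∫ ω, matNorm (matProd a σ η n ω) ^ (2 : ℝ) ∂P ≤ C * r ^ n := by
  set M : Matrix (Fin (d + 1) × Fin (d + 1)) (Fin (d + 1) × Fin (d + 1)) ℝ :=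
    Matrix.of fun r s => ∫ ω, Matrix.kronecker (coeffMat a σ η 0 ω) (coeffMat a σ η 0 ω) r s ∂P
    with hM
  obtain ⟨r, C, hr0, hr1, hb⟩ := exists_norm_pow_apply_le (M.map (algebraMap ℝ ℂ)) hD0
  refine ⟨r, ∑ _i : Fin (d + 1), ∑ _j : Fin (d + 1), C, hr0, hr1, fun n => ?_⟩
  have h1 : ∫ ω, matNorm (matProd a σ η n ω) ^ (2 : ℝ) ∂P =
      ∑ i, ∑ j, (M ^ n) (i, i) (j, j) := by
    simp only [Real.rpow_two, matNorm_sq]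
    simp only [sq]
    rw [integral_finsetSum _ fun i _ => integrable_finsetSum _ fun j _ =>
      (N.integral_matProd_mul H n i i j j).1]
    refine Finset.sum_congr rfl fun i _ => ?_
    rw [integral_finsetSum _ fun j _ => (N.integral_matProd_mul H n i i j j).1]
    exact Finset.sum_congr rfl fun j _ => (N.integral_matProd_mul H n i i j j).2
  rw [h1, Finset.sum_mul]
  refine Finset.sum_le_sum fun i _ => ?_
  rw [Finset.sum_mul]
  refine Finset.sum_le_sum fun j _ => ?_
  have h2 := hb n (i, i) (j, j)
  rw [← Matrix.map_pow] at h2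
  simp only [Matrix.map_apply, Complex.coe_algebraMap, Complex.norm_real] at h2
  exact (le_abs_self _).trans h2

/-! ### Existence and uniqueness of the exponent -/

/-- For `lam ≥ 1` the moments of `Π_n` grow at least like the powers of `E |σ_1 η|^lam`. -/
lemma IsNoise.pow_le_integral_matNorm (N : IsNoise η P ρ) (H : NoiseLaw a σ ρ) {lam : ℝ}
    (hlam : 1 ≤ lam) (n : ℕ) :
    (|σ 0| ^ lam * ∫ t, |t| ^ lam ∂ρ) ^ n ≤ ∫ ω, matNorm (matProd a σ η n ω) ^ lam ∂P := by
  have := H.prob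
  have hlam0 : 0 ≤ lam := by linarith
  set z : EuclideanSpace ℝ (Fin (d + 1)) := EuclideanSpace.single 0 1 with hz
  have hle : ∀ n ω, |rowMul z (matProd a σ η n ω) 0| ^ lam ≤ matNorm (matProd a σ η n ω) ^ lam := by
    intro n ω
    refine Real.rpow_le_rpow (abs_nonneg _) ?_ hlam0
    refine (PiLp.norm_apply_le (rowMul z (matProd a σ η n ω)) 0).trans ?_
    simpa [hz] using norm_rowMul_le z (matProd a σ η n ω)
  have hcm : Measurable fun v : EuclideanSpace ℝ (Fin (d + 1)) => |v 0| ^ lam :=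
    (by fun_prop : Measurable fun v : EuclideanSpace ℝ (Fin (d + 1)) => |v 0|).pow_const lam
  have hint : ∀ n, Integrable (fun ω => |rowMul z (matProd a σ η n ω) 0| ^ lam) P := fun n =>
    (N.integrable_matNorm_matProd H hlam0 n).mono'
      (hcm.comp (N.measurable_rowMul_matProd z n)).aestronglyMeasurable (ae_of_all _ fun ω => by
        rw [Real.norm_of_nonneg (Real.rpow_nonneg (abs_nonneg _) _)]; exact hle n ω)
  refine le_trans ?_ (integral_mono (hint n) (N.integrable_matNorm_matProd H hlam0 n) (hle n))
  set m := |σ 0| ^ lam * ∫ t, |t| ^ lam ∂ρ with hm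
  have hm0 : 0 ≤ m := mul_nonneg (Real.rpow_nonneg (abs_nonneg _) _)
    (integral_nonneg fun _ => Real.rpow_nonneg (abs_nonneg _) _)
  induction n with
  | zero => simp [matProd, rowMul, hz]
  | succ n ih =>
    have hG : Measurable fun p : EuclideanSpace ℝ (Fin (d + 1)) × (Fin (d + 1) → ℝ) =>
        |step a σ p.1 p.2 0| ^ lam := hcm.comp (measurable_step a σ)
    have hZ := measurable_rowMul_matProd_pastAlg (a := a) (σ := σ) (η := η) z n
    have hi := hint (n + 1)
    simp only [rowMul_matProd_succ] at hi ⊢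
    have h1 := N.integral_past hZ hG hi
    rw [h1]
    -- The next first entry is a constant plus `y 0 * σ 0 * t`, with `t` symmetric.
    have h2 : ∀ y : EuclideanSpace ℝ (Fin (d + 1)), m * |y 0| ^ lam ≤
        ∫ e, |step a σ y e 0| ^ lam ∂(Measure.pi fun _ : Fin (d + 1) => ρ) := by
      intro y
      have h3 := integral_map (μ := Measure.pi fun _ : Fin (d + 1) => ρ)
        (measurePreserving_eval (fun _ : Fin (d + 1) => ρ) 0).measurable.aemeasurable
        (f := fun t => |(y 0 * a 0 + nextCoord y 0) + (y 0 * σ 0) * t| ^ lam) (by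
          refine Measurable.aestronglyMeasurable ?_
          exact (by fun_prop : Measurable fun t : ℝ =>
            |(y 0 * a 0 + nextCoord y 0) + (y 0 * σ 0) * t|).pow_const lam)
      rw [(measurePreserving_eval (fun _ : Fin (d + 1) => ρ) 0).map_eq] at h3
      have h4 : ∀ e, step a σ y e 0 =
          (y 0 * a 0 + nextCoord y 0) + (y 0 * σ 0) * Function.eval 0 e := fun e => by
        rw [step_apply]; simp; ring
      simp only [h4]
      rw [← h3]
      refine le_trans (le_of_eq ?_) (H.mul_le_integral_abs_rpow hlam _ _)
      rw [abs_mul, Real.mul_rpow (abs_nonneg _) (abs_nonneg _), hm]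
      ring
    have hi2 : Integrable (fun ω => ∫ e, |step a σ (rowMul z (matProd a σ η n ω)) e 0| ^ lam
        ∂(Measure.pi fun _ : Fin (d + 1) => ρ)) P := by
      have hpm := ((hZ.mono (N.pastAlg_le n) le_rfl).prodMk
        (measurable_pi_lambda _ fun i => N.meas n i))
      have h5 := (integrable_map_measure hG.aestronglyMeasurable hpm.aemeasurable).2 hi
      rw [N.map_prodMk hZ] at h5
      exact h5.integral_prod_left.comp_measurable (hZ.mono (N.pastAlg_le n) le_rfl)
    refine le_trans ?_ (integral_mono ((hint n).const_mul m) hi2 fun ω => h2 _)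
    rw [integral_const_mul, pow_succ, mul_comm]
    exact mul_le_mul_of_nonneg_left ih hm0

end Omega

/-- Fekete's lemma for sequences that are submultiplicative up to a constant factor. -/
lemma exists_tendsto_rpow_one_div {E : ℕ → ℝ} {K m : ℝ} (hK : 0 < K) (hm : 0 < m)
    (hmE : ∀ n, m ^ n ≤ E n) (hE : ∀ n k, E (n + k) ≤ K * (E n * E k)) :
    ∃ κ, m ≤ κ ∧ Tendsto (fun n : ℕ => E n ^ (1 / (n : ℝ))) atTop (𝓝 κ) := by
  have hpos : ∀ n, 0 < E n := fun n => lt_of_lt_of_le (pow_pos hm n) (hmE n)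
  -- The factor `K` turns `E` into a submultiplicative sequence.
  set u : ℕ → ℝ := fun n => Real.log (K * E n) with hu
  have hsub : Subadditive u := by
    intro n k
    simp only [hu]
    rw [← Real.log_mul (mul_pos hK (hpos n)).ne' (mul_pos hK (hpos k)).ne']
    refine Real.log_le_log (mul_pos hK (hpos _)) ?_
    calc K * E (n + k) ≤ K * (K * (E n * E k)) := mul_le_mul_of_nonneg_left (hE n k) hK.le
      _ = _ := by ring
  have hlow : ∀ n : ℕ, n * Real.log m + Real.log K ≤ u n := by
    intro n
    simp only [hu]
    rw [Real.log_mul hK.ne' (hpos n).ne', ← Real.log_pow, add_comm]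
    have := Real.log_le_log (pow_pos hm n) (hmE n)
    linarith
  have hbdd : BddBelow (Set.range fun n : ℕ => u n / n) := by
    refine ⟨min 0 (Real.log m - |Real.log K|), ?_⟩
    rintro _ ⟨n, rfl⟩
    rcases Nat.eq_zero_or_pos n with rfl | hn
    · simp
    refine (min_le_right _ _).trans ?_
    have hn1 : (1 : ℝ) ≤ n := by exact_mod_cast hn
    simp only
    rw [le_div_iff₀ (by linarith)]
    have h1 := hlow n
    have h2 := neg_abs_le (Real.log K)
    have h3 : |Real.log K| ≤ |Real.log K| * n := le_mul_of_one_le_right (abs_nonneg _) hn1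
    nlinarith
  have hlim := hsub.tendsto_lim hbdd
  have hlog : Tendsto (fun n : ℕ => u n / n - Real.log K / n) atTop (𝓝 (hsub.lim - 0)) :=
    hlim.sub (tendsto_const_div_atTop_nhds_zero_nat _)
  have hconv : Tendsto (fun n : ℕ => E n ^ (1 / (n : ℝ))) atTop (𝓝 (Real.exp (hsub.lim - 0))) := by
    refine ((Real.continuous_exp.tendsto _).comp hlog).congr fun n => ?_
    simp only [Function.comp_def, hu]
    rw [Real.rpow_def_of_pos (hpos n), Real.log_mul hK.ne' (hpos n).ne']
    congr 1
    ring
  refine ⟨_, ge_of_tendsto hconv ?_, hconv⟩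
  filter_upwards [eventually_gt_atTop 0] with n hn
  have h1 := Real.rpow_le_rpow (pow_pos hm n).le (hmE n) (show 0 ≤ 1 / (n : ℝ) by positivity)
  rwa [one_div, Real.pow_rpow_inv_natCast hm.le hn.ne', ← one_div] at h1

section Exponent

variable {Ω : Type*} [MeasurableSpace Ω] {η : ℕ → Fin (d + 1) → Ω → ℝ} {P : Measure Ω}

lemma IsNoise.measurable_matNorm_matProd (N : IsNoise η P ρ) (n : ℕ) :
    Measurable fun ω => matNorm (matProd a σ η n ω) :=
  measurable_matNorm_of.comp
    ((measurable_matProd_fun_pastAlg n).mono (N.pastAlg_le n) le_rfl)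

lemma kappa_nonneg {lam κ : ℝ} (h : KappaEq a σ η P lam κ) : 0 ≤ κ :=
  ge_of_tendsto' h fun _ => Real.rpow_nonneg
    (integral_nonneg fun _ => Real.rpow_nonneg (matNorm_nonneg _) _) _

lemma kappa_le_of_le_mul_pow {lam κ r C : ℝ} (hr0 : 0 < r)
    (hb : ∀ n, ∫ ω, matNorm (matProd a σ η n ω) ^ lam ∂P ≤ C * r ^ n)
    (h : KappaEq a σ η P lam κ) : κ ≤ r := by
  set C' := max C 1 with hC'
  have hC'0 : 0 < C' := lt_of_lt_of_le one_pos (le_max_right _ _)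
  have hlim : Tendsto (fun n : ℕ => C' ^ (1 / (n : ℝ)) * r) atTop (𝓝 (C' ^ (0 : ℝ) * r)) := by
    refine Tendsto.mul_const r ?_
    exact ((Real.continuous_const_rpow hC'0.ne').tendsto 0).comp tendsto_one_div_atTop_nhds_zero_nat
  rw [Real.rpow_zero, one_mul] at hlim
  refine le_of_tendsto_of_tendsto h hlim ?_
  filter_upwards [eventually_gt_atTop 0] with n hn
  have h0 : 0 ≤ ∫ ω, matNorm (matProd a σ η n ω) ^ lam ∂P :=
    integral_nonneg fun _ => Real.rpow_nonneg (matNorm_nonneg _) _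
  have h1 : ∫ ω, matNorm (matProd a σ η n ω) ^ lam ∂P ≤ C' * r ^ n :=
    (hb n).trans (mul_le_mul_of_nonneg_right (le_max_left _ _) (pow_nonneg hr0.le n))
  refine (Real.rpow_le_rpow h0 h1 (by positivity : (0 : ℝ) ≤ 1 / n)).trans (le_of_eq ?_)
  rw [Real.mul_rpow hC'0.le (pow_nonneg hr0.le n), one_div,
    Real.pow_rpow_inv_natCast hr0.le hn.ne']

variable [IsProbabilityMeasure P]

lemma IsNoise.exists_kappaEq (N : IsNoise η P ρ) (H : NoiseLaw a σ ρ) {lam : ℝ} (hlam : 1 ≤ lam) :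
    ∃ κ, |σ 0| ^ lam * ∫ t, |t| ^ lam ∂ρ ≤ κ ∧ KappaEq a σ η P lam κ := by
  have hσ := H.first
  have hprob := H.prob
  have hlam0 : 0 < lam := by linarith
  refine exists_tendsto_rpow_one_div (K := (d + 1 : ℝ) ^ lam * (d + 1)) (by positivity) ?_
    (N.pow_le_integral_matNorm H hlam) (N.integral_matNorm_add_le H hlam0.le)
  refine mul_pos (Real.rpow_pos_of_pos (abs_pos.2 hσ.ne') _) ?_
  have hne : ∀ᵐ t ∂ρ, t ≠ 0 := by
    have := H.nullSingletonClass
    exact ae_iff.2 (by simp)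
  have hi : Integrable (fun t : ℝ => |t| ^ lam) ρ := by
    have h1 : MemLp (fun t : ℝ => t) (ENNReal.ofReal lam) ρ := by
      refine (H.memLp ⌈lam⌉₊).mono_exponent ?_
      rw [← ENNReal.ofReal_natCast]
      exact ENNReal.ofReal_le_ofReal (Nat.le_ceil lam)
    have := (integrable_norm_rpow_iff h1.1 (by simpa using hlam0) ENNReal.ofReal_ne_top).2 h1
    simpa [ENNReal.toReal_ofReal hlam0.le] using this
  rw [integral_pos_iff_support_of_nonneg (fun t => Real.rpow_nonneg (abs_nonneg _) _) hi]
  refine pos_iff_ne_zero.2 fun h0 => ?_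
  have h1 : ∀ᵐ t ∂ρ, False := by
    filter_upwards [hne, measure_eq_zero_iff_ae_notMem.1 h0] with t ht ht'
    exact ht' (Real.rpow_pos_of_pos (abs_pos.2 ht) _).ne'
  exact IsProbabilityMeasure.ne_zero ρ (by simpa using h1)

/-- `κ` is logarithmically convex. -/
lemma IsNoise.kappa_le_mul (N : IsNoise η P ρ) (H : NoiseLaw a σ ρ) {p q s t κ₁ κ₂ κ : ℝ}
    (hp : 0 ≤ p) (hq : 0 ≤ q) (hs : 0 < s) (ht : 0 < t) (hst : s + t = 1)
    (h₁ : KappaEq a σ η P p κ₁) (h₂ : KappaEq a σ η P q κ₂)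
    (h : KappaEq a σ η P (s * p + t * q) κ) : κ ≤ κ₁ ^ s * κ₂ ^ t := by
  have hlim := (h₁.rpow_const (p := s) (Or.inr hs.le)).mul (h₂.rpow_const (p := t) (Or.inr ht.le))
  refine le_of_tendsto_of_tendsto' h hlim fun n => ?_
  have hnn : ∀ p : ℝ, 0 ≤ ∫ ω, matNorm (matProd a σ η n ω) ^ p ∂P := fun p =>
    integral_nonneg fun _ => Real.rpow_nonneg (matNorm_nonneg _) _
  have h1 := integral_rpow_le_mul (fun ω => matNorm_nonneg _) (N.measurable_matNorm_matProd n)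
    hp hq hs ht hst (N.integrable_matNorm_matProd H hp n) (N.integrable_matNorm_matProd H hq n)
  refine (Real.rpow_le_rpow (hnn _) h1 (by positivity : (0 : ℝ) ≤ 1 / n)).trans (le_of_eq ?_)
  rw [Real.mul_rpow (Real.rpow_nonneg (hnn _) _) (Real.rpow_nonneg (hnn _) _),
    ← Real.rpow_mul (hnn _), ← Real.rpow_mul (hnn _), ← Real.rpow_mul (hnn _),
    ← Real.rpow_mul (hnn _), mul_comm s, mul_comm t]

lemma IsNoise.kappa_two_lt_one (N : IsNoise η P ρ) (H : NoiseLaw a σ ρ) (hD0 : CondD0 a σ η P)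
    {κ : ℝ} (h : KappaEq a σ η P 2 κ) : κ < 1 := by
  obtain ⟨r, C, hr0, hr1, hb⟩ := N.exists_second_moment_le H hD0
  exact lt_of_le_of_lt (kappa_le_of_le_mul_pow hr0 hb h) hr1

/-- A positive exponent with `κ = 1` is larger than two. -/
lemma IsNoise.two_lt_of_kappaEq_one (N : IsNoise η P ρ) (H : NoiseLaw a σ ρ)
    (hD0 : CondD0 a σ η P) {lam : ℝ} (hlam : 0 < lam) (h : KappaEq a σ η P lam 1) : 2 < lam := by
  obtain ⟨κ, -, hκ⟩ := N.exists_kappaEq H (lam := 2) (by norm_num)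
  have hκ1 := N.kappa_two_lt_one H hD0 hκ
  have hκ0 := kappa_nonneg hκ
  by_contra hcon
  rcases (not_lt.1 hcon).lt_or_eq with hlt | rfl
  · have h0 : KappaEq a σ η P 0 1 := by simp [KappaEq]
    have h1 := N.kappa_le_mul H (p := 0) (q := 2) (s := 1 - lam / 2) (t := lam / 2) le_rfl
      (by norm_num) (by linarith) (by linarith) (by ring) h0 hκ
      (show KappaEq a σ η P ((1 - lam / 2) * 0 + lam / 2 * 2) 1 by
        rwa [show (1 - lam / 2) * 0 + lam / 2 * 2 = lam by ring])
    rw [Real.one_rpow, one_mul] at h1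
    exact absurd h1 (not_le.2 (Real.rpow_lt_one hκ0 hκ1 (by linarith)))
  · have := tendsto_nhds_unique h hκ
    linarith

/-- There is exactly one positive exponent with `κ = 1`: the function `κ` is logarithmically
convex, equals `1` at `0`, is less than `1` at `2`, and exceeds `1` somewhere. -/
theorem IsNoise.existsUnique_exponent (N : IsNoise η P ρ) (H : NoiseLaw a σ ρ)
    (hD0 : CondD0 a σ η P) {p : ℝ} (hp : 1 ≤ p) (hp1 : 1 < |σ 0| ^ p * ∫ t, |t| ^ p ∂ρ) :
    ∃! lam : ℝ, 0 < lam ∧ KappaEq a σ η P lam 1 := by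
  obtain ⟨κ₂, -, hκ₂⟩ := N.exists_kappaEq H (lam := 2) (by norm_num)
  have hκ₂1 := N.kappa_two_lt_one H hD0 hκ₂
  have hκ₂0 := kappa_nonneg hκ₂
  have huniq : ∀ lam₁ lam₂ : ℝ, 0 < lam₁ → lam₁ < lam₂ → KappaEq a σ η P lam₁ 1 →
      ¬ KappaEq a σ η P lam₂ 1 := by
    intro lam₁ lam₂ h0 h12 h1 h2
    have h3 := N.two_lt_of_kappaEq_one H hD0 h0 h1
    -- `lam₁` lies between `2` and `lam₂`, so that convexity yields `κ(lam₁) < 1`.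
    set t := (lam₁ - 2) / (lam₂ - 2) with ht
    have ht0 : 0 < t := div_pos (by linarith) (by linarith)
    have ht1 : t < 1 := by rw [ht, div_lt_one (by linarith)]; linarith
    have he : (1 - t) * 2 + t * lam₂ = lam₁ := by
      have : t * (lam₂ - 2) = lam₁ - 2 := by rw [ht]; field_simp [show lam₂ - 2 ≠ 0 by linarith]
      linarith
    have h4 := N.kappa_le_mul H (p := 2) (q := lam₂) (s := 1 - t) (t := t) (by norm_num)
      (by linarith) (by linarith) ht0 (by ring) hκ₂ h2 (he.symm ▸ h1)
    rw [Real.one_rpow, mul_one] at h4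
    exact absurd h4 (not_le.2 (Real.rpow_lt_one hκ₂0 hκ₂1 (by linarith)))
  choose! κ hκ using fun lam (hlam : (1 : ℝ) ≤ lam) => N.exists_kappaEq H hlam
  -- Logarithmic convexity implies convexity, hence continuity on an open interval.
  have hconv : ConvexOn ℝ (Set.Ioi 1) κ := by
    refine ⟨convex_Ioi 1, fun x hx y hy s t hs ht hst => ?_⟩
    have hx' : (1 : ℝ) < x := hx
    have hy' : (1 : ℝ) < y := hy
    rcases hs.eq_or_lt with rfl | hs
    · obtain rfl : t = 1 := by linarith
      simp
    rcases ht.eq_or_lt with rfl | ht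
    · obtain rfl : s = 1 := by linarith
      simp
    have hz : (1 : ℝ) ≤ s * x + t * y := by nlinarith
    have h1 := N.kappa_le_mul H (by linarith) (by linarith) hs ht hst (hκ x hx'.le).2
      (hκ y hy'.le).2 (hκ _ hz).2
    simp only [smul_eq_mul]
    exact h1.trans (Real.geom_mean_le_arith_mean2_weighted hs.le ht.le
      (kappa_nonneg (hκ x hx'.le).2) (kappa_nonneg (hκ y hy'.le).2) hst)
  have hcont : ContinuousOn κ (Set.Ioi 1) := hconv.continuousOn isOpen_Ioi
  -- By convexity `κ < 1` on `(0, 2]`, while `κ(p) > 1`.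
  have hp2 : 2 < p := by
    by_contra hcon
    have hpκ : 1 < κ p := lt_of_lt_of_le hp1 (hκ p hp).1
    rcases (not_lt.1 hcon).lt_or_eq with hlt | rfl
    · have h0 : KappaEq a σ η P 0 1 := by simp [KappaEq]
      have h1 := N.kappa_le_mul H (p := 0) (q := 2) (s := 1 - p / 2) (t := p / 2) le_rfl
        (by norm_num) (by linarith) (by linarith) (by ring) h0 hκ₂
        (show KappaEq a σ η P ((1 - p / 2) * 0 + p / 2 * 2) (κ p) by
          rw [show (1 - p / 2) * 0 + p / 2 * 2 = p by ring]; exact (hκ p hp).2)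
      rw [Real.one_rpow, one_mul] at h1
      have := Real.rpow_lt_one hκ₂0 hκ₂1 (show 0 < p / 2 by linarith)
      linarith
    · have := tendsto_nhds_unique (hκ 2 hp).2 hκ₂
      linarith
  have hivt : (1 : ℝ) ∈ κ '' Set.Icc 2 p := by
    refine intermediate_value_Icc hp2.le (hcont.mono fun x hx => ?_) ⟨?_, ?_⟩
    · exact lt_of_lt_of_le (by norm_num) hx.1
    · exact (tendsto_nhds_unique (hκ 2 (by norm_num)).2 hκ₂).trans_le hκ₂1.le
    · exact hp1.le.trans (hκ p hp).1
  obtain ⟨lam, hlam, hlam1⟩ := hivt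
  have hlam2 : (2 : ℝ) ≤ lam := hlam.1
  refine ⟨lam, ⟨by linarith, hlam1 ▸ (hκ lam (by linarith)).2⟩, fun lam' ⟨h0, h1⟩ => ?_⟩
  have hk := (hκ lam (by linarith)).2
  rw [hlam1] at hk
  rcases lt_trichotomy lam' lam with h | h | h
  · exact absurd hk (huniq _ _ h0 h h1)
  · exact h
  · exact absurd h1 (huniq _ _ (by linarith) h hk)

end Exponent

end RCA

namespace RCA
variable {d : ℕ} {a σ : Fin (d + 1) → ℝ} {ρ : Measure ℝ}

/-! ### Smoothing for functions of polynomial growth -/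

section Smoothing

variable {Ω : Type*} [MeasurableSpace Ω] {η : ℕ → Fin (d + 1) → Ω → ℝ} {P : Measure Ω}
  [IsProbabilityMeasure P]

lemma IsNoise.integrable_comp_rowMul (N : IsNoise η P ρ) (H : NoiseLaw a σ ρ)
    {F : EuclideanSpace ℝ (Fin (d + 1)) → ℝ} (hF : Measurable F) {C lam : ℝ} (hlam : 0 ≤ lam)
    (hC0 : 0 ≤ C) (hC : ∀ z, |F z| ≤ C * ‖z‖ ^ lam) (x : Sph d) (n : ℕ) :
    Integrable (fun ω => F (rowMul (x : EuclideanSpace ℝ (Fin (d + 1)))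
        (matProd a σ η n ω))) P := by
  refine ((N.integrable_matNorm_matProd H hlam n).const_mul C).mono'
    (hF.comp (N.measurable_rowMul_matProd _ n)).aestronglyMeasurable (ae_of_all _ fun ω => ?_)
  exact (hC _).trans (mul_le_mul_of_nonneg_left
    (Real.rpow_le_rpow (norm_nonneg _) (norm_rowMul_matProd_le x n ω) hlam) hC0)

/-- The smoothing property `tendsto_transOp_iterate_sub` for functions of polynomial growth, by
truncation. -/
lemma IsNoise.tendsto_integral_rowMul_sub (N : IsNoise η P ρ) (H : NoiseLaw a σ ρ)
    {F : ℕ → EuclideanSpace ℝ (Fin (d + 1)) → ℝ} (hF : ∀ n, Measurable (F n)) {C lam : ℝ}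
    (hlam : 0 ≤ lam) (hC0 : 0 ≤ C) (hC : ∀ n z, |F n z| ≤ C * ‖z‖ ^ lam) {l : ℕ}
    (hl : 2 * d + 1 ≤ l) {x : Sph d} {xs : ℕ → Sph d} (hxs : Tendsto xs atTop (𝓝 x)) :
    Tendsto (fun n =>
      ∫ ω, F n (rowMul (xs n : EuclideanSpace ℝ (Fin (d + 1))) (matProd a σ η l ω)) ∂P -
      ∫ ω, F n (rowMul (x : EuclideanSpace ℝ (Fin (d + 1))) (matProd a σ η l ω)) ∂P)
      atTop (𝓝 0) := by
  have := H.prob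
  set E := ∫ ω, matNorm (matProd a σ η l ω) ^ (lam + 1) ∂P with hE
  have hE0 : 0 ≤ E := integral_nonneg fun _ => Real.rpow_nonneg (matNorm_nonneg _) _
  -- The error of the truncation at `M` is controlled by the moment of order `lam + 1`.
  have htr : ∀ M : ℝ, 0 < M → ∀ n (y : Sph d),
      |∫ ω, F n (rowMul (y : EuclideanSpace ℝ (Fin (d + 1))) (matProd a σ η l ω)) ∂P -
      ∫ ω, ({z | ‖z‖ ≤ M}.indicator (F n))
        (rowMul (y : EuclideanSpace ℝ (Fin (d + 1))) (matProd a σ η l ω)) ∂P| ≤ C * E / M := by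
    intro M hM n y
    have hmI : Measurable ({z | ‖z‖ ≤ M}.indicator (F n)) :=
      (hF n).indicator (measurableSet_le measurable_norm measurable_const)
    have hbI : ∀ z, |{z | ‖z‖ ≤ M}.indicator (F n) z| ≤ C * ‖z‖ ^ lam := fun z => by
      by_cases hz : z ∈ {z : EuclideanSpace ℝ (Fin (d + 1)) | ‖z‖ ≤ M}
      · rw [Set.indicator_of_mem hz]; exact hC n z
      · rw [Set.indicator_of_notMem hz, abs_zero]
        exact mul_nonneg hC0 (Real.rpow_nonneg (norm_nonneg _) _)
    rw [← integral_sub (N.integrable_comp_rowMul H (hF n) hlam hC0 (hC n) y l)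
      (N.integrable_comp_rowMul H hmI hlam hC0 hbI y l), hE,
      show C * (∫ ω, matNorm (matProd a σ η l ω) ^ (lam + 1) ∂P) / M =
        ∫ ω, C / M * matNorm (matProd a σ η l ω) ^ (lam + 1) ∂P by
          rw [integral_const_mul]; ring, ← Real.norm_eq_abs]
    refine norm_integral_le_of_norm_le
      ((N.integrable_matNorm_matProd H (by linarith) l).const_mul _) (ae_of_all _ fun ω => ?_)
    set z := rowMul (y : EuclideanSpace ℝ (Fin (d + 1))) (matProd a σ η l ω) with hz
    by_cases hzM : z ∈ {z : EuclideanSpace ℝ (Fin (d + 1)) | ‖z‖ ≤ M}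
    · rw [Set.indicator_of_mem hzM, sub_self, norm_zero]
      exact mul_nonneg (by positivity) (Real.rpow_nonneg (matNorm_nonneg _) _)
    · rw [Set.indicator_of_notMem hzM, sub_zero]
      have hzM' : M < ‖z‖ := by simpa using hzM
      have h1 : ‖z‖ ^ lam ≤ ‖z‖ ^ (lam + 1) / M := by
        rw [le_div_iff₀ hM, Real.rpow_add_one (by linarith)]
        exact mul_le_mul_of_nonneg_left hzM'.le (Real.rpow_nonneg (norm_nonneg _) _)
      have h2 : ‖z‖ ^ (lam + 1) ≤ matNorm (matProd a σ η l ω) ^ (lam + 1) :=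
        Real.rpow_le_rpow (norm_nonneg _) (norm_rowMul_matProd_le y l ω) (by linarith)
      calc ‖F n z‖ ≤ C * ‖z‖ ^ lam := hC n z
        _ ≤ C * (matNorm (matProd a σ η l ω) ^ (lam + 1) / M) := by
            refine mul_le_mul_of_nonneg_left (h1.trans ?_) hC0
            gcongr
        _ = _ := by ring
  rw [Metric.tendsto_atTop]
  intro ε hε
  set M : ℝ := 4 * (C * E + 1) / ε with hM
  have hM0 : 0 < M := by positivity
  have hCM : C * E / M ≤ ε / 4 := by
    rw [hM, div_le_iff₀ (by positivity)]
    field_simp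
    linarith
  have hmI : ∀ n, Measurable ({z | ‖z‖ ≤ M}.indicator (F n)) := fun n =>
    (hF n).indicator (measurableSet_le measurable_norm measurable_const)
  have hbI : ∀ n z, |{z | ‖z‖ ≤ M}.indicator (F n) z| ≤ C * M ^ lam := fun n z => by
    by_cases hz : z ∈ {z : EuclideanSpace ℝ (Fin (d + 1)) | ‖z‖ ≤ M}
    · rw [Set.indicator_of_mem hz]
      exact (hC n z).trans (mul_le_mul_of_nonneg_left
        (Real.rpow_le_rpow (norm_nonneg _) hz hlam) hC0)
    · rw [Set.indicator_of_notMem hz, abs_zero]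
      positivity
  have hlim := tendsto_transOp_iterate_sub H hmI hbI (ne_zero_of_mem_unit_sphere x)
    ((continuous_subtype_val.tendsto x).comp hxs) hl
  obtain ⟨n₀, hn₀⟩ := Metric.tendsto_atTop.1 hlim (ε / 4) (by linarith)
  refine ⟨n₀, fun n hn => ?_⟩
  have h1 := hn₀ n hn
  rw [Real.dist_eq, sub_zero] at h1 ⊢
  simp only [Function.comp_def] at h1
  rw [← N.integral_rowMul_matProd (hmI n) (hbI n), ← N.integral_rowMul_matProd (hmI n)
      (hbI n)] at h1
  have h2 := htr M hM0 n (xs n)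
  have h3 := htr M hM0 n x
  rw [abs_le] at h2 h3
  rw [abs_lt] at h1 ⊢
  constructor <;> linarith [h1.1, h1.2, h2.1, h2.2, h3.1, h3.2]

/-- Uniform smoothing: the functions `x ↦ E F (x' Π_l)` on the sphere, with `F` ranging over the
measurable functions with `|F z| ≤ C |z|^lam`, are uniformly equicontinuous. -/
theorem IsNoise.exists_forall_abs_integral_rowMul_sub_le (N : IsNoise η P ρ) (H : NoiseLaw a σ ρ)
    {C lam : ℝ} (hlam : 0 ≤ lam) (hC0 : 0 ≤ C) {l : ℕ} (hl : 2 * d + 1 ≤ l) {ε : ℝ} (hε : 0 < ε) :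
    ∃ δ : ℝ, 0 < δ ∧ ∀ F : EuclideanSpace ℝ (Fin (d + 1)) → ℝ, Measurable F →
      (∀ z, |F z| ≤ C * ‖z‖ ^ lam) → ∀ x y : Sph d, dist x y < δ →
      |∫ ω, F (rowMul (x : EuclideanSpace ℝ (Fin (d + 1))) (matProd a σ η l ω)) ∂P -
        ∫ ω, F (rowMul (y : EuclideanSpace ℝ (Fin (d + 1))) (matProd a σ η l ω)) ∂P| ≤ ε := by
  by_contra! hcon
  choose F hF hFC x y hxy hgap using fun n : ℕ => hcon (1 / ((n : ℝ) + 1)) (by positivity)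
  obtain ⟨x₀, -, φ, hφ, hx₀⟩ := isCompact_univ.tendsto_subseq (fun n => Set.mem_univ (x n))
  have hy₀ : Tendsto (y ∘ φ) atTop (𝓝 x₀) := by
    refine hx₀.congr_dist ?_
    refine squeeze_zero (fun _ => dist_nonneg) (fun n => (hxy (φ n)).le) ?_
    exact tendsto_one_div_add_atTop_nhds_zero_nat.comp hφ.tendsto_atTop
  have h1 := N.tendsto_integral_rowMul_sub H (F := fun n => F (φ n)) (fun n => hF _) hlam hC0
    (fun n => hFC _) hl hx₀
  have h2 := N.tendsto_integral_rowMul_sub H (F := fun n => F (φ n)) (fun n => hF _) hlam hC0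
    (fun n => hFC _) hl hy₀
  have h3 := (h1.sub h2).abs
  simp only [sub_self, abs_zero] at h3
  obtain ⟨n, hn⟩ := (h3.eventually_lt_const hε).exists
  refine absurd hn (not_lt.2 ((hgap (φ n)).le.trans (le_of_eq ?_)))
  simp only [Function.comp_def]
  congr 1
  ring

/-- Functions of polynomial growth and null sets: the law of `x' Π_l` is equivalent to Lebesgue
measure. -/
theorem IsNoise.integral_rowMul_eq_zero_iff (N : IsNoise η P ρ) (H : NoiseLaw a σ ρ)
    {F : EuclideanSpace ℝ (Fin (d + 1)) → ℝ} (hF : Measurable F) {C lam : ℝ} (hlam : 0 ≤ lam)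
    (hC0 : 0 ≤ C) (hF0 : ∀ z, 0 ≤ F z) (hC : ∀ z, |F z| ≤ C * ‖z‖ ^ lam) (x : Sph d) {l : ℕ}
    (hl : 4 * d + 2 ≤ l) :
    ∫ ω, F (rowMul (x : EuclideanSpace ℝ (Fin (d + 1))) (matProd a σ η l ω)) ∂P = 0 ↔
      ∀ᵐ z, F z = 0 := by
  have := H.prob
  have hm : Measurable fun z => min (F z) 1 := hF.min measurable_const
  have h0 : ∀ z, 0 ≤ min (F z) 1 := fun z => le_min (hF0 z) zero_le_one
  have hb : ∀ z, |min (F z) 1| ≤ 1 := fun z => by rw [abs_of_nonneg (h0 z)]; exact min_le_right _ _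
  have hz : ∀ z, min (F z) 1 = 0 ↔ F z = 0 := fun z => by
    constructor
    · intro h
      rcases min_choice (F z) 1 with h' | h'
      · rw [← h', h]
      · rw [h'] at h; exact absurd h one_ne_zero
    · intro h; rw [h]; exact min_eq_left zero_le_one
  have h1 := transOp_iterate_eq_zero_iff H hm h0 hb (ne_zero_of_mem_unit_sphere x) hl
  rw [← N.integral_rowMul_matProd hm hb, integral_eq_zero_iff_of_nonneg (fun _ => h0 _)
    (Integrable.of_bound (hm.comp (N.measurable_rowMul_matProd _ l)).aestronglyMeasurable 1
      (ae_of_all _ fun _ => hb _))] at h1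
  rw [integral_eq_zero_iff_of_nonneg (fun _ => hF0 _)
    (N.integrable_comp_rowMul H hF hlam hC0 hC x l)]
  have h2 : (∀ᵐ z, min (F z) 1 = 0) ↔ ∀ᵐ z, F z = 0 :=
    eventually_congr (Eventually.of_forall hz)
  rw [← h2, ← h1]
  exact eventually_congr (Eventually.of_forall fun ω => (hz _).symm)

/-- A fixed point of the sphere, used to define directions of vectors that are almost surely
nonzero. -/
noncomputable def basePoint (d : ℕ) : Sph d := ⟨EuclideanSpace.single 0 1, by simp⟩

end Smoothing

lemma direction_rowMul_matProd {Ω : Type*} {η : ℕ → Fin (d + 1) → Ω → ℝ}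
    (x y : Sph d) {n : ℕ} {ω : Ω}
    (h : rowMul (x : EuclideanSpace ℝ (Fin (d + 1))) (matProd a σ η n ω) ≠ 0) :
    direction y (rowMul (x : EuclideanSpace ℝ (Fin (d + 1))) (matProd a σ η n ω)) =
      dirChain a σ η x n ω := by
  conv_lhs => rw [← norm_smul_dirChain]
  rw [direction_smul _ (norm_pos_iff.2 h), direction_coe]

end RCA

namespace RCA
variable {d : ℕ} {a σ : Fin (d + 1) → ℝ} {ρ : Measure ℝ}

/-! ### Existence of the tilt function -/

open BoundedContinuousFunction

lemma NoiseLaw.continuous_tiltOp (H : NoiseLaw a σ ρ) {lam : ℝ} (hlam : 0 ≤ lam) {f : Sph d → ℝ}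
    (hf : Continuous f) {C : ℝ} (hC : ∀ x, |f x| ≤ C) : Continuous (tiltOp a σ ρ lam f) := by
  refine continuous_of_dominated (bound := fun e : Fin (d + 1) → ℝ =>
    matNorm (companion fun i => a i + σ i * e i) ^ lam * C) (fun x => ?_) (fun x => ?_)
    ((H.integrable_matNorm_rpow hlam).mul_const C) ?_
  · exact ((measurable_tilt_integrand lam hf.measurable).comp
      measurable_prodMk_left).aestronglyMeasurable
  · refine ae_of_all _ fun e => ?_
    rw [norm_mul, Real.norm_of_nonneg (Real.rpow_nonneg (norm_nonneg _) _)]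
    exact mul_le_mul (Real.rpow_le_rpow (norm_nonneg _) (norm_step_le x e) hlam) (hC _)
      (abs_nonneg _) (Real.rpow_nonneg (matNorm_nonneg _) _)
  · filter_upwards [ae_last_coeff_ne_zero H] with e he
    have hne : ∀ x : Sph d, step a σ (x : EuclideanSpace ℝ (Fin (d + 1))) e ≠ 0 := fun x h =>
      ne_zero_of_mem_unit_sphere x (step_eq_zero he h)
    have hcs : Continuous fun x : Sph d => step a σ (x : EuclideanSpace ℝ (Fin (d + 1))) e :=
      (continuous_step a σ).comp (continuous_subtype_val.prodMk continuous_const)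
    refine (hcs.norm.rpow_const fun x => Or.inl (norm_ne_zero_iff.2 (hne x))).mul (hf.comp ?_)
    rw [continuous_iff_continuousAt]
    intro x
    have h1 : ContinuousAt (fun y : Sph d =>
        direction (basePoint d) (step a σ (y : EuclideanSpace ℝ (Fin (d + 1))) e)) x :=
      ContinuousAt.comp (f := fun y : Sph d => step a σ (y : EuclideanSpace ℝ (Fin (d + 1))) e)
        (continuousAt_direction (basePoint d) (hne x)) hcs.continuousAt
    exact h1.congr (Eventually.of_forall fun y => direction_eq_of_ne_zero _ _ (hne y))

/-- The operator `Q_lam` on the space of continuous functions on the sphere. -/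
noncomputable def tiltCLM (H : NoiseLaw a σ ρ) {lam : ℝ} (hlam : 0 ≤ lam) :
    (Sph d →ᵇ ℝ) →L[ℝ] (Sph d →ᵇ ℝ) :=
  LinearMap.mkContinuous
    { toFun := fun f => BoundedContinuousFunction.mkOfCompact
        ⟨tiltOp a σ ρ lam f, H.continuous_tiltOp hlam f.continuous f.norm_coe_le_norm⟩
      map_add' := fun f g => by
        ext x
        simp only [mkOfCompact_apply, ContinuousMap.coe_mk, BoundedContinuousFunction.add_apply,
          tiltOp, mul_add]
        exact integral_add
          (H.integrable_tilt hlam f.continuous.measurable f.norm_coe_le_norm x)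
          (H.integrable_tilt hlam g.continuous.measurable g.norm_coe_le_norm x)
      map_smul' := fun c f => by
        ext x
        have := congrFun (tiltOp_const_mul (a := a) (σ := σ) (ρ := ρ) lam c f) x
        simpa using this }
    (∫ e : Fin (d + 1) → ℝ, matNorm (companion fun i => a i + σ i * e i) ^ lam
        ∂(Measure.pi fun _ => ρ))
    fun f => by
      refine (BoundedContinuousFunction.norm_le ?_).2 fun x => ?_
      · exact mul_nonneg (integral_nonneg fun _ => Real.rpow_nonneg (matNorm_nonneg _) _)
          (norm_nonneg _)
      · exact H.abs_tiltOp_le hlam f.norm_coe_le_norm x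

lemma tiltCLM_apply (H : NoiseLaw a σ ρ) {lam : ℝ} (hlam : 0 ≤ lam) (f : Sph d →ᵇ ℝ) (x : Sph d) :
    tiltCLM H hlam f x = tiltOp a σ ρ lam f x := rfl

lemma tiltCLM_pow_apply (H : NoiseLaw a σ ρ) {lam : ℝ} (hlam : 0 ≤ lam) (f : Sph d →ᵇ ℝ) (n : ℕ) :
    ⇑((tiltCLM H hlam ^ n) f) = (tiltOp a σ ρ lam)^[n] f := by
  induction n with
  | zero => rfl
  | succ n ih =>
    ext x
    rw [pow_succ', mul_apply_eq_comp, tiltCLM_apply, ih, Function.iterate_succ_apply']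

/-- If the tails of a nonnegative series are bounded by a multiple of their first terms, then the
terms decay exponentially. -/
lemma le_mul_pow_of_sum_le {t : ℕ → ℝ} (ht : ∀ n, 0 ≤ t n) {B : ℝ} (hB : 1 ≤ B)
    (hsum : ∀ m N, ∑ n ∈ Finset.range N, t (n + m) ≤ B * t m) (h0 : t 0 ≤ 1) (m : ℕ) :
    t m ≤ B * (1 - 1 / B) ^ m := by
  have hB0 : 0 < B := by linarith
  have hs : ∀ m, Summable fun n => t (n + m) := fun m =>
    summable_of_sum_range_le (fun n => ht _) (hsum m)
  have hD : ∀ m, ∑' n, t (n + m) ≤ B * t m := fun m =>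
    Real.tsum_le_of_sum_range_le (fun n => ht _) (hsum m)
  have hrec : ∀ m, ∑' n, t (n + m) = t m + ∑' n, t (n + (m + 1)) := fun m => by
    rw [(hs m).tsum_eq_zero_add]
    simp only [zero_add, add_assoc, add_comm 1 m]
  -- The tails `s m` satisfy `s m ≤ B * (s m - s (m + 1))`.
  have hle : ∀ m, ∑' n, t (n + m) ≤ B * (1 - 1 / B) ^ m := by
    intro m
    induction m with
    | zero =>
      refine (hD 0).trans ?_
      simpa using mul_le_mul_of_nonneg_left h0 hB0.le
    | succ m ih =>
      have h1 : ∑' n, t (n + (m + 1)) ≤ (1 - 1 / B) * ∑' n, t (n + m) := by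
        have h2 := hD m
        have h3 := hrec m
        have h4 : (∑' n, t (n + m)) / B ≤ t m := by rw [div_le_iff₀ hB0]; linarith
        have h5 : (1 - 1 / B) * ∑' n, t (n + m) = ∑' n, t (n + m) - (∑' n, t (n + m)) / B := by ring
        linarith
      refine h1.trans ?_
      have hq : 0 ≤ 1 - 1 / B := by
        have : 1 / B ≤ 1 := by rw [div_le_one hB0]; exact hB
        linarith
      calc (1 - 1 / B) * ∑' n, t (n + m) ≤ (1 - 1 / B) * (B * (1 - 1 / B) ^ m) :=
            mul_le_mul_of_nonneg_left ih hq
        _ = _ := by ring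
  refine le_trans ?_ (hle m)
  have := (hs m).le_tsum 0 fun n _ => ht _
  simpa using this

section Omega

variable {Ω : Type*} [MeasurableSpace Ω] {η : ℕ → Fin (d + 1) → Ω → ℝ} {P : Measure Ω}
  [IsProbabilityMeasure P]

/-- The homogeneous extension `z ↦ |z|^lam f (z / |z|)`. -/
noncomputable def homExt (lam : ℝ) (f : Sph d → ℝ) (z : EuclideanSpace ℝ (Fin (d + 1))) : ℝ :=
  ‖z‖ ^ lam * f (direction (basePoint d) z)

lemma measurable_homExt (lam : ℝ) {f : Sph d → ℝ} (hf : Measurable f) :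
    Measurable (homExt lam f) :=
  (measurable_norm.pow_const lam).mul
    (hf.comp (measurable_direction_comp measurable_const measurable_id))

lemma abs_homExt_le {lam : ℝ} {f : Sph d → ℝ} {C : ℝ} (hC : ∀ x, |f x| ≤ C)
    (z : EuclideanSpace ℝ (Fin (d + 1))) : |homExt lam f z| ≤ C * ‖z‖ ^ lam := by
  rw [homExt, abs_mul, abs_of_nonneg (Real.rpow_nonneg (norm_nonneg _) _), mul_comm]
  exact mul_le_mul_of_nonneg_right (hC _) (Real.rpow_nonneg (norm_nonneg _) _)

lemma homExt_rowMul_matProd {Ω : Type*} {η : ℕ → Fin (d + 1) → Ω → ℝ} {lam : ℝ} (hlam : 0 < lam)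
    (f : Sph d → ℝ) (x : Sph d) (n : ℕ) (ω : Ω) :
    homExt lam f (rowMul (x : EuclideanSpace ℝ (Fin (d + 1))) (matProd a σ η n ω)) =
      ‖rowMul (x : EuclideanSpace ℝ (Fin (d + 1))) (matProd a σ η n ω)‖ ^ lam *
        f (dirChain a σ η x n ω) := by
  by_cases h : rowMul (x : EuclideanSpace ℝ (Fin (d + 1))) (matProd a σ η n ω) = 0
  · simp [homExt, h, Real.zero_rpow hlam.ne']
  · rw [homExt, direction_rowMul_matProd x _ h]

lemma IsNoise.integral_homExt (N : IsNoise η P ρ) (H : NoiseLaw a σ ρ) {lam : ℝ} (hlam : 0 < lam)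
    {f : Sph d → ℝ} (hf : Measurable f) {C : ℝ} (hC : ∀ x, |f x| ≤ C) (x : Sph d) (n : ℕ) :
    ∫ ω, homExt lam f (rowMul (x : EuclideanSpace ℝ (Fin (d + 1))) (matProd a σ η n ω)) ∂P =
      (tiltOp a σ ρ lam)^[n] f x := by
  simp only [homExt_rowMul_matProd hlam]
  exact N.integral_tilt H hlam.le hf hC x n

/-- A nonnegative fixed function of `Q_lam` that is not zero is positive. -/
lemma IsNoise.tiltOp_iterate_pos (N : IsNoise η P ρ) (H : NoiseLaw a σ ρ) {lam : ℝ}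
    (hlam : 0 < lam) {f : Sph d → ℝ} (hf : Continuous f) {C : ℝ} (hC : ∀ x, |f x| ≤ C)
    (hf0 : ∀ x, 0 ≤ f x) {y : Sph d} (hy : 0 < f y) (x : Sph d) {l : ℕ} (hl : 4 * d + 2 ≤ l) :
    0 < (tiltOp a σ ρ lam)^[l] f x := by
  have hC0 : 0 ≤ C := (abs_nonneg _).trans (hC x)
  have h0 : ∀ z, 0 ≤ homExt lam f z := fun z =>
    mul_nonneg (Real.rpow_nonneg (norm_nonneg _) _) (hf0 _)
  have hm := measurable_homExt lam hf.measurable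
  rw [← N.integral_homExt H hlam hf.measurable hC]
  refine lt_of_le_of_ne (integral_nonneg fun _ => h0 _) fun hcon => ?_
  have hae := (N.integral_rowMul_eq_zero_iff H hm hlam.le hC0 h0
      (abs_homExt_le hC) x hl).1 hcon.symm
  have hyn : (y : EuclideanSpace ℝ (Fin (d + 1))) ≠ 0 := ne_zero_of_mem_unit_sphere y
  have hev : ∀ᶠ z in 𝓝 (y : EuclideanSpace ℝ (Fin (d + 1))), 0 < homExt lam f z := by
    have h1 : ContinuousAt (fun z => f (direction (basePoint d) z))
        (y : EuclideanSpace ℝ (Fin (d + 1))) :=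
      ContinuousAt.comp hf.continuousAt (continuousAt_direction (basePoint d) hyn)
    have h2 : ∀ᶠ z in 𝓝 (y : EuclideanSpace ℝ (Fin (d + 1))), 0 < f (direction (basePoint d) z) :=
      h1.eventually_const_lt (by simpa only [direction_coe] using hy)
    filter_upwards [h2, isOpen_ne.mem_nhds hyn] with z hz hz0
    exact mul_pos (Real.rpow_pos_of_pos (norm_pos_iff.2 hz0) _) hz
  obtain ⟨U, hU, hUo, hyU⟩ := eventually_nhds_iff.1 hev
  refine (hUo.measure_pos volume ⟨_, hyU⟩).ne' (measure_mono_null (fun z hz => ?_) (ae_iff.1 hae))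
  exact (hU z hz).ne'

/-- The iterates of `Q_lam` grow at most like `r^n`, for every `r > κ(lam) = 1`. -/
lemma IsNoise.exists_norm_tiltCLM_pow_one_le (N : IsNoise η P ρ) (H : NoiseLaw a σ ρ) {lam : ℝ}
    (hlam : 0 < lam) (hκ : KappaEq a σ η P lam 1) {r : ℝ} (hr : 1 < r) :
    ∃ n₀ : ℕ, ∀ n, n₀ ≤ n → ‖(tiltCLM H hlam.le ^ n) 1‖ ≤ r ^ n := by
  obtain ⟨n₀, hn₀⟩ := eventually_atTop.1 (hκ.eventually_lt_const hr)
  refine ⟨max n₀ 1, fun n hn => ?_⟩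
  have hnpos : n ≠ 0 := by have := (le_max_right n₀ 1).trans hn; omega
  have hnn : 0 ≤ ∫ ω, matNorm (matProd a σ η n ω) ^ lam ∂P :=
    integral_nonneg fun _ => Real.rpow_nonneg (matNorm_nonneg _) _
  have h1 : ∫ ω, matNorm (matProd a σ η n ω) ^ lam ∂P ≤ r ^ n := by
    have h2 := (hn₀ n ((le_max_left _ _).trans hn)).le
    have h3 := pow_le_pow_left₀ (Real.rpow_nonneg hnn _) h2 n
    rwa [one_div, Real.rpow_inv_natCast_pow hnn hnpos] at h3
  refine (BoundedContinuousFunction.norm_le (by positivity)).2 fun x => ?_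
  rw [tiltCLM_pow_apply, ← N.integral_tilt H hlam.le (f := (1 : Sph d →ᵇ ℝ)) (C := 1)
    measurable_one (by simp)]
  rw [Real.norm_of_nonneg (integral_nonneg fun _ => by
    simpa using Real.rpow_nonneg (norm_nonneg _) _)]
  refine le_trans ?_ h1
  refine integral_mono (N.integrable_tilt H hlam.le (f := (1 : Sph d →ᵇ ℝ)) measurable_one (C := 1)
    (by simp) x n) (N.integrable_matNorm_matProd H hlam.le n) fun ω => ?_
  simpa using Real.rpow_le_rpow (norm_nonneg _) (norm_rowMul_matProd_le x n ω) hlam.le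

/-- The resolvent of `Q_lam` at `r > 1`, applied to the constant function one. -/
lemma IsNoise.exists_resolvent (N : IsNoise η P ρ) (H : NoiseLaw a σ ρ) {lam : ℝ}
    (hlam : 0 < lam) (hκ : KappaEq a σ η P lam 1) {r : ℝ} (hr : 1 < r) :
    ∃ h : Sph d →ᵇ ℝ, tiltCLM H hlam.le h = r • (h - 1) ∧
      ∀ x m, ∑ n ∈ Finset.range m, (r⁻¹) ^ n * (tiltOp a σ ρ lam)^[n] (fun _ => 1) x ≤ h x := by
  set T := tiltCLM H hlam.le with hT
  have hr0 : 0 < r := by linarith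
  obtain ⟨r', hr'1, hr'r⟩ := exists_between hr
  obtain ⟨n₀, hn₀⟩ := N.exists_norm_tiltCLM_pow_one_le H hlam hκ hr'1
  have hsum : Summable fun n : ℕ => (r⁻¹) ^ n • (T ^ n) (1 : Sph d →ᵇ ℝ) := by
    refine Summable.of_norm_bounded_eventually_nat (g := fun n => (r' / r) ^ n)
      (summable_geometric_of_lt_one (by positivity) ((div_lt_one hr0).2 hr'r)) ?_
    filter_upwards [eventually_ge_atTop n₀] with n hn
    rw [norm_smul, norm_pow, norm_inv, Real.norm_of_nonneg hr0.le, div_pow, inv_pow]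
    rw [div_eq_inv_mul]
    exact mul_le_mul_of_nonneg_left (hn₀ n hn) (by positivity)
  have h1 : ∀ n, ⇑((T ^ n) (1 : Sph d →ᵇ ℝ)) = (tiltOp a σ ρ lam)^[n] fun _ => 1 := fun n =>
    tiltCLM_pow_apply H hlam.le 1 n
  refine ⟨∑' n : ℕ, (r⁻¹) ^ n • (T ^ n) (1 : Sph d →ᵇ ℝ), ?_, fun x m => ?_⟩
  · rw [T.map_tsum hsum]
    conv_rhs => rw [hsum.tsum_eq_zero_add]
    simp only [pow_zero, one_smul, one_apply_eq_self, add_sub_cancel_left]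
    rw [← tsum_const_smul'' (r : ℝ)]
    refine tsum_congr fun n => ?_
    rw [map_smul, smul_smul, pow_succ' T, mul_apply_eq_comp, pow_succ' r⁻¹, ← mul_assoc,
      mul_inv_cancel₀ hr0.ne', one_mul]
  · have h2 : ((∑' n : ℕ, (r⁻¹) ^ n • (T ^ n) (1 : Sph d →ᵇ ℝ) : Sph d →ᵇ ℝ)) x =
        ∑' n : ℕ, (r⁻¹) ^ n * (tiltOp a σ ρ lam)^[n] (fun _ => 1) x := by
      have h3 := (BoundedContinuousFunction.evalCLM ℝ x).map_tsum hsum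
      simp only [BoundedContinuousFunction.evalCLM_apply, BoundedContinuousFunction.coe_smul,
        h1, smul_eq_mul] at h3
      exact h3
    rw [h2]
    have h4 : Summable fun n : ℕ => (r⁻¹) ^ n * (tiltOp a σ ρ lam)^[n] (fun _ => 1) x := by
      have h3 := hsum.map (BoundedContinuousFunction.evalCLM ℝ x)
        (BoundedContinuousFunction.evalCLM ℝ x).continuous
      refine h3.congr fun n => ?_
      simp only [Function.comp_apply, BoundedContinuousFunction.evalCLM_apply,
        BoundedContinuousFunction.coe_smul, h1, smul_eq_mul]
    refine h4.sum_le_tsum _ fun n _ => mul_nonneg (by positivity) ?_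
    rw [← N.integral_tilt H hlam.le measurable_const (C := 1) (by simp)]
    exact integral_nonneg fun ω => by simpa using Real.rpow_nonneg (norm_nonneg _) _

/-- The resolvent blows up at `1`. Otherwise the iterates `Q_lam^n 1` would decay exponentially,
against `κ(lam) = 1`. -/
lemma IsNoise.exists_resolvent_norm_gt (N : IsNoise η P ρ) (H : NoiseLaw a σ ρ) {lam : ℝ}
    (hlam : 0 < lam) (hκ : KappaEq a σ η P lam 1) {ε : ℝ} (hε : 0 < ε) (B : ℝ) :
    ∃ r : ℝ, 1 < r ∧ r < 1 + ε ∧ ∃ h : Sph d →ᵇ ℝ, tiltCLM H hlam.le h = r • (h - 1) ∧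
      (∀ x, 0 ≤ h x) ∧ B < ‖h‖ := by
  have hprob := H.prob
  by_contra! hcon
  set t : Sph d → ℕ → ℝ := fun x n => (tiltOp a σ ρ lam)^[n] (fun _ => 1) x with ht
  have ht0 : ∀ x n, 0 ≤ t x n := fun x n => by
    simp only [ht]
    rw [← N.integral_tilt H hlam.le measurable_const (C := 1) (by simp)]
    exact integral_nonneg fun ω => by simpa using Real.rpow_nonneg (norm_nonneg _) _
  set B' := max B 2 with hB'
  have hB'2 : 2 ≤ B' := le_max_right _ _
  -- As `r ↓ 1`, the bound on the resolvents passes to the partial sums of `∑ Q_lam^n 1`.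
  have hpart : ∀ x m, ∑ n ∈ Finset.range m, t x n ≤ B' := by
    intro x m
    have hlim : Tendsto (fun r : ℝ => ∑ n ∈ Finset.range m, (r⁻¹) ^ n * t x n) (𝓝[>] 1)
        (𝓝 (∑ n ∈ Finset.range m, ((1 : ℝ)⁻¹) ^ n * t x n)) := by
      refine Tendsto.mono_left ?_ nhdsWithin_le_nhds
      refine tendsto_finsetSum _ fun n _ => ?_
      exact ((tendsto_inv₀ one_ne_zero).pow n).mul_const _
    simp only [inv_one, one_pow, one_mul] at hlim
    refine le_of_tendsto hlim ?_
    filter_upwards [Ioo_mem_nhdsGT (show (1 : ℝ) < 1 + ε by linarith)] with r hr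
    obtain ⟨h, hh, hs⟩ := N.exists_resolvent H hlam hκ hr.1
    have h0 : ∀ x, 0 ≤ h x := fun x => by simpa using hs x 0
    calc _ ≤ h x := hs x m
      _ ≤ ‖h‖ := (le_abs_self _).trans (h.norm_coe_le_norm x)
      _ ≤ B' := (hcon r hr.1 hr.2 h hh h0).trans (le_max_left _ _)
  -- Applying the positive operator `Q_lam^k` to this bound controls the tails.
  have htail : ∀ x k m, ∑ n ∈ Finset.range m, t x (n + k) ≤ B' * t x k := by
    intro x k m
    have h1 : ∀ n, t x (n + k) = (tiltOp a σ ρ lam)^[k] ((tiltOp a σ ρ lam)^[n] fun _ => 1) x :=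
      fun n => by simp only [ht]; rw [add_comm, Function.iterate_add_apply]
    set T := tiltCLM H hlam.le with hT
    have h2 : ∑ n ∈ Finset.range m, t x (n + k) =
        (T ^ k) (∑ n ∈ Finset.range m, (T ^ n) (1 : Sph d →ᵇ ℝ)) x := by
      rw [map_sum, BoundedContinuousFunction.sum_apply]
      refine Finset.sum_congr rfl fun n _ => ?_
      rw [h1, hT, tiltCLM_pow_apply, tiltCLM_pow_apply]
      rfl
    have h3 : ∀ y, (∑ n ∈ Finset.range m, (T ^ n) (1 : Sph d →ᵇ ℝ)) y =
        ∑ n ∈ Finset.range m, t y n := fun y => by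
      rw [BoundedContinuousFunction.sum_apply]
      refine Finset.sum_congr rfl fun n _ => ?_
      rw [hT, tiltCLM_pow_apply]
      rfl
    rw [h2, hT, tiltCLM_pow_apply]
    have h4 := H.tiltOp_iterate_mono hlam.le
      (f := (∑ n ∈ Finset.range m, (T ^ n) (1 : Sph d →ᵇ ℝ) : Sph d →ᵇ ℝ))
      (g := fun _ => B' * 1) (BoundedContinuousFunction.continuous _).measurable measurable_const
      (fun y => (∑ n ∈ Finset.range m, (T ^ n) (1 : Sph d →ᵇ ℝ) : Sph d →ᵇ ℝ).norm_coe_le_norm y)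
          (C' := B')
      (fun y => by rw [mul_one, abs_of_nonneg (by linarith)])
      (fun y => by rw [h3, mul_one]; exact hpart y m) k x
    rw [tiltOp_iterate_const_mul] at h4
    exact h4
  have hdecay : ∀ n x, (tiltOp a σ ρ lam)^[n] (fun _ => 1) x ≤ B' * (1 - 1 / B') ^ n := fun n x =>
    le_mul_pow_of_sum_le (ht0 x) (by linarith) (htail x) (by simp [ht]) n
  have hq : 1 / B' ≤ 1 / 2 := one_div_le_one_div_of_le (by norm_num) hB'2
  have hq0 : 0 < 1 / B' := by positivity
  have hfin := kappa_le_of_le_mul_pow (a := a) (σ := σ) (η := η) (P := P) (lam := lam)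
    (r := 1 - 1 / B') (C := ((d + 1 : ℝ) ^ lam * (d + 1)) * B') (by linarith) (fun n => by
      rw [mul_assoc]
      exact N.integral_matNorm_le H hlam.le n (hdecay n)) hκ
  linarith

/-- Existence of a positive continuous fixed function of `Q_lam` when `κ(lam) = 1`. It is a limit
point of the normalized resolvents of `Q_lam` at `r ↓ 1`, which exists because a power of `Q_lam`
is compact by the smoothing property. -/
theorem IsNoise.exists_fixed (N : IsNoise η P ρ) (H : NoiseLaw a σ ρ) {lam : ℝ}
    (hlam : 0 < lam) (hκ : KappaEq a σ η P lam 1) :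
    ∃ g : Sph d → ℝ, Continuous g ∧ (∀ x, 0 < g x) ∧ ∀ x, tiltOp a σ ρ lam g x = g x := by
  have hprob := H.prob
  have : Nonempty (Sph d) := ⟨basePoint d⟩
  set T := tiltCLM H hlam.le with hT
  choose r hr1 hr2 h hh h0 hB using fun k : ℕ => N.exists_resolvent_norm_gt H hlam hκ
    (ε := 1 / ((k : ℝ) + 1)) (by positivity) ((k : ℝ) + 1)
  set c : ℕ → ℝ := fun k => ‖h k‖⁻¹ with hc
  have hnpos : ∀ k, 0 < ‖h k‖ := fun k => lt_trans (by positivity) (hB k)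
  set g : ℕ → Sph d →ᵇ ℝ := fun k => c k • h k with hg
  have hg1 : ∀ k, ‖g k‖ = 1 := fun k => by
    simp only [hg, hc, norm_smul, norm_inv, norm_norm]
    exact inv_mul_cancel₀ (hnpos k).ne'
  have hTg : ∀ k, T (g k) - g k = (r k - 1) • g k - (r k * c k) • (1 : Sph d →ᵇ ℝ) := fun k => by
    simp only [hg, map_smul, hT, hh k]
    module
  have hr : Tendsto r atTop (𝓝 1) := by
    refine tendsto_of_tendsto_of_tendsto_of_le_of_le tendsto_const_nhds ?_ (fun k => (hr1 k).le)
      (fun k => (hr2 k).le)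
    simpa using (tendsto_one_div_add_atTop_nhds_zero_nat (𝕜 := ℝ)).const_add 1
  have hc0 : Tendsto c atTop (𝓝 0) := by
    refine tendsto_inv_atTop_zero.comp ?_
    refine tendsto_atTop_mono (fun k => (hB k).le) ?_
    exact tendsto_atTop_add_const_right _ _ tendsto_natCast_atTop_atTop
  -- The normalized resolvents are almost fixed by `T`.
  have hdiff : Tendsto (fun k => T (g k) - g k) atTop (𝓝 0) := by
    refine squeeze_zero_norm (a := fun k => |r k - 1| + |r k * c k|) (fun k => ?_) ?_
    · rw [hTg]
      refine (norm_sub_le _ _).trans (add_le_add ?_ ?_)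
      · rw [norm_smul, hg1, mul_one, Real.norm_eq_abs]
      · rw [norm_smul, norm_one, mul_one, Real.norm_eq_abs]
    · have h1 : Tendsto (fun k => |r k - 1|) atTop (𝓝 0) := by
        simpa using (hr.sub_const 1).abs
      have h2 : Tendsto (fun k => |r k * c k|) atTop (𝓝 0) := by
        simpa using (hr.mul hc0).abs
      simpa using h1.add h2
  have hdiffn : ∀ n, Tendsto (fun k => (T ^ n) (g k) - g k) atTop (𝓝 0) := by
    intro n
    induction n with
    | zero => simp
    | succ n ih =>
      have h1 := (T.continuous.tendsto 0).comp ih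
      rw [map_zero] at h1
      have h2 := h1.add hdiff
      rw [add_zero] at h2
      refine h2.congr fun k => ?_
      simp only [Function.comp_def, pow_succ', mul_apply_eq_comp, map_sub]
      abel
  set l := 4 * d + 2 with hl
  -- compactness of `T ^ l`
  set A : Set (Sph d →ᵇ ℝ) := (fun f => (T ^ l) f) '' {f | ‖f‖ ≤ 1} with hA
  have hAc : IsCompact (closure A) := by
    refine BoundedContinuousFunction.arzela_ascoli (Metric.closedBall (0 : ℝ) ‖T ^ l‖)
      (isCompact_closedBall _ _) A ?_ ?_
    · rintro _ x ⟨f, hf, rfl⟩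
      rw [mem_closedBall_zero_iff]
      refine (BoundedContinuousFunction.norm_coe_le_norm _ x).trans ?_
      refine ((T ^ l).le_opNorm f).trans ?_
      exact mul_le_of_le_one_right (norm_nonneg _) hf
    · intro x
      rw [Metric.equicontinuousAt_iff]
      intro ε hε
      obtain ⟨δ, hδ, hF⟩ := N.exists_forall_abs_integral_rowMul_sub_le H
          (C := 1) hlam.le zero_le_one
        (l := l) (by omega) (half_pos hε)
      refine ⟨δ, hδ, ?_⟩
      rintro y hy ⟨_, f, hf, rfl⟩
      have hfC : ∀ x, |f x| ≤ 1 := fun x => (f.norm_coe_le_norm x).trans hf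
      have h1 := hF (homExt lam f) (measurable_homExt lam f.continuous.measurable)
        (abs_homExt_le hfC) x y (by rwa [dist_comm])
      rw [N.integral_homExt H hlam f.continuous.measurable hfC,
        N.integral_homExt H hlam f.continuous.measurable hfC] at h1
      simp only [hT, tiltCLM_pow_apply, Real.dist_eq]
      linarith
  obtain ⟨G, -, ψ, hψ, hlim⟩ := hAc.tendsto_subseq (x := fun k => (T ^ l) (g k))
    (fun k => subset_closure ⟨g k, (hg1 k).le, rfl⟩)
  -- `T ^ l (g k)` and `g k` have the same limit points.
  have hgG : Tendsto (fun k => g (ψ k)) atTop (𝓝 G) := by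
    have h1 := hlim.sub ((hdiffn l).comp hψ.tendsto_atTop)
    rw [sub_zero] at h1
    refine h1.congr fun k => ?_
    simp only [Function.comp_def]
    abel
  have hTG : T G = G := by
    have h1 := ((T.continuous.tendsto G).comp hgG).sub hgG
    have h2 := tendsto_nhds_unique h1 (hdiff.comp hψ.tendsto_atTop)
    exact sub_eq_zero.1 h2
  have hG1 : ‖G‖ = 1 :=
    tendsto_nhds_unique ((continuous_norm.tendsto G).comp hgG) (by
      simp only [Function.comp_def, hg1]; exact tendsto_const_nhds)
  have hG0 : ∀ x, 0 ≤ G x := fun x => by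
    refine ge_of_tendsto' (((BoundedContinuousFunction.evalCLM ℝ x).continuous.tendsto G).comp hgG)
      fun k => ?_
    simp only [Function.comp_def, BoundedContinuousFunction.evalCLM_apply, hg,
      BoundedContinuousFunction.coe_smul, smul_eq_mul]
    exact mul_nonneg (inv_nonneg.2 (norm_nonneg _)) (h0 _ _)
  obtain ⟨y, hy⟩ : ∃ y, 0 < G y := by
    by_contra! hcon
    have : G = 0 := by
      ext x
      exact le_antisymm (hcon x) (hG0 x)
    rw [this, norm_zero] at hG1
    exact zero_ne_one hG1
  have hfix : ∀ n, (T ^ n) G = G := by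
    intro n
    induction n with
    | zero => rfl
    | succ n ih => rw [pow_succ', mul_apply_eq_comp, ih, hTG]
  refine ⟨G, G.continuous, fun x => ?_, fun x => ?_⟩
  · have h1 := N.tiltOp_iterate_pos H hlam G.continuous G.norm_coe_le_norm hG0 hy x (le_refl l)
    rwa [← tiltCLM_pow_apply H hlam.le G l, ← hT, hfix] at h1
  · rw [← tiltCLM_apply H hlam.le, ← hT, hTG]

end Omega

end RCA

namespace RCA
variable {d : ℕ}

/-! ### Markov chains with given transition kernel -/

/-- A finite measure on a sequence space is determined by the laws of the initial segments. -/
lemma ext_of_map_fin {E : Type*} [MeasurableSpace E] {μ ν : Measure (ℕ → E)} [IsFiniteMeasure μ]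
    (h : ∀ n, μ.map (fun w (k : Fin n) => w k) = ν.map fun w (k : Fin n) => w k) : μ = ν := by
  refine IsProjectiveLimit.unique (P := fun I : Finset ℕ => μ.map I.restrict) (fun I => rfl)
    fun I => ?_
  have hI : ∀ i : I, (i : ℕ) < I.sup id + 1 := fun i =>
    Nat.lt_succ_of_le (Finset.le_sup (f := id) i.2)
  set g : (Fin (I.sup id + 1) → E) → I → E := fun u i => u ⟨i, hI i⟩ with hg
  have hgm : Measurable g := measurable_pi_lambda _ fun i => measurable_pi_apply _
  have hr : (I.restrict : (ℕ → E) → I → E) = g ∘ fun w (k : Fin (I.sup id + 1)) => w k := rfl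
  have hm : Measurable fun (w : ℕ → E) (k : Fin (I.sup id + 1)) => w k :=
    measurable_pi_lambda _ fun k => measurable_pi_apply _
  change ν.map I.restrict = μ.map I.restrict
  rw [hr, ← Measure.map_map hgm hm, ← Measure.map_map hgm hm, h]

lemma measurable_snoc {E : Type*} [MeasurableSpace E] (n : ℕ) :
    Measurable fun p : (Fin n → E) × E => (Fin.snoc p.1 p.2 : Fin (n + 1) → E) := by
  refine measurable_pi_iff.2 fun i => ?_
  refine Fin.lastCases ?_ (fun j => ?_) i
  · simpa only [Fin.snoc_last] using measurable_snd
  · simp only [Fin.snoc_castSucc]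
    exact (measurable_pi_apply j).comp measurable_fst

/-- `x_n` as a function of `x_0` and of `(x_1, u_1), …, (x_n, u_n)`. -/
def segX : (n : ℕ) → Sph d → (Fin n → Sph d × ℝ) → Sph d
  | 0, x, _ => x
  | n + 1, _, u => (u (Fin.last n)).1

lemma pathX_eq_segX (x : Sph d) (w : ℕ → Sph d × ℝ) (n : ℕ) :
    pathX x w n = segX n x fun k : Fin n => w k := by
  cases n <;> rfl

lemma measurable_segX (n : ℕ) :
    Measurable fun p : Sph d × (Fin n → Sph d × ℝ) => segX n p.1 p.2 := by
  cases n with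
  | zero => exact measurable_fst
  | succ n =>
    exact measurable_fst.comp ((measurable_pi_apply (Fin.last n)).comp measurable_snd)

lemma measurable_initSeg {E : Type*} [MeasurableSpace E] (n : ℕ) :
    Measurable fun (w : ℕ → E) (k : Fin n) => w k :=
  measurable_pi_lambda _ fun _ => measurable_pi_apply _

lemma measurable_shiftSeq {E : Type*} [MeasurableSpace E] (n : ℕ) :
    Measurable fun (w : ℕ → E) (k : ℕ) => w (n + k) :=
  measurable_pi_lambda _ fun _ => measurable_pi_apply _

lemma measurable_pathX (n : ℕ) :
    Measurable fun p : Sph d × (ℕ → Sph d × ℝ) => pathX p.1 p.2 n := by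
  simp only [pathX_eq_segX]
  exact (measurable_segX n).comp
    (measurable_fst.prodMk ((measurable_initSeg n).comp measurable_snd))

lemma measurable_pathX_right (x : Sph d) (n : ℕ) :
    Measurable fun w : ℕ → Sph d × ℝ => pathX x w n :=
  (measurable_pathX n).comp measurable_prodMk_left

lemma measurable_pathV (n : ℕ) : Measurable fun w : ℕ → Sph d × ℝ => pathV w n :=
  Finset.measurable_sum _ fun k _ => measurable_snd.comp (measurable_pi_apply k)

/-- `Q x` is the law of `((x_1, u_1), (x_2, u_2), …)` when `x_0 = x` and `K` is the conditional law
of `(x_{n+1}, u_{n+1})` given the past, as a function of `x_n`. -/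
def IsChain (K : Kernel (Sph d) (Sph d × ℝ)) (Q : Kernel (Sph d) (ℕ → Sph d × ℝ)) : Prop :=
  ∀ (x : Sph d) (n : ℕ) (F : (Fin (n + 1) → Sph d × ℝ) → ENNReal), Measurable F →
    ∫⁻ w, F (fun k => w k) ∂(Q x) =
      ∫⁻ w, ∫⁻ p, F (Fin.snoc (fun k : Fin n => w k) p) ∂(K (pathX x w n)) ∂(Q x)

/-- Existence of the chain, by the Ionescu-Tulcea theorem. -/
lemma exists_isChain (K : Kernel (Sph d) (Sph d × ℝ)) [IsMarkovKernel K] :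
    ∃ Q : Kernel (Sph d) (ℕ → Sph d × ℝ), IsMarkovKernel Q ∧ IsChain K Q := by
  -- the trajectory starts at index `0` with the pair `(x, 0)`, which the shift removes
  set κ : (n : ℕ) → Kernel ((i : Finset.Iic n) → Sph d × ℝ) (Sph d × ℝ) := fun n =>
    K.comap (fun y => (y ⟨n, Finset.mem_Iic.2 le_rfl⟩).1)
      (measurable_fst.comp (measurable_pi_apply _)) with hκ
  have hκm : ∀ n, IsMarkovKernel (κ n) := fun n => by rw [hκ]; infer_instance
  have hinit : Measurable fun (x : Sph d) (_ : Finset.Iic 0) => ((x, 0) : Sph d × ℝ) :=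
    measurable_pi_lambda _ fun _ => measurable_id.prodMk measurable_const
  have hshift : Measurable fun (y : ℕ → Sph d × ℝ) (k : ℕ) => y (k + 1) :=
    measurable_pi_lambda _ fun _ => measurable_pi_apply _
  set τ := Kernel.traj (X := fun _ => Sph d × ℝ) κ 0 with hτ
  refine ⟨((τ.comap _ hinit).map fun y k => y (k + 1)), ?_, fun x n F hF => ?_⟩
  · exact Kernel.IsMarkovKernel.map _ hshift
  set x₀ : (i : Finset.Iic 0) → Sph d × ℝ := fun _ => (x, 0) with hx₀
  have hQ : ((τ.comap _ hinit).map fun y k => y (k + 1)) x = (τ x₀).map fun y k => y (k + 1) := by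
    rw [Kernel.map_apply _ hshift, Kernel.comap_apply]
  have hzero : ∀ᵐ y ∂(τ x₀), y 0 = (x, 0) := by
    have h1 : (τ x₀).map (Preorder.frestrictLe 0) = Measure.dirac x₀ := by
      rw [hτ, Kernel.traj_map_frestrictLe_apply, Kernel.partialTraj_self, Kernel.id_apply]
    have h2 : ∀ᵐ z ∂((τ x₀).map (Preorder.frestrictLe 0)), z = x₀ := by
      rw [h1]
      exact (ae_dirac_iff (measurableSet_singleton x₀)).2 rfl
    filter_upwards [ae_of_ae_map (by fun_prop) h2] with y hy
    exact congrFun hy ⟨0, Finset.mem_Iic.2 le_rfl⟩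
  have hstate : ∀ᵐ y ∂(τ x₀), pathX x (fun k => y (k + 1)) n = (y n).1 := by
    filter_upwards [hzero] with y hy
    cases n with
    | zero => rw [hy]; rfl
    | succ n => rfl
  have hseg : Measurable fun (z : (i : Finset.Iic n) → Sph d × ℝ) (k : Fin n) =>
      z ⟨k + 1, Finset.mem_Iic.2 k.2⟩ :=
    measurable_pi_lambda _ fun _ => measurable_pi_apply _
  have hG : Measurable fun q : ((i : Finset.Iic n) → Sph d × ℝ) × (Sph d × ℝ) =>
      F (Fin.snoc (fun k : Fin n => q.1 ⟨k + 1, Finset.mem_Iic.2 k.2⟩) q.2) :=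
    hF.comp ((measurable_snoc n).comp ((hseg.comp measurable_fst).prodMk measurable_snd))
  have hkey := Kernel.partialTraj_compProd_eq_map_traj (X := fun _ => Sph d × ℝ) (κ := κ)
    (Nat.zero_le n) (x₀ := x₀)
  rw [← Kernel.traj_map_frestrictLe_apply] at hkey
  have h1 := congrArg (fun m => ∫⁻ q, F (Fin.snoc (fun k : Fin n => q.1 ⟨k + 1,
    Finset.mem_Iic.2 k.2⟩) q.2) ∂m) hkey
  beta_reduce at h1
  rw [Measure.lintegral_compProd hG, lintegral_map hG.lintegral_kernel_prod_right' (by fun_prop),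
    lintegral_map hG (by fun_prop)] at h1
  have hI : Measurable fun w : ℕ → Sph d × ℝ =>
      ∫⁻ p, F (Fin.snoc (fun k : Fin n => w k) p) ∂(K (pathX x w n)) := by
    have h3 : Measurable fun q : (ℕ → Sph d × ℝ) × (Sph d × ℝ) =>
        F (Fin.snoc (fun k : Fin n => q.1 k) q.2) := hF.comp ((measurable_snoc n).comp
      (((measurable_initSeg n).comp measurable_fst).prodMk measurable_snd))
    exact h3.lintegral_kernel_prod_right' (κ := K.comap _ (measurable_pathX_right x n))
  have hFm : Measurable fun w : ℕ → Sph d × ℝ => F fun k => w k :=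
    hF.comp (measurable_initSeg _)
  rw [hQ, lintegral_map hFm hshift, lintegral_map hI hshift]
  refine Eq.trans ?_ (h1.symm.trans ?_)
  · refine lintegral_congr fun y => congrArg F (funext fun i => ?_)
    refine Fin.lastCases ?_ (fun j => ?_) i
    · simp
    · simp [Preorder.frestrictLe]
  · refine lintegral_congr_ae ?_
    filter_upwards [hstate] with y hy
    rw [hy]
    rfl

/-- The Markov property, for finitely many future coordinates. -/
lemma IsChain.lintegral_markov_fin {K : Kernel (Sph d) (Sph d × ℝ)} [IsMarkovKernel K]
    {Q : Kernel (Sph d) (ℕ → Sph d × ℝ)} [IsMarkovKernel Q] (hQ : IsChain K Q) (x : Sph d)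
    (n m : ℕ) {F : (Fin n → Sph d × ℝ) × (Fin m → Sph d × ℝ) → ENNReal} (hF : Measurable F) :
    ∫⁻ w, F (fun k => w k, fun k => w (n + k)) ∂(Q x) =
      ∫⁻ w, ∫⁻ w', F (fun k => w k, fun k => w' k) ∂(Q (pathX x w n)) ∂(Q x) := by
  induction m with
  | zero =>
    refine lintegral_congr fun w => ?_
    have : ∀ w' : ℕ → Sph d × ℝ, F (fun k => w k, fun k : Fin 0 => w' k) =
        F (fun k => w k, fun k => w (n + k)) := fun w' => by
      congr 2; exact Subsingleton.elim _ _
    simp only [this, lintegral_const, measure_univ, mul_one]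
  | succ m ih =>
    set F' : (Fin (n + m + 1) → Sph d × ℝ) → ENNReal := fun u =>
      F (fun k => u ⟨k, by omega⟩, fun k => u ⟨n + k, by omega⟩) with hF'
    have hF'm : Measurable F' := hF.comp
      ((measurable_pi_lambda _ fun _ => measurable_pi_apply _).prodMk
      (measurable_pi_lambda _ fun _ => measurable_pi_apply _))
    have h1 := hQ x (n + m) F' hF'm
    set G : (Fin n → Sph d × ℝ) × (Fin m → Sph d × ℝ) → ENNReal := fun q =>
      ∫⁻ p, F (q.1, Fin.snoc q.2 p) ∂(K (segX m (segX n x q.1) q.2)) with hG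
    have hst : Measurable fun q : (Fin n → Sph d × ℝ) × (Fin m → Sph d × ℝ) =>
        segX m (segX n x q.1) q.2 :=
      (measurable_segX m).comp ((((measurable_segX n).comp measurable_prodMk_left).comp
        measurable_fst).prodMk measurable_snd)
    have hGm : Measurable G := by
      have h3 : Measurable fun r : ((Fin n → Sph d × ℝ) × (Fin m → Sph d × ℝ)) × (Sph d × ℝ) =>
          F (r.1.1, Fin.snoc r.1.2 r.2) :=
        hF.comp ((measurable_fst.comp measurable_fst).prodMk ((measurable_snoc m).comp
          ((measurable_snd.comp measurable_fst).prodMk measurable_snd)))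
      exact h3.lintegral_kernel_prod_right' (κ := K.comap _ hst)
    have h2 := ih hGm
    calc ∫⁻ w, F (fun k => w k, fun k => w (n + k)) ∂(Q x)
        = ∫⁻ w, F' (fun k => w k) ∂(Q x) := rfl
      _ = ∫⁻ w, G (fun k => w k, fun k => w (n + k)) ∂(Q x) := by
        rw [h1]
        refine lintegral_congr fun w => ?_
        simp only [hG]
        have hs : pathX x w (n + m) =
            segX m (segX n x fun k : Fin n => w k) fun k : Fin m => w (n + k) := by
          cases m with
          | zero => exact pathX_eq_segX x w n
          | succ m => rfl
        rw [hs]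
        refine lintegral_congr fun p => ?_
        simp only [hF']
        congr 2
        · funext k
          simp [Fin.snoc, show (k : ℕ) < n + m by omega]
        · funext k
          refine Fin.lastCases ?_ (fun j => ?_) k
          · simp [Fin.snoc]
          · simp [Fin.snoc]
      _ = _ := h2
      _ = _ := by
        refine lintegral_congr fun w => ?_
        have h4 := hQ (pathX x w n) m (fun u => F (fun k : Fin n => w k, u))
          (hF.comp measurable_prodMk_left)
        rw [h4]
        refine lintegral_congr fun w' => ?_
        simp only [hG, ← pathX_eq_segX]

/-- The law of the pair consisting of the first `n` steps and of the future after time `n`. -/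
lemma IsChain.map_prodMk {K : Kernel (Sph d) (Sph d × ℝ)} [IsMarkovKernel K]
    {Q : Kernel (Sph d) (ℕ → Sph d × ℝ)} [IsMarkovKernel Q] (hQ : IsChain K Q) (x : Sph d)
    (n : ℕ) :
    (Q x).map (fun w => ((fun k : Fin n => w k), fun k => w (n + k))) =
      ((Q x).map fun w (k : Fin n) => w k) ⊗ₘ
        Q.comap (fun u => segX n x u) ((measurable_segX n).comp measurable_prodMk_left) := by
  have hm : Measurable fun w : ℕ → Sph d × ℝ => ((fun k : Fin n => w k), fun k => w (n + k)) :=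
    (measurable_initSeg n).prodMk (measurable_shiftSeq n)
  refine Measure.ext_prod fun {s t} hs ht => ?_
  rw [Measure.compProd_apply_prod hs ht, Measure.map_apply hm (hs.prod ht),
    setLIntegral_map hs (Kernel.measurable_coe _ ht) (measurable_initSeg n)]
  simp only [Kernel.comap_apply]
  set A : Set (ℕ → Sph d × ℝ) := (fun w (k : Fin n) => w k) ⁻¹' s with hA
  have hAm : MeasurableSet A := measurable_initSeg n hs
  -- both sides are measures in `t`, which are compared on initial segments
  have hext : ((Q x).restrict A).map (fun w k => w (n + k)) =
      ((Q x).restrict A).bind (Q.comap (fun w => pathX x w n) (measurable_pathX_right x n)) := by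
    refine ext_of_map_fin fun m => ?_
    refine Measure.ext fun B hB => ?_
    rw [Measure.map_map (measurable_initSeg m) (measurable_shiftSeq n),
      Measure.map_apply ((measurable_initSeg m).comp (measurable_shiftSeq n)) hB,
      Measure.map_apply (measurable_initSeg m) hB,
      Measure.bind_apply (measurable_initSeg m hB) (Kernel.aemeasurable _),
      Measure.restrict_apply (((measurable_initSeg m).comp (measurable_shiftSeq n)) hB)]
    have h1 := hQ.lintegral_markov_fin x n m (F := (s ×ˢ B).indicator fun _ => 1)
      (measurable_const.indicator (hs.prod hB))
    have h2 : ∀ w w' : ℕ → Sph d × ℝ, (s ×ˢ B).indicator (fun _ => (1 : ENNReal))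
        (fun k : Fin n => w k, fun k : Fin m => w' k) =
        A.indicator 1 w * ((fun (w : ℕ → Sph d × ℝ) (k : Fin m) => w k) ⁻¹' B).indicator 1 w' := by
      intro w w'
      by_cases h3 : (fun k : Fin n => w k) ∈ s <;> by_cases h4 : (fun k : Fin m => w' k) ∈ B <;>
        simp [hA, Set.indicator, h3, h4]
    have h3 := fun w : ℕ → Sph d × ℝ => h2 w fun k => w (n + k)
    simp only [h3, h2] at h1
    rw [← lintegral_indicator_one ((((measurable_initSeg m).comp (measurable_shiftSeq n)) hB).inter
      hAm), ← lintegral_indicator hAm]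
    refine Eq.trans ?_ (h1.trans ?_)
    · refine lintegral_congr fun w => ?_
      rw [Set.inter_indicator_one, mul_comm]
      rfl
    · refine lintegral_congr fun w => ?_
      rw [lintegral_const_mul _ (measurable_one.indicator (measurable_initSeg m hB)),
        lintegral_indicator_one (measurable_initSeg m hB)]
      by_cases h5 : w ∈ A <;> simp [h5]
  have h := congrArg (fun μ => μ t) hext
  beta_reduce at h
  rw [Measure.map_apply (measurable_shiftSeq n) ht, Measure.restrict_apply
      (measurable_shiftSeq n ht),
    Measure.bind_apply ht (Kernel.aemeasurable _)] at h
  simp only [Kernel.comap_apply, pathX_eq_segX] at h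
  rw [← h, Set.inter_comm]
  rfl

/-- The Markov property, in terms of integrals of nonnegative functions. -/
lemma IsChain.lintegral_markov {K : Kernel (Sph d) (Sph d × ℝ)} [IsMarkovKernel K]
    {Q : Kernel (Sph d) (ℕ → Sph d × ℝ)} [IsMarkovKernel Q] (hQ : IsChain K Q) (x : Sph d)
    (n : ℕ) {F : (Fin n → Sph d × ℝ) × (ℕ → Sph d × ℝ) → ENNReal} (hF : Measurable F) :
    ∫⁻ w, F (fun k => w k, fun k => w (n + k)) ∂(Q x) =
      ∫⁻ w, ∫⁻ w', F (fun k => w k, w') ∂(Q (pathX x w n)) ∂(Q x) := by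
  have hm : Measurable fun w : ℕ → Sph d × ℝ => ((fun k : Fin n => w k), fun k => w (n + k)) :=
    (measurable_initSeg n).prodMk (measurable_shiftSeq n)
  rw [← lintegral_map (f := F) hF hm, hQ.map_prodMk, Measure.lintegral_compProd hF,
    lintegral_map hF.lintegral_kernel_prod_right' (measurable_initSeg n)]
  simp only [Kernel.comap_apply, ← pathX_eq_segX]

instance : StandardBorelSpace (Sph d) :=
  Metric.isClosed_sphere.measurableSet.standardBorel

/-- The conditional expectation of a function of the past and of the future of a chain, for an
arbitrary initial law. -/
lemma IsChain.condExp_ae_eq {K : Kernel (Sph d) (Sph d × ℝ)} [IsMarkovKernel K]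
    {Q : Kernel (Sph d) (ℕ → Sph d × ℝ)} [IsMarkovKernel Q] (hQ : IsChain K Q)
    (μ : Measure (Sph d)) [IsProbabilityMeasure μ] (n : ℕ) {f : ℝ × (ℕ → Sph d × ℝ) → ℝ}
    (hf : Measurable f) {C : ℝ} (hC : ∀ z, |f z| ≤ C) {ϱ : Sph d × (ℕ → Sph d × ℝ) → ℝ}
    (hϱ : Measurable[pathFil d n] ϱ) :
    (μ ⊗ₘ Q)[fun p => f (ϱ p, fun k => p.2 (n + k)) | pathFil d n]
      =ᵐ[μ ⊗ₘ Q] fun p => ∫ w, f (ϱ p, w) ∂(Q (pathX p.1 p.2 n)) := by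
  obtain ⟨r, hr, rfl⟩ := hϱ.exists_eq_measurable_comp
  set X : Sph d × (ℕ → Sph d × ℝ) → Sph d × (Fin n → Sph d × ℝ) :=
    fun p => (p.1, fun k : Fin n => p.2 k) with hX
  have hXm : Measurable X :=
    measurable_fst.prodMk ((measurable_initSeg n).comp measurable_snd)
  set Y : Sph d × (ℕ → Sph d × ℝ) → ℕ → Sph d × ℝ := fun p k => p.2 (n + k) with hY
  have hYm : Measurable Y := (measurable_shiftSeq n).comp measurable_snd
  have hlaw : (μ ⊗ₘ Q).map (fun p => (X p, Y p)) =
      ((μ ⊗ₘ Q).map X) ⊗ₘ Q.comap (fun q => segX n q.1 q.2) (measurable_segX n) := by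
    refine Measure.ext_of_lintegral _ fun F hF => ?_
    have hF1 : Measurable fun p => F (X p, Y p) := hF.comp (hXm.prodMk hYm)
    rw [lintegral_map hF (hXm.prodMk hYm), Measure.lintegral_compProd hF1,
      Measure.lintegral_compProd hF, lintegral_map hF.lintegral_kernel_prod_right' hXm]
    refine Eq.trans ?_ (Measure.lintegral_compProd
      (hF.lintegral_kernel_prod_right'.comp hXm)).symm
    refine lintegral_congr fun x => ?_
    have h1 := hQ.lintegral_markov x n (F := fun q => F ((x, q.1), q.2))
      (hF.comp (by fun_prop))
    refine h1.trans (lintegral_congr fun w => ?_)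
    rw [pathX_eq_segX]
    rfl
  have : Nonempty (Sph d) := ⟨basePoint d⟩
  have hcd := condDistrib_ae_eq_of_measure_eq_compProd_of_measurable hXm hYm hlaw
  have hg : Measurable fun q : (Sph d × (Fin n → Sph d × ℝ)) × (ℕ → Sph d × ℝ) =>
      f (r q.1, q.2) := hf.comp ((hr.comp measurable_fst).prodMk measurable_snd)
  have h2 := condExp_prod_ae_eq_integral_condDistrib hXm hYm.aemeasurable
    hg.stronglyMeasurable (μ := μ ⊗ₘ Q)
    (Integrable.of_bound (hg.comp (hXm.prodMk hYm)).aestronglyMeasurable C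
      (ae_of_all _ fun p => hC _))
  refine h2.trans ?_
  filter_upwards [ae_of_ae_map hXm.aemeasurable hcd] with p hp
  rw [hp, Kernel.comap_apply, pathX_eq_segX]
  rfl

end RCA

namespace RCA
variable {d : ℕ} {a σ : Fin (d + 1) → ℝ} {ρ : Measure ℝ}

/-! ### The tilted laws -/

/-- A positive continuous fixed function of `Q_lam`. -/
structure IsFixedTilt (a σ : Fin (d + 1) → ℝ) (ρ : Measure ℝ) (lam : ℝ) (h : Sph d → ℝ) : Prop where
  cont : Continuous h
  pos : ∀ x, 0 < h x
  fixed : ∀ x, tiltOp a σ ρ lam h x = h x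

lemma IsFixedTilt.exists_bound {lam : ℝ} {h : Sph d → ℝ} (T : IsFixedTilt a σ ρ lam h) :
    ∃ C, ∀ x, |h x| ≤ C := by
  obtain ⟨C, hC⟩ := isCompact_univ.exists_bound_of_continuousOn (f := h) T.cont.continuousOn
  exact ⟨C, fun x => hC x (Set.mem_univ x)⟩

/-- The one-step transition kernel of the tilted chain. -/
lemma IsFixedTilt.exists_kernel (H : NoiseLaw a σ ρ) {lam : ℝ} (hlam : 0 ≤ lam) {h : Sph d → ℝ}
    (T : IsFixedTilt a σ ρ lam h) :
    ∃ K : Kernel (Sph d) (Sph d × ℝ), IsMarkovKernel K ∧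
      ∀ x (F : Sph d × ℝ → ENNReal), Measurable F → ∫⁻ p, F p ∂(K x) = ENNReal.ofReal (h x)⁻¹ *
        ∫⁻ e, ENNReal.ofReal (‖step a σ (x : EuclideanSpace ℝ (Fin (d + 1))) e‖ ^ lam *
          h (direction x (step a σ (x : EuclideanSpace ℝ (Fin (d + 1))) e))) *
          F (direction x (step a σ (x : EuclideanSpace ℝ (Fin (d + 1))) e),
            Real.log ‖step a σ (x : EuclideanSpace ℝ (Fin (d + 1))) e‖)
          ∂(Measure.pi fun _ => ρ) := by
  have := H.prob
  set γ : Measure (Fin (d + 1) → ℝ) := Measure.pi fun _ => ρ with hγ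
  set W : Sph d × (Fin (d + 1) → ℝ) → ENNReal := fun p =>
    ENNReal.ofReal (‖step a σ (p.1 : EuclideanSpace ℝ (Fin (d + 1))) p.2‖ ^ lam *
      h (direction p.1 (step a σ (p.1 : EuclideanSpace ℝ (Fin (d + 1))) p.2))) with hW
  have hWm : Measurable W := (measurable_tilt_integrand lam T.cont.measurable).ennreal_ofReal
  set D : Sph d × (Fin (d + 1) → ℝ) → Sph d × ℝ := fun p =>
    (direction p.1 (step a σ (p.1 : EuclideanSpace ℝ (Fin (d + 1))) p.2),
      Real.log ‖step a σ (p.1 : EuclideanSpace ℝ (Fin (d + 1))) p.2‖) with hD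
  have hDm : Measurable D := by
    have h1 : Measurable fun p : Sph d × (Fin (d + 1) → ℝ) =>
        step a σ (p.1 : EuclideanSpace ℝ (Fin (d + 1))) p.2 :=
      measurable_step_comp (measurable_subtype_coe.comp measurable_fst) measurable_snd
    exact (measurable_direction_comp measurable_fst h1).prodMk h1.norm.log
  set κ : Sph d → Measure (Sph d × ℝ) := fun x =>
    ENNReal.ofReal (h x)⁻¹ • (γ.withDensity fun e => W (x, e)).map fun e => D (x, e) with hκ
  have hlint : ∀ x (F : Sph d × ℝ → ENNReal), Measurable F → ∫⁻ p, F p ∂(κ x) =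
      ENNReal.ofReal (h x)⁻¹ * ∫⁻ e, W (x, e) * F (D (x, e)) ∂γ := fun x F hF => by
    simp only [hκ]
    have hDx : Measurable fun e => D (x, e) := hDm.comp measurable_prodMk_left
    have hWx : Measurable fun e => W (x, e) := hWm.comp measurable_prodMk_left
    have hFx : Measurable fun e => F (D (x, e)) := hF.comp hDx
    rw [lintegral_smul_measure, lintegral_map hF hDx,
      lintegral_withDensity_eq_lintegral_mul _ hWx hFx]
    rfl
  refine ⟨⟨κ, Measure.measurable_of_measurable_coe _ fun s hs => ?_⟩, ⟨fun x => ⟨?_⟩⟩, hlint⟩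
  · have h1 : ∀ x, κ x s = ENNReal.ofReal (h x)⁻¹ *
        ∫⁻ e, W (x, e) * s.indicator 1 (D (x, e)) ∂γ := fun x => by
      rw [← hlint x _ (measurable_one.indicator hs), lintegral_indicator_one hs]
    simp only [h1]
    refine (T.cont.measurable.inv.ennreal_ofReal).mul ?_
    exact (hWm.mul ((measurable_one.indicator hs).comp hDm)).lintegral_prod_right'
  · change κ x Set.univ = 1
    rw [← lintegral_one, hlint x _ measurable_const]
    simp only [mul_one, hW]
    obtain ⟨C, hC⟩ := T.exists_bound
    rw [← ofReal_integral_eq_lintegral_ofReal (H.integrable_tilt hlam T.cont.measurable hC x)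
      (ae_of_all _ fun e => mul_nonneg (Real.rpow_nonneg (norm_nonneg _) _) (T.pos _).le)]
    have h2 := T.fixed x
    rw [tiltOp] at h2
    rw [h2, ← ENNReal.ofReal_mul (inv_nonneg.2 (T.pos x).le), inv_mul_cancel₀ (T.pos x).ne',
      ENNReal.ofReal_one]

lemma measurable_snoc_comp {X E : Type*} [MeasurableSpace X] [MeasurableSpace E] {n : ℕ}
    {f : X → Fin n → E} {g : X → E} (hf : Measurable f) (hg : Measurable g) :
    Measurable fun x => (Fin.snoc (f x) (g x) : Fin (n + 1) → E) :=
  (measurable_snoc n).comp (hf.prodMk hg)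

/-- The function on `ℝ^q` whose expectation at `x' Π_n` is `h(x) Ẽ_x G(x_n, v_n)`. -/
noncomputable def tiltLift (lam : ℝ) (h : Sph d → ℝ) (G : Sph d × ℝ → ℝ)
    (z : EuclideanSpace ℝ (Fin (d + 1))) : ℝ :=
  ‖z‖ ^ lam * (h (direction (basePoint d) z) * G (direction (basePoint d) z, Real.log ‖z‖))

lemma measurable_tiltLift (lam : ℝ) {h : Sph d → ℝ} (hh : Measurable h) {G : Sph d × ℝ → ℝ}
    (hG : Measurable G) : Measurable (tiltLift lam h G) := by
  have h1 : Measurable (direction (basePoint d)) := measurable_direction.comp measurable_prodMk_left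
  exact (measurable_norm.pow_const lam).mul ((hh.comp h1).mul
    (hG.comp (h1.prodMk measurable_norm.log)))

lemma abs_tiltLift_le {lam : ℝ} {h : Sph d → ℝ} {C : ℝ} (hC : ∀ x, |h x| ≤ C) {G : Sph d × ℝ → ℝ}
    {B : ℝ} (hB : ∀ p, |G p| ≤ B) (z : EuclideanSpace ℝ (Fin (d + 1))) :
    |tiltLift lam h G z| ≤ (C * B) * ‖z‖ ^ lam := by
  rw [tiltLift, abs_mul, abs_mul, abs_of_nonneg (Real.rpow_nonneg (norm_nonneg _) _), mul_comm]
  refine mul_le_mul_of_nonneg_right ?_ (Real.rpow_nonneg (norm_nonneg _) _)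
  exact mul_le_mul (hC _) (hB _) (abs_nonneg _) ((abs_nonneg _).trans (hC (basePoint d)))

section Omega

variable {Ω : Type*} {η : ℕ → Fin (d + 1) → Ω → ℝ}

/-- The first `n` pairs `(x_k, u_k)` on the original probability space. -/
noncomputable def chainSeg (a σ : Fin (d + 1) → ℝ) (η : ℕ → Fin (d + 1) → Ω → ℝ) (x : Sph d)
    (n : ℕ) (ω : Ω) (k : Fin n) : Sph d × ℝ :=
  (dirChain a σ η x (k + 1) ω, logIncr a σ η x k ω)

lemma measurable_chainSeg_pastAlg (x : Sph d) (n : ℕ) :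
    Measurable[pastAlg η n] (chainSeg a σ η x n) :=
  @measurable_pi_lambda _ _ _ (pastAlg η n) _ _ fun k =>
    (measurable_dirChain_pastAlg x k.2).prodMk (measurable_logIncr_pastAlg x k.2)

/-- The weight `|x' Π_n|^lam h(x_n)`. -/
noncomputable def tiltWeight (a σ : Fin (d + 1) → ℝ) (η : ℕ → Fin (d + 1) → Ω → ℝ) (lam : ℝ)
    (h : Sph d → ℝ) (x : Sph d) (n : ℕ) (ω : Ω) : ℝ :=
  ‖rowMul (x : EuclideanSpace ℝ (Fin (d + 1))) (matProd a σ η n ω)‖ ^ lam * h (dirChain a σ η x n ω)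

lemma tiltWeight_nonneg {lam : ℝ} {h : Sph d → ℝ} (h0 : ∀ x, 0 < h x) (x : Sph d) (n : ℕ) (ω : Ω) :
    0 ≤ tiltWeight a σ η lam h x n ω :=
  mul_nonneg (Real.rpow_nonneg (norm_nonneg _) _) (h0 _).le

lemma sum_logIncr (x : Sph d) {n : ℕ} {ω : Ω}
    (h : rowMul (x : EuclideanSpace ℝ (Fin (d + 1))) (matProd a σ η n ω) ≠ 0) :
    ∑ k ∈ Finset.range n, logIncr a σ η x k ω =
      Real.log ‖rowMul (x : EuclideanSpace ℝ (Fin (d + 1))) (matProd a σ η n ω)‖ := by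
  induction n with
  | zero => simp [matProd, rowMul]
  | succ n ih =>
    have h1 := norm_ne_zero_iff.2 h
    rw [norm_rowMul_matProd_succ] at h1
    have h2 := left_ne_zero_of_mul h1
    rw [Finset.sum_range_succ, ih (norm_ne_zero_iff.1 h2), norm_rowMul_matProd_succ,
      Real.log_mul h2 (right_ne_zero_of_mul h1)]
    rfl

variable [MeasurableSpace Ω] {P : Measure Ω}

lemma IsNoise.measurable_chainSeg (N : IsNoise η P ρ) (x : Sph d) (n : ℕ) :
    Measurable (chainSeg a σ η x n) :=
  (measurable_chainSeg_pastAlg x n).mono (N.pastAlg_le n) le_rfl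

lemma IsNoise.measurable_tiltWeight (N : IsNoise η P ρ) {lam : ℝ} {h : Sph d → ℝ}
    (hh : Measurable h) (x : Sph d) (n : ℕ) : Measurable (tiltWeight a σ η lam h x n) :=
  ((N.measurable_rowMul_matProd _ n).norm.pow_const lam).mul (hh.comp (N.measurable_dirChain x n))

/-- The tilted laws are determined by their finite-dimensional laws. -/
lemma IsTiltedLaw.ext {lam : ℝ} {h : Sph d → ℝ} {Q Q' : Kernel (Sph d) (ℕ → Sph d × ℝ)}
    (hQ : IsTiltedLaw a σ η P lam h Q) (hQ' : IsTiltedLaw a σ η P lam h Q') : Q = Q' := by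
  have := hQ.isMarkov
  ext1 x
  refine ext_of_map_fin fun n => Measure.ext_of_lintegral _ fun F hF => ?_
  rw [lintegral_map hF (measurable_initSeg n), lintegral_map hF (measurable_initSeg n),
    hQ.findim x n F hF, hQ'.findim x n F hF]

variable [IsProbabilityMeasure P]

/-- The last step of the weighted chain is made according to the kernel of the tilted chain. -/
lemma IsNoise.lintegral_tiltWeight_succ (N : IsNoise η P ρ) (H : NoiseLaw a σ ρ) {lam : ℝ}
    {h : Sph d → ℝ} (T : IsFixedTilt a σ ρ lam h)
    {K : Kernel (Sph d) (Sph d × ℝ)} [IsMarkovKernel K]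
    (hK : ∀ x (F : Sph d × ℝ → ENNReal), Measurable F →
      ∫⁻ p, F p ∂(K x) = ENNReal.ofReal (h x)⁻¹ *
        ∫⁻ e, ENNReal.ofReal (‖step a σ (x : EuclideanSpace ℝ (Fin (d + 1))) e‖ ^ lam *
          h (direction x (step a σ (x : EuclideanSpace ℝ (Fin (d + 1))) e))) *
          F (direction x (step a σ (x : EuclideanSpace ℝ (Fin (d + 1))) e),
            Real.log ‖step a σ (x : EuclideanSpace ℝ (Fin (d + 1))) e‖)
          ∂(Measure.pi fun _ => ρ)) (x : Sph d) (n : ℕ)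
    {F : (Fin (n + 1) → Sph d × ℝ) → ENNReal} (hF : Measurable F) :
    ∫⁻ ω, ENNReal.ofReal (tiltWeight a σ η lam h x (n + 1) ω) * F (chainSeg a σ η x (n + 1) ω) ∂P =
      ∫⁻ ω, ENNReal.ofReal (tiltWeight a σ η lam h x n ω) *
        ∫⁻ p, F (Fin.snoc (chainSeg a σ η x n ω) p) ∂(K (segX n x (chainSeg a σ η x n ω))) ∂P := by
  have := H.prob
  have hst : Measurable fun q : (ℝ × Sph d × (Fin n → Sph d × ℝ)) × (Fin (d + 1) → ℝ) =>
      step a σ (q.1.2.1 : EuclideanSpace ℝ (Fin (d + 1))) q.2 :=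
    measurable_step_comp (measurable_subtype_coe.comp
      (measurable_fst.comp (measurable_snd.comp measurable_fst))) measurable_snd
  have hdir := measurable_direction_comp
    (measurable_fst.comp (measurable_snd.comp measurable_fst)) hst
  have hG : Measurable fun q : (ℝ × Sph d × (Fin n → Sph d × ℝ)) × (Fin (d + 1) → ℝ) =>
      ENNReal.ofReal (q.1.1 ^ lam) * (ENNReal.ofReal (
        ‖step a σ (q.1.2.1 : EuclideanSpace ℝ (Fin (d + 1))) q.2‖ ^ lam *
        h (direction q.1.2.1 (step a σ (q.1.2.1 : EuclideanSpace ℝ (Fin (d + 1))) q.2))) *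
      F (Fin.snoc q.1.2.2
        (direction q.1.2.1 (step a σ (q.1.2.1 : EuclideanSpace ℝ (Fin (d + 1))) q.2),
        Real.log ‖step a σ (q.1.2.1 : EuclideanSpace ℝ (Fin (d + 1))) q.2‖))) := by
    refine ((measurable_fst.comp measurable_fst).pow_const lam).ennreal_ofReal.mul (.mul ?_ ?_)
    · exact ((hst.norm.pow_const lam).mul (T.cont.measurable.comp hdir)).ennreal_ofReal
    · exact hF.comp ((measurable_snoc n).comp ((measurable_snd.comp
        (measurable_snd.comp measurable_fst)).prodMk (hdir.prodMk hst.norm.log)))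
  have hZ : Measurable[pastAlg η n] fun ω =>
      (‖rowMul (x : EuclideanSpace ℝ (Fin (d + 1))) (matProd a σ η n ω)‖,
        dirChain a σ η x n ω, chainSeg a σ η x n ω) :=
    (measurable_norm.comp (measurable_rowMul_matProd_pastAlg _ n)).prodMk
      ((measurable_dirChain_pastAlg x le_rfl).prodMk (measurable_chainSeg_pastAlg x n))
  have hmain := N.lintegral_past hZ hG
  refine Eq.trans ?_ (hmain.trans ?_)
  · refine lintegral_congr fun ω => ?_
    rw [← mul_assoc, ← ENNReal.ofReal_mul (Real.rpow_nonneg (norm_nonneg _) _)]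
    congr 2
    · rw [tiltWeight, norm_rowMul_matProd_succ, Real.mul_rpow (norm_nonneg _) (norm_nonneg _),
        mul_assoc]
      rfl
    · funext k
      refine Fin.lastCases ?_ (fun j => ?_) k
      · rw [Fin.snoc_last]; rfl
      · rw [Fin.snoc_castSucc]; rfl
  · refine lintegral_congr fun ω => ?_
    have hs : segX n x (chainSeg a σ η x n ω) = dirChain a σ η x n ω := by
      cases n <;> rfl
    have hx := T.pos (dirChain a σ η x n ω)
    have hFs : Measurable fun p => F (Fin.snoc (chainSeg a σ η x n ω) p) :=
      hF.comp (measurable_snoc_comp measurable_const measurable_id)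
    -- The factor `h(x_n)` of the weight cancels against `h(x_n)⁻¹` in the kernel.
    dsimp only
    rw [hs, hK _ _ hFs, tiltWeight,
      lintegral_const_mul _ ?_, ENNReal.ofReal_mul (Real.rpow_nonneg (norm_nonneg _) _), mul_assoc,
      ← mul_assoc (ENNReal.ofReal (h _)), ← ENNReal.ofReal_mul hx.le, mul_inv_cancel₀ hx.ne',
      ENNReal.ofReal_one, one_mul]
    · have h1 : Measurable fun e : Fin (d + 1) → ℝ =>
          step a σ (dirChain a σ η x n ω : EuclideanSpace ℝ (Fin (d + 1))) e :=
        measurable_step_comp measurable_const measurable_id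
      have h2 := measurable_direction_comp (measurable_const (a := dirChain a σ η x n ω)) h1
      exact ((h1.norm.pow_const lam).mul (T.cont.measurable.comp h2)).ennreal_ofReal.mul
        (hF.comp (measurable_snoc_comp measurable_const (h2.prodMk h1.norm.log)))

/-- Existence of the tilted laws, as the laws of a Markov chain. -/
theorem IsFixedTilt.exists_tiltedLaw (N : IsNoise η P ρ) (H : NoiseLaw a σ ρ) {lam : ℝ}
    (hlam : 0 ≤ lam) {h : Sph d → ℝ} (T : IsFixedTilt a σ ρ lam h) :
    ∃ (K : Kernel (Sph d) (Sph d × ℝ)) (Q : Kernel (Sph d) (ℕ → Sph d × ℝ)), IsMarkovKernel K ∧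
      IsChain K Q ∧ IsTiltedLaw a σ η P lam h Q := by
  obtain ⟨K, hKm, hK⟩ := T.exists_kernel H hlam
  obtain ⟨Q, hQm, hQ⟩ := exists_isChain K
  refine ⟨K, Q, hKm, hQ, ⟨hQm, fun x n F hF => ?_⟩⟩
  induction n with
  | zero =>
    have h1 : ∀ u : Fin 0 → Sph d × ℝ, F u = F fun k => k.elim0 := fun u => by
      congr 1; exact Subsingleton.elim _ _
    have h2 := T.pos x
    simp only [h1, lintegral_const, measure_univ, mul_one, matProd, dirChain]
    rw [← mul_assoc, ← ENNReal.ofReal_mul (inv_nonneg.2 h2.le)]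
    simp [rowMul, inv_mul_cancel₀ h2.ne']
  | succ n ih =>
    have h3 : Measurable fun q : (Fin n → Sph d × ℝ) =>
        ∫⁻ p, F (Fin.snoc q p) ∂(K (segX n x q)) :=
      (hF.comp (measurable_snoc n)).lintegral_kernel_prod_right'
        (κ := K.comap _ ((measurable_segX n).comp measurable_prodMk_left))
    rw [hQ x n F hF]
    simp only [pathX_eq_segX]
    rw [ih _ h3]
    exact congrArg _ (N.lintegral_tiltWeight_succ H T hK x n hF).symm

lemma IsTiltedLaw.exists_isChain {lam : ℝ} {h : Sph d → ℝ} {Q : Kernel (Sph d) (ℕ → Sph d × ℝ)}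
    (hQ : IsTiltedLaw a σ η P lam h Q) (N : IsNoise η P ρ) (H : NoiseLaw a σ ρ) (hlam : 0 ≤ lam)
    (T : IsFixedTilt a σ ρ lam h) :
    ∃ K : Kernel (Sph d) (Sph d × ℝ), IsMarkovKernel K ∧ IsChain K Q := by
  obtain ⟨K, Q', hK, hQ', hQ'T⟩ := T.exists_tiltedLaw N H hlam
  rw [hQ.ext hQ'T]
  exact ⟨K, hK, hQ'⟩

/-- The finite-dimensional laws, in terms of integrals of real functions. -/
lemma IsTiltedLaw.integral_eq {lam : ℝ} {h : Sph d → ℝ} {Q : Kernel (Sph d) (ℕ → Sph d × ℝ)}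
    (hQ : IsTiltedLaw a σ η P lam h Q) (N : IsNoise η P ρ) (T : IsFixedTilt a σ ρ lam h)
    (x : Sph d) (n : ℕ) {f : (Fin n → Sph d × ℝ) → ℝ} (hf : Measurable f) :
    ∫ w, f (fun k => w k) ∂(Q x) =
      (h x)⁻¹ * ∫ ω, tiltWeight a σ η lam h x n ω * f (chainSeg a σ η x n ω) ∂P := by
  have hw := N.measurable_tiltWeight (a := a) (σ := σ) (lam := lam) T.cont.measurable x n
  have hmap : (Q x).map (fun w (k : Fin n) => w k) = ENNReal.ofReal (h x)⁻¹ •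
      (P.withDensity fun ω => ENNReal.ofReal (tiltWeight a σ η lam h x n ω)).map
        (chainSeg a σ η x n) := by
    refine Measure.ext_of_lintegral _ fun F hF => ?_
    have hFc : Measurable fun ω => F (chainSeg a σ η x n ω) := hF.comp (N.measurable_chainSeg x n)
    rw [lintegral_map hF (measurable_initSeg n), hQ.findim x n F hF, lintegral_smul_measure,
      lintegral_map hF (N.measurable_chainSeg x n),
      lintegral_withDensity_eq_lintegral_mul _ hw.ennreal_ofReal hFc]
    rfl
  rw [← integral_map (f := f) (measurable_initSeg n).aemeasurable hf.aestronglyMeasurable, hmap,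
    integral_smul_measure, integral_map (N.measurable_chainSeg x n).aemeasurable
      hf.aestronglyMeasurable,
    integral_withDensity_eq_integral_toReal_smul hw.ennreal_ofReal
      (ae_of_all _ fun _ => ENNReal.ofReal_lt_top),
    ENNReal.toReal_ofReal (inv_nonneg.2 (T.pos x).le), smul_eq_mul]
  congr 1
  refine integral_congr_ae (ae_of_all _ fun ω => ?_)
  simp only [smul_eq_mul]
  rw [ENNReal.toReal_ofReal (tiltWeight_nonneg T.pos x n ω)]

lemma IsTiltedLaw.integral_pathX_pathV {lam : ℝ} {h : Sph d → ℝ}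
    {Q : Kernel (Sph d) (ℕ → Sph d × ℝ)} (hQ : IsTiltedLaw a σ η P lam h Q) (N : IsNoise η P ρ)
    (hlam : 0 < lam) (T : IsFixedTilt a σ ρ lam h) (x : Sph d) (n : ℕ) {G : Sph d × ℝ → ℝ}
    (hG : Measurable G) :
    ∫ w, G (pathX x w n, pathV w n) ∂(Q x) = (h x)⁻¹ *
      ∫ ω, tiltLift lam h G
        (rowMul (x : EuclideanSpace ℝ (Fin (d + 1))) (matProd a σ η n ω)) ∂P := by
  have hf : Measurable fun u : Fin n → Sph d × ℝ => G (segX n x u, ∑ k, (u k).2) :=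
    hG.comp (((measurable_segX n).comp measurable_prodMk_left).prodMk
      (Finset.measurable_sum _ fun k _ => measurable_snd.comp (measurable_pi_apply k)))
  have h1 := hQ.integral_eq N T x n hf
  simp only [pathX_eq_segX, pathV, ← Fin.sum_univ_eq_sum_range]
  refine h1.trans ?_
  congr 1
  refine integral_congr_ae (ae_of_all _ fun ω => ?_)
  beta_reduce
  have hs : segX n x (chainSeg a σ η x n ω) = dirChain a σ η x n ω := by
    cases n <;> rfl
  rw [hs, tiltLift, tiltWeight, mul_assoc]
  by_cases hz : rowMul (x : EuclideanSpace ℝ (Fin (d + 1))) (matProd a σ η n ω) = 0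
  · rw [hz, norm_zero, Real.zero_rpow hlam.ne', zero_mul, zero_mul]
  · rw [direction_rowMul_matProd x _ hz, ← sum_logIncr x hz,
      ← Fin.sum_univ_eq_sum_range (fun k => logIncr a σ η x k ω)]
    rfl

end Omega

end RCA

namespace RCA
variable {d : ℕ} {a σ : Fin (d + 1) → ℝ} {ρ : Measure ℝ}

/-! ### Continuity and reachability of the tilted chain -/

section Omega

variable {Ω : Type*} {η : ℕ → Fin (d + 1) → Ω → ℝ}

lemma continuous_dirChain {ω : Ω}
    (hω : ∀ k (x : Sph d), step a σ (x : EuclideanSpace ℝ (Fin (d + 1))) (fun i => η k i ω) ≠ 0)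
    (n : ℕ) : Continuous fun x => dirChain a σ η x n ω := by
  induction n with
  | zero => exact continuous_id
  | succ n ih =>
    have hcs : Continuous fun x : Sph d => step a σ
        (dirChain a σ η x n ω : EuclideanSpace ℝ (Fin (d + 1))) fun i => η n i ω :=
      (continuous_step a σ).comp ((continuous_subtype_val.comp ih).prodMk continuous_const)
    rw [continuous_iff_continuousAt]
    intro x
    have h1 := ContinuousAt.comp (f := fun x : Sph d => step a σ
        (dirChain a σ η x n ω : EuclideanSpace ℝ (Fin (d + 1))) fun i => η n i ω)
        (continuousAt_direction (basePoint d) (hω n (dirChain a σ η x n ω))) hcs.continuousAt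
    exact h1.congr (Eventually.of_forall fun y => direction_eq_of_ne_zero _ _ (hω n _))

lemma continuous_logIncr {ω : Ω}
    (hω : ∀ k (x : Sph d), step a σ (x : EuclideanSpace ℝ (Fin (d + 1))) (fun i => η k i ω) ≠ 0)
    (n : ℕ) : Continuous fun x => logIncr a σ η x n ω := by
  have hcs : Continuous fun x : Sph d => step a σ
      (dirChain a σ η x n ω : EuclideanSpace ℝ (Fin (d + 1))) fun i => η n i ω :=
    (continuous_step a σ).comp
      ((continuous_subtype_val.comp (continuous_dirChain hω n)).prodMk continuous_const)
  exact hcs.norm.log fun x => norm_ne_zero_iff.2 (hω n _)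

lemma continuous_tiltWeight {lam : ℝ} (hlam : 0 ≤ lam) {h : Sph d → ℝ} (hh : Continuous h) {ω : Ω}
    (hω : ∀ k (x : Sph d), step a σ (x : EuclideanSpace ℝ (Fin (d + 1))) (fun i => η k i ω) ≠ 0)
    (n : ℕ) : Continuous fun x => tiltWeight a σ η lam h x n ω := by
  have h1 : Continuous fun x : Sph d =>
      rowMul (x : EuclideanSpace ℝ (Fin (d + 1))) (matProd a σ η n ω) := by
    unfold rowMul
    fun_prop
  exact (h1.norm.rpow_const fun _ => Or.inr hlam).mul (hh.comp (continuous_dirChain hω n))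

variable [MeasurableSpace Ω] {P : Measure Ω} [IsProbabilityMeasure P]

lemma IsNoise.ae_forall_step_ne_zero (N : IsNoise η P ρ) (H : NoiseLaw a σ ρ) : ∀ᵐ ω ∂P, ∀ k
    (x : Sph d), step a σ (x : EuclideanSpace ℝ (Fin (d + 1))) (fun i => η k i ω) ≠ 0 := by
  have := H.prob
  rw [ae_all_iff]
  intro k
  have hm : Measurable fun ω i => η k i ω := measurable_pi_lambda _ fun i => N.meas k i
  have hlaw : P.map (fun ω i => η k i ω) = Measure.pi fun _ => ρ := by
    have h1 := congrArg (fun μ => μ.map Prod.snd)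
      (N.map_prodMk (n := k) (Z := fun _ => ()) (@measurable_const _ _ _ (pastAlg η k) _))
    beta_reduce at h1
    rw [Measure.map_map measurable_snd (measurable_const.prodMk hm), Measure.map_snd_prod,
      Measure.map_apply measurable_const MeasurableSet.univ] at h1
    simpa [Function.comp_def] using h1
  have h2 := ae_last_coeff_ne_zero H
  rw [← hlaw] at h2
  filter_upwards [ae_of_ae_map hm.aemeasurable h2] with ω hω x h
  exact ne_zero_of_mem_unit_sphere x (step_eq_zero hω h)

variable {lam : ℝ} {h : Sph d → ℝ} {Q : Kernel (Sph d) (ℕ → Sph d × ℝ)}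

lemma IsTiltedLaw.continuous_integral (hQ : IsTiltedLaw a σ η P lam h Q) (N : IsNoise η P ρ)
    (H : NoiseLaw a σ ρ) (hlam : 0 ≤ lam) (T : IsFixedTilt a σ ρ lam h) (m : ℕ)
    {f : (Fin m → Sph d × ℝ) → ℝ} (hf : Continuous f) {B : ℝ} (hB : ∀ z, |f z| ≤ B) :
    Continuous fun x => ∫ w, f (fun k => w k) ∂(Q x) := by
  obtain ⟨C, hC⟩ := T.exists_bound
  simp only [hQ.integral_eq N T _ m hf.measurable]
  refine (T.cont.inv₀ fun x => (T.pos x).ne').mul ?_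
  refine continuous_of_dominated
    (bound := fun ω => matNorm (matProd a σ η m ω) ^ lam * C * B) (fun x => ?_) (fun x => ?_)
    (((N.integrable_matNorm_matProd H hlam m).mul_const C).mul_const B) ?_
  · exact ((N.measurable_tiltWeight T.cont.measurable x m).mul
      (hf.measurable.comp (N.measurable_chainSeg x m))).aestronglyMeasurable
  · refine ae_of_all _ fun ω => ?_
    have h1 := Real.rpow_le_rpow (norm_nonneg _)
      (norm_rowMul_matProd_le (a := a) (σ := σ) (η := η) x m ω) hlam
    have h2 : 0 ≤ matNorm (matProd a σ η m ω) ^ lam := Real.rpow_nonneg (matNorm_nonneg _) _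
    have hC0 : 0 ≤ C := (abs_nonneg _).trans (hC x)
    rw [norm_mul, tiltWeight, norm_mul, Real.norm_of_nonneg (Real.rpow_nonneg (norm_nonneg _) _)]
    exact mul_le_mul (mul_le_mul h1 (hC _) (abs_nonneg _) h2) (hB _) (abs_nonneg _)
      (mul_nonneg h2 hC0)
  · filter_upwards [N.ae_forall_step_ne_zero H] with ω hω
    refine (continuous_tiltWeight hlam T.cont hω m).mul (hf.comp (continuous_pi fun k => ?_))
    exact (continuous_dirChain hω _).prodMk (continuous_logIncr hω _)

/-- The smoothing property of the tilted chain. -/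
theorem IsTiltedLaw.exists_forall_abs_sub_le (hQ : IsTiltedLaw a σ η P lam h Q) (N : IsNoise η P ρ)
    (H : NoiseLaw a σ ρ) (hlam : 0 < lam) (T : IsFixedTilt a σ ρ lam h) {l : ℕ}
    (hl : 2 * d + 1 ≤ l) {B : ℝ} (hB : 0 ≤ B) {ε : ℝ} (hε : 0 < ε) :
    ∃ δ : ℝ, 0 < δ ∧ ∀ G : Sph d × ℝ → ℝ, Measurable G → (∀ p, |G p| ≤ B) →
      ∀ x y : Sph d, dist x y < δ →
        |∫ w, G (pathX x w l, pathV w l) ∂(Q x) - ∫ w, G (pathX y w l, pathV w l) ∂(Q y)| ≤ ε := by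
  obtain ⟨C, hC⟩ := T.exists_bound
  have hC0 : 0 ≤ C := (abs_nonneg _).trans (hC (basePoint d))
  have hinv : Continuous fun x => (h x)⁻¹ := T.cont.inv₀ fun x => (T.pos x).ne'
  obtain ⟨D, hD⟩ := isCompact_univ.exists_bound_of_continuousOn hinv.continuousOn
  have hD' : ∀ x, |(h x)⁻¹| ≤ D := fun x => hD x (Set.mem_univ x)
  have hD0 : 0 ≤ D := (abs_nonneg _).trans (hD' (basePoint d))
  set M := ∫ ω, C * B * matNorm (matProd a σ η l ω) ^ lam ∂P with hM
  have hM0 : 0 ≤ M := integral_nonneg fun ω =>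
    mul_nonneg (mul_nonneg hC0 hB) (Real.rpow_nonneg (matNorm_nonneg _) _)
  obtain ⟨δ₁, hδ₁, hF⟩ := N.exists_forall_abs_integral_rowMul_sub_le H hlam.le
    (mul_nonneg hC0 hB) hl (show 0 < ε / (2 * (D + 1)) by positivity)
  obtain ⟨δ₂, hδ₂, hu⟩ := Metric.uniformContinuous_iff.1
    (CompactSpace.uniformContinuous_of_continuous hinv) (ε / (2 * (M + 1))) (by positivity)
  refine ⟨min δ₁ δ₂, lt_min hδ₁ hδ₂, fun G hG hGB x y hxy => ?_⟩
  rw [hQ.integral_pathX_pathV N hlam T x l hG, hQ.integral_pathX_pathV N hlam T y l hG]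
  have hm := measurable_tiltLift lam T.cont.measurable hG
  have hb := abs_tiltLift_le (lam := lam) hC hGB
  set I : Sph d → ℝ := fun x => ∫ ω, tiltLift lam h G
    (rowMul (x : EuclideanSpace ℝ (Fin (d + 1))) (matProd a σ η l ω)) ∂P with hI
  have h1 : |I x - I y| ≤ ε / (2 * (D + 1)) :=
    hF _ hm hb x y (hxy.trans_le (min_le_left _ _))
  have h2 : |I y| ≤ M := by
    rw [← Real.norm_eq_abs]
    refine norm_integral_le_of_norm_le ((N.integrable_matNorm_matProd H hlam.le l).const_mul _)
      (ae_of_all _ fun ω => (hb _).trans ?_)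
    exact mul_le_mul_of_nonneg_left (Real.rpow_le_rpow (norm_nonneg _)
      (norm_rowMul_matProd_le y l ω) hlam.le) (mul_nonneg hC0 hB)
  have h3 : |(h x)⁻¹ - (h y)⁻¹| ≤ ε / (2 * (M + 1)) :=
    (hu (hxy.trans_le (min_le_right _ _))).le
  have h4 : (h x)⁻¹ * I x - (h y)⁻¹ * I y =
      (h x)⁻¹ * (I x - I y) + ((h x)⁻¹ - (h y)⁻¹) * I y := by ring
  change |(h x)⁻¹ * I x - (h y)⁻¹ * I y| ≤ ε
  rw [h4]
  refine (abs_add_le _ _).trans ?_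
  rw [abs_mul, abs_mul]
  have h5 : |(h x)⁻¹| * |I x - I y| ≤ (D + 1) * (ε / (2 * (D + 1))) :=
    mul_le_mul ((hD' x).trans (by linarith)) h1 (abs_nonneg _) (by linarith)
  have h6 : |(h x)⁻¹ - (h y)⁻¹| * |I y| ≤ ε / (2 * (M + 1)) * (M + 1) :=
    mul_le_mul h3 (h2.trans (by linarith)) (abs_nonneg _) (by positivity)
  have h7 : (D + 1) * (ε / (2 * (D + 1))) = ε / 2 := by field_simp
  have h8 : ε / (2 * (M + 1)) * (M + 1) = ε / 2 := by field_simp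
  linarith

/-- The null sets of `(x_l, v_l)` under the tilted law do not depend on the starting point. -/
theorem IsTiltedLaw.integral_eq_zero_iff (hQ : IsTiltedLaw a σ η P lam h Q) (N : IsNoise η P ρ)
    (H : NoiseLaw a σ ρ) (hlam : 0 < lam) (T : IsFixedTilt a σ ρ lam h) {l : ℕ}
    (hl : 4 * d + 2 ≤ l) {G : Sph d × ℝ → ℝ} (hG : Measurable G) {B : ℝ} (hG0 : ∀ p, 0 ≤ G p)
    (hB : ∀ p, |G p| ≤ B) (x : Sph d) :
    ∫ w, G (pathX x w l, pathV w l) ∂(Q x) = 0 ↔ ∀ᵐ z, tiltLift lam h G z = 0 := by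
  obtain ⟨C, hC⟩ := T.exists_bound
  have hC0 : 0 ≤ C := (abs_nonneg _).trans (hC (basePoint d))
  have hB0 : 0 ≤ B := (abs_nonneg _).trans (hB (basePoint d, 0))
  rw [hQ.integral_pathX_pathV N hlam T x l hG, mul_eq_zero,
    or_iff_right (inv_ne_zero (T.pos x).ne')]
  exact N.integral_rowMul_eq_zero_iff H (measurable_tiltLift lam T.cont.measurable hG) hlam.le
    (mul_nonneg hC0 hB0) (fun z => mul_nonneg (Real.rpow_nonneg (norm_nonneg _) _)
      (mul_nonneg (T.pos _).le (hG0 _))) (abs_tiltLift_le hC hB) x hl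

theorem IsTiltedLaw.condC1 (hQ : IsTiltedLaw a σ η P lam h Q) (N : IsNoise η P ρ)
    (H : NoiseLaw a σ ρ) (hlam : 0 ≤ lam) (T : IsFixedTilt a σ ρ lam h) : CondC1 Q := by
  obtain ⟨K, hK, hKQ⟩ := hQ.exists_isChain N H hlam T
  have := hQ.isMarkov
  refine ⟨fun μ hμ n f hf ⟨C, hC⟩ ϱ hϱ => hKQ.condExp_ae_eq μ n hf hC hϱ, fun m f hf ⟨B, hB⟩ => ?_⟩
  exact hQ.continuous_integral N H hlam T m hf hB

theorem IsTiltedLaw.condC3 (hQ : IsTiltedLaw a σ η P lam h Q) (N : IsNoise η P ρ)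
    (H : NoiseLaw a σ ρ) (hlam : 0 < lam) (T : IsFixedTilt a σ ρ lam h) : CondC3 Q := by
  have := hQ.isMarkov
  refine ⟨4 * d + 2, by omega, fun ν δ hδ => ⟨basePoint d, 1, one_pos, fun ε hε _ => ?_⟩⟩
  set y := basePoint d with hy
  set l := 4 * d + 2 with hl
  set A : Set (Sph d × ℝ) := {p | dist p.1 y < ε ∧ |p.2 - ν| < δ} with hA
  have hAo : IsOpen A := by
    have h1 : IsOpen {p : Sph d × ℝ | dist p.1 y < ε} := isOpen_lt (by fun_prop) continuous_const
    have h2 : IsOpen {p : Sph d × ℝ | |p.2 - ν| < δ} := isOpen_lt (by fun_prop) continuous_const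
    exact h1.inter h2
  set G : Sph d × ℝ → ℝ := A.indicator 1 with hG
  have hGm : Measurable G := measurable_one.indicator hAo.measurableSet
  have hG0 : ∀ p, 0 ≤ G p := fun p => Set.indicator_nonneg (fun _ _ => zero_le_one) p
  have hG1 : ∀ p, |G p| ≤ 1 := fun p => by
    rw [abs_of_nonneg (hG0 p)]
    exact Set.indicator_le_self' (fun _ _ => zero_le_one) p
  set p : Sph d → ℝ := fun x => ∫ w, G (pathX x w l, pathV w l) ∂(Q x) with hp
  have hpc : Continuous p := by
    rw [Metric.continuous_iff]
    intro x e he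
    obtain ⟨δ', hδ', hF⟩ := hQ.exists_forall_abs_sub_le N H hlam T (l := l) (by omega)
      (B := 1) zero_le_one (half_pos he)
    exact ⟨δ', hδ', fun z hz => lt_of_le_of_lt (hF G hGm hG1 z x hz) (half_lt_self he)⟩
  have hp0 : ∀ x, 0 < p x := by
    intro x
    refine lt_of_le_of_ne (integral_nonneg fun _ => hG0 _) fun hcon => ?_
    have hae := (hQ.integral_eq_zero_iff N H hlam T le_rfl hGm hG0 hG1 x).1 hcon.symm
    -- the function is positive near the vector of direction `y` and norm `exp ν`
    set z₀ : EuclideanSpace ℝ (Fin (d + 1)) := Real.exp ν • (y : EuclideanSpace ℝ (Fin (d + 1)))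
      with hz₀
    have hn : ‖z₀‖ = Real.exp ν := by
      rw [hz₀, norm_smul, Real.norm_of_nonneg (Real.exp_pos _).le, norm_eq_of_mem_sphere, mul_one]
    have hz0 : z₀ ≠ 0 := norm_ne_zero_iff.1 (by rw [hn]; exact (Real.exp_pos _).ne')
    have hd : direction (basePoint d) z₀ = y := by
      rw [hz₀, direction_smul _ (Real.exp_pos _), direction_coe]
    have hcont : ContinuousAt (fun z : EuclideanSpace ℝ (Fin (d + 1)) =>
        (direction (basePoint d) z, Real.log ‖z‖)) z₀ :=
      (continuousAt_direction _ hz0).prodMk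
        ((Real.continuousAt_log (norm_ne_zero_iff.2 hz0)).comp continuous_norm.continuousAt)
    have hmem : (direction (basePoint d) z₀, Real.log ‖z₀‖) ∈ A := by
      rw [hd, hn, Real.log_exp]
      exact ⟨by simpa using hε, by simpa using hδ⟩
    have hev := (hcont.eventually (hAo.mem_nhds hmem)).and (isOpen_ne.mem_nhds hz0)
    obtain ⟨U, hU, hUo, hzU⟩ := eventually_nhds_iff.1 hev
    refine (hUo.measure_pos volume ⟨_, hzU⟩).ne'
      (measure_mono_null (fun z hz => ?_) (ae_iff.1 hae))
    have h1 : G (direction (basePoint d) z, Real.log ‖z‖) = 1 :=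
      Set.indicator_of_mem (s := A) (hU z hz).1 _
    change ¬ (tiltLift lam h G z = 0)
    rw [tiltLift, h1, mul_one]
    exact (mul_pos (Real.rpow_pos_of_pos (norm_pos_iff.2 (hU z hz).2) _) (T.pos _)).ne'
  obtain ⟨x₀, -, hx₀⟩ := isCompact_univ.exists_isMinOn ⟨y, Set.mem_univ y⟩ hpc.continuousOn
  have hval : ∀ x, Q x {w | dist (pathX x w l) y < ε ∧ |pathV w l - ν| < δ} =
      ENNReal.ofReal (p x) := fun x => by
    have hm : MeasurableSet {w : ℕ → Sph d × ℝ | dist (pathX x w l) y < ε ∧ |pathV w l - ν| < δ} :=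
      ((measurable_pathX_right x l).prodMk (measurable_pathV l)) hAo.measurableSet
    have h1 : p x = ∫ w, {w : ℕ → Sph d × ℝ | dist (pathX x w l) y < ε ∧
        |pathV w l - ν| < δ}.indicator 1 w ∂(Q x) := rfl
    rw [h1, integral_indicator_one hm, ofReal_measureReal]
  refine lt_of_lt_of_le (ENNReal.ofReal_pos.2 (hp0 x₀)) ?_
  refine le_iInf₂ fun x _ => ?_
  rw [hval]
  exact ENNReal.ofReal_le_ofReal (hx₀ (Set.mem_univ x))

theorem IsTiltedLaw.condC4 (hQ : IsTiltedLaw a σ η P lam h Q) (N : IsNoise η P ρ)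
    (H : NoiseLaw a σ ρ) (hlam : 0 < lam) (T : IsFixedTilt a σ ρ lam h) : CondC4 Q := by
  refine ⟨2 * d + 1, by omega, fun Φ hΦ ⟨B, hB⟩ e he => ?_⟩
  obtain ⟨δ, hδ, hF⟩ := hQ.exists_forall_abs_sub_le N H hlam T le_rfl
    ((abs_nonneg _).trans (hB (basePoint d, 0, 0))) he
  refine ⟨δ, hδ, fun x y hxy t => ?_⟩
  exact hF (fun p => Φ (p.1, p.2, t)) (hΦ.comp (by fun_prop)) (fun p => hB _) x y hxy

end Omega

end RCA

namespace RCA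
variable {d : ℕ} {a σ : Fin (d + 1) → ℝ} {ρ : Measure ℝ}

/-! ### Geometric ergodicity of the tilted chain -/

section Chain

variable {K : Kernel (Sph d) (Sph d × ℝ)} [IsMarkovKernel K]
  {Q : Kernel (Sph d) (ℕ → Sph d × ℝ)} [IsMarkovKernel Q]

/-- The Markov property, in terms of integrals of real functions. -/
lemma IsChain.integral_markov (hQ : IsChain K Q) (x : Sph d) (n : ℕ)
    {F : (Fin n → Sph d × ℝ) × (ℕ → Sph d × ℝ) → ℝ} (hF : Measurable F)
    (hi : Integrable (fun w => F (fun k => w k, fun k => w (n + k))) (Q x)) :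
    ∫ w, F (fun k => w k, fun k => w (n + k)) ∂(Q x) =
      ∫ w, ∫ w', F (fun k => w k, w') ∂(Q (pathX x w n)) ∂(Q x) := by
  have hm : Measurable fun w : ℕ → Sph d × ℝ => ((fun k : Fin n => w k), fun k => w (n + k)) :=
    (measurable_initSeg n).prodMk (measurable_shiftSeq n)
  have hi' := (integrable_map_measure hF.aestronglyMeasurable hm.aemeasurable).2 hi
  rw [hQ.map_prodMk] at hi'
  have h1 := integral_map (μ := Q x) hm.aemeasurable (f := F) hF.aestronglyMeasurable
  rw [hQ.map_prodMk, Measure.integral_compProd hi'] at h1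
  have h2 : StronglyMeasurable fun u : Fin n → Sph d × ℝ => ∫ w', F (u, w') ∂(Q (segX n x u)) :=
    hF.stronglyMeasurable.integral_kernel_prod_right'
      (κ := Q.comap (fun u => segX n x u) ((measurable_segX n).comp measurable_prodMk_left))
  simp only [Kernel.comap_apply] at h1
  rw [← h1, integral_map (measurable_initSeg n).aemeasurable h2.aestronglyMeasurable]
  simp only [pathX_eq_segX]

/-- `chainOp Q n f x` is the expectation of `f(x_n)` for the chain started at `x`. -/
noncomputable def chainOp (Q : Kernel (Sph d) (ℕ → Sph d × ℝ)) (n : ℕ) (f : Sph d → ℝ)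
    (x : Sph d) : ℝ :=
  ∫ w, f (pathX x w n) ∂(Q x)

lemma measurable_chainOp (n : ℕ) {f : Sph d → ℝ} (hf : Measurable f) :
    Measurable (chainOp Q n f) :=
  ((hf.comp (measurable_pathX n)).stronglyMeasurable.integral_kernel_prod_right'
      (κ := Q)).measurable

lemma integrable_comp_pathX (n : ℕ) {f : Sph d → ℝ} (hf : Measurable f) {C : ℝ}
    (hC : ∀ x, |f x| ≤ C) (x : Sph d) : Integrable (fun w => f (pathX x w n)) (Q x) :=
  Integrable.of_bound (hf.comp (measurable_pathX_right x n)).aestronglyMeasurable C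
    (ae_of_all _ fun _ => hC _)

lemma chainOp_le (n : ℕ) {f : Sph d → ℝ} (hf : Measurable f) {C : ℝ} (hC : ∀ x, |f x| ≤ C) {c : ℝ}
    (hc : ∀ x, f x ≤ c) (x : Sph d) : chainOp Q n f x ≤ c := by
  have h1 := integral_mono (integrable_comp_pathX (Q := Q) n hf hC x) (integrable_const c)
    fun w => hc (pathX x w n)
  simpa [chainOp] using h1

lemma le_chainOp (n : ℕ) {f : Sph d → ℝ} (hf : Measurable f) {C : ℝ} (hC : ∀ x, |f x| ≤ C) {c : ℝ}
    (hc : ∀ x, c ≤ f x) (x : Sph d) : c ≤ chainOp Q n f x := by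
  have h1 := integral_mono (integrable_const c) (integrable_comp_pathX (Q := Q) n hf hC x)
    fun w => hc (pathX x w n)
  simpa [chainOp] using h1

lemma abs_chainOp_le (n : ℕ) {f : Sph d → ℝ} (hf : Measurable f) {C : ℝ} (hC : ∀ x, |f x| ≤ C)
    (x : Sph d) : |chainOp Q n f x| ≤ C :=
  abs_le.2 ⟨le_chainOp n hf hC (fun y => (abs_le.1 (hC y)).1) x,
    chainOp_le n hf hC (fun y => (abs_le.1 (hC y)).2) x⟩

lemma IsChain.chainOp_add (hQ : IsChain K Q) (n m : ℕ) {f : Sph d → ℝ} (hf : Measurable f) {C : ℝ}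
    (hC : ∀ x, |f x| ≤ C) (x : Sph d) :
    chainOp Q (n + m) f x = chainOp Q n (chainOp Q m f) x := by
  have hF : Measurable fun q : (Fin n → Sph d × ℝ) × (ℕ → Sph d × ℝ) =>
      f (pathX (segX n x q.1) q.2 m) :=
    hf.comp ((measurable_pathX m).comp ((((measurable_segX n).comp
      measurable_prodMk_left).comp measurable_fst).prodMk measurable_snd))
  have hp : ∀ w : ℕ → Sph d × ℝ, pathX x w (n + m) =
      pathX (pathX x w n) (fun k => w (n + k)) m := fun w => by
    cases m <;> rfl
  have h1 := hQ.integral_markov x n hF (by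
    simp only [← pathX_eq_segX, ← hp]
    exact integrable_comp_pathX _ hf hC x)
  simp only [← pathX_eq_segX, ← hp] at h1
  exact h1

/-- The oscillation of `chainOp Q n f` is at most that of `f`. -/
lemma chainOp_sub_le (n : ℕ) {f : Sph d → ℝ} (hf : Measurable f) {D : ℝ}
    (hD : ∀ x y, f x - f y ≤ D) (x y : Sph d) : chainOp Q n f x - chainOp Q n f y ≤ D := by
  have hC : ∀ z, |f z| ≤ |f x| + D := fun z => by
    have h1 := hD z x
    have h2 := hD x z
    have h3 := le_abs_self (f x)
    have h4 := neg_abs_le (f x)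
    exact abs_le.2 ⟨by linarith, by linarith⟩
  have h1 : ∀ z, chainOp Q n f x ≤ f z + D := fun z =>
    chainOp_le n hf hC (fun u => by linarith [hD u z]) x
  have h2 := le_chainOp (Q := Q) n hf hC (c := chainOp Q n f x - D) (fun z => by linarith [h1 z]) y
  linarith

/-- Iteration of a contraction of oscillations at time `l`. -/
lemma IsChain.chainOp_sub_le_pow (hQ : IsChain K Q) {l : ℕ} {θ : ℝ}
    (hθ : ∀ f : Sph d → ℝ, Measurable f → ∀ D : ℝ, (∀ x y, f x - f y ≤ D) →
      ∀ x y, chainOp Q l f x - chainOp Q l f y ≤ θ * D)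
    {f : Sph d → ℝ} (hf : Measurable f) {D : ℝ} (hD : ∀ x y, f x - f y ≤ D) (n : ℕ) (x y : Sph d) :
    chainOp Q n f x - chainOp Q n f y ≤ θ ^ (n / l) * D := by
  have hC : ∀ z, |f z| ≤ |f x| + D := fun z => by
    have h1 := hD z x
    have h2 := hD x z
    have h3 := le_abs_self (f x)
    have h4 := neg_abs_le (f x)
    exact abs_le.2 ⟨by linarith, by linarith⟩
  have hk : ∀ k x y, chainOp Q (l * k + n % l) f x - chainOp Q (l * k + n % l) f y ≤ θ ^ k * D := by
    intro k
    induction k with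
    | zero => simpa using fun x y => chainOp_sub_le (Q := Q) (n % l) hf hD x y
    | succ k ih =>
      intro x y
      have h1 : l * (k + 1) + n % l = l + (l * k + n % l) := by ring
      rw [h1, hQ.chainOp_add l _ hf hC, hQ.chainOp_add l _ hf hC, pow_succ', mul_assoc]
      exact hθ _ (measurable_chainOp _ hf) _ ih x y
  have h2 := hk (n / l) x y
  rwa [Nat.div_add_mod] at h2

end Chain

/-- Functions almost equal to `1` for `μ` and to `-1` for `ν` exist only if `ν` is not absolutely
continuous with respect to `μ`. -/
lemma not_forall_exists_integral_gt {X : Type*} [MeasurableSpace X] {μ ν : Measure X}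
    [IsProbabilityMeasure μ] [IsProbabilityMeasure ν] (hνμ : ν ≪ μ) :
    ¬ ∀ ε : ℝ, 0 < ε → ∃ f : X → ℝ, Measurable f ∧ (∀ x, |f x| ≤ 1) ∧
      2 - ε < ∫ x, f x ∂μ - ∫ x, f x ∂ν := by
  intro hcon
  choose f hf hf1 hgap using fun k : ℕ => hcon ((1 / 2) ^ k) (by positivity)
  have hint : ∀ (k : ℕ) (m : Measure X) [IsProbabilityMeasure m], Integrable (f k) m :=
    fun k m _ => Integrable.of_bound (hf k).aestronglyMeasurable 1 (ae_of_all _ (hf1 k))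
  have hμ1 : ∀ k, ∫ x, f k x ∂μ ≤ 1 := fun k => by
    have := integral_mono (hint k μ) (integrable_const 1) fun x => (abs_le.1 (hf1 k x)).2
    simpa using this
  have hν1 : ∀ k, -1 ≤ ∫ x, f k x ∂ν := fun k => by
    have := integral_mono (integrable_const (-1)) (hint k ν) fun x => (abs_le.1 (hf1 k x)).1
    simpa using this
  -- `A k` carries almost all of the mass of `μ`, and almost nothing of that of `ν`. By the
  -- Borel-Cantelli lemma, `ν` lives on the `μ`-null set of points outside infinitely many `A k`.
  set A : ℕ → Set X := fun k => {x | 0 < f k x} with hA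
  have hAm : ∀ k, MeasurableSet (A k) := fun k => measurableSet_lt measurable_const (hf k)
  have hμA : ∀ k, μ (A k)ᶜ ≤ ENNReal.ofReal ((1 / 2) ^ k) := fun k => by
    rw [← ofReal_measureReal, ← integral_indicator_one (hAm k).compl]
    refine ENNReal.ofReal_le_ofReal ?_
    calc ∫ x, (A k)ᶜ.indicator 1 x ∂μ ≤ ∫ x, (1 - f k x) ∂μ := by
          refine integral_mono ((integrable_const 1).indicator (hAm k).compl)
            ((integrable_const 1).sub (hint k μ)) fun x => ?_
          have h1 := (abs_le.1 (hf1 k x)).2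
          by_cases hx : x ∈ A k
          · simpa [hx] using h1
          · have : f k x ≤ 0 := not_lt.1 hx
            simpa [hx] using this
      _ = 1 - ∫ x, f k x ∂μ := by
          rw [integral_sub (integrable_const 1) (hint k μ)]; simp
      _ ≤ (1 / 2) ^ k := by linarith [hgap k, hν1 k]
  have hνA : ∀ k, ν (A k) ≤ ENNReal.ofReal ((1 / 2) ^ k) := fun k => by
    rw [← ofReal_measureReal, ← integral_indicator_one (hAm k)]
    refine ENNReal.ofReal_le_ofReal ?_
    calc ∫ x, (A k).indicator 1 x ∂ν ≤ ∫ x, (1 + f k x) ∂ν := by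
          refine integral_mono ((integrable_const 1).indicator (hAm k))
            ((integrable_const 1).add (hint k ν)) fun x => ?_
          have h1 := (abs_le.1 (hf1 k x)).1
          by_cases hx : x ∈ A k
          · have : 0 < f k x := hx
            simpa [hx] using this.le
          · simp only [Set.indicator_of_notMem hx]
            linarith
      _ = 1 + ∫ x, f k x ∂ν := by
          rw [integral_add (integrable_const 1) (hint k ν)]; simp
      _ ≤ (1 / 2) ^ k := by linarith [hgap k, hμ1 k]
  have hs : ∑' k : ℕ, ENNReal.ofReal ((1 / 2) ^ k) ≠ ⊤ :=
    summable_geometric_two.tsum_ofReal_ne_top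
  have h1 := hνμ (measure_limsup_atTop_eq_zero (μ := μ) (s := fun k => (A k)ᶜ)
    (ne_top_of_le_ne_top hs (ENNReal.tsum_le_tsum hμA)))
  have h2 := measure_limsup_atTop_eq_zero (μ := ν) (s := A)
    (ne_top_of_le_ne_top hs (ENNReal.tsum_le_tsum hνA))
  have h3 : ν Set.univ = 0 := by
    refine measure_mono_null (fun x _ => ?_) (measure_union_null h1 h2)
    by_contra hx
    rw [Set.mem_union, not_or, mem_limsup_iff_frequently_mem,
      mem_limsup_iff_frequently_mem, not_frequently, not_frequently] at hx
    obtain ⟨k, hk1, hk2⟩ := (hx.1.and hx.2).exists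
    exact hk1 hk2
  simp at h3

section Omega

variable {Ω : Type*} {η : ℕ → Fin (d + 1) → Ω → ℝ} [MeasurableSpace Ω] {P : Measure Ω}
  [IsProbabilityMeasure P] {lam : ℝ} {h : Sph d → ℝ} {Q : Kernel (Sph d) (ℕ → Sph d × ℝ)}

lemma IsTiltedLaw.pathX_absolutelyContinuous (hQ : IsTiltedLaw a σ η P lam h Q)
    (N : IsNoise η P ρ) (H : NoiseLaw a σ ρ) (hlam : 0 < lam) (T : IsFixedTilt a σ ρ lam h) {l : ℕ}
    (hl : 4 * d + 2 ≤ l) (x y : Sph d) :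
    (Q x).map (fun w => pathX x w l) ≪ (Q y).map fun w => pathX y w l := by
  have := hQ.isMarkov
  have hval : ∀ (x : Sph d) (A : Set (Sph d)), MeasurableSet A →
      (((Q x).map fun w => pathX x w l) A = 0 ↔
        ∀ᵐ z, tiltLift lam h (fun p => A.indicator 1 p.1) z = 0) := fun x A hA => by
    have h1 := hQ.integral_eq_zero_iff N H hlam T hl (G := fun p => A.indicator 1 p.1) (B := 1)
      ((measurable_one.indicator hA).comp measurable_fst)
      (fun p => Set.indicator_nonneg (fun _ _ => zero_le_one) _) (fun p => by
        by_cases hp : p.1 ∈ A <;> simp [hp]) x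
    have hm := measurable_pathX_right x l
    rw [← h1, Measure.map_apply hm hA, ← measureReal_eq_zero_iff,
      ← integral_indicator_one (hm hA)]
    rfl
  refine Measure.AbsolutelyContinuous.mk fun A hA hy => ?_
  rw [hval x A hA]
  exact (hval y A hA).1 hy

/-- The tilted chain contracts oscillations: by compactness, since the laws of `x_l` for two
starting points depend continuously on these points in total variation, and are never mutually
singular. -/
theorem IsTiltedLaw.exists_contraction (hQ : IsTiltedLaw a σ η P lam h Q)
    (N : IsNoise η P ρ) (H : NoiseLaw a σ ρ) (hlam : 0 < lam) (T : IsFixedTilt a σ ρ lam h) {l : ℕ}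
    (hl : 4 * d + 2 ≤ l) :
    ∃ θ : ℝ, 0 ≤ θ ∧ θ < 1 ∧ ∀ f : Sph d → ℝ, Measurable f → ∀ D : ℝ, (∀ x y, f x - f y ≤ D) →
      ∀ x y, chainOp Q l f x - chainOp Q l f y ≤ θ * D := by
  have := hQ.isMarkov
  -- it is enough to treat functions with values in `[-1, 1]`
  obtain ⟨θ, hθ0, hθ1, hθ⟩ : ∃ θ : ℝ, 0 ≤ θ ∧ θ < 1 ∧ ∀ f : Sph d → ℝ, Measurable f →
      (∀ x, |f x| ≤ 1) → ∀ x y, chainOp Q l f x - chainOp Q l f y ≤ θ * 2 := by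
    by_contra! hcon
    have hk0 : ∀ k : ℕ, (0 : ℝ) ≤ 1 - 1 / ((k : ℝ) + 1) := fun k => by
      have h1 : 1 / ((k : ℝ) + 1) ≤ 1 := by
        rw [div_le_one (by positivity)]
        linarith [(Nat.cast_nonneg k : (0 : ℝ) ≤ k)]
      linarith
    choose f hf hf1 x y hgap using fun k : ℕ => hcon (1 - 1 / ((k : ℝ) + 1)) (hk0 k) (by
      have : 0 < 1 / ((k : ℝ) + 1) := by positivity
      linarith)
    obtain ⟨p, -, φ, hφ, hp⟩ := (isCompact_univ (X := Sph d × Sph d)).tendsto_subseq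
      (x := fun k => (x k, y k)) fun _ => Set.mem_univ _
    have hx : Tendsto (fun k => x (φ k)) atTop (𝓝 p.1) := (continuous_fst.tendsto p).comp hp
    have hy : Tendsto (fun k => y (φ k)) atTop (𝓝 p.2) := (continuous_snd.tendsto p).comp hp
    have : IsProbabilityMeasure ((Q p.1).map fun w => pathX p.1 w l) :=
      Measure.isProbabilityMeasure_map (measurable_pathX_right _ _).aemeasurable
    have : IsProbabilityMeasure ((Q p.2).map fun w => pathX p.2 w l) :=
      Measure.isProbabilityMeasure_map (measurable_pathX_right _ _).aemeasurable
    refine not_forall_exists_integral_gt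
      (hQ.pathX_absolutelyContinuous N H hlam T hl p.2 p.1) fun ε hε => ?_
    obtain ⟨δ, hδ, hF⟩ := hQ.exists_forall_abs_sub_le N H hlam T (l := l) (by omega)
      (B := 1) zero_le_one (show 0 < ε / 4 by positivity)
    have hlim : Tendsto (fun k => 2 * (1 / ((φ k : ℝ) + 1))) atTop (𝓝 0) := by
      have h1 := (tendsto_one_div_add_atTop_nhds_zero_nat (𝕜 := ℝ)).comp hφ.tendsto_atTop
      simpa using h1.const_mul 2
    obtain ⟨k, hk1, hk2, hk3⟩ := ((Metric.tendsto_nhds.1 hx δ hδ).and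
      ((Metric.tendsto_nhds.1 hy δ hδ).and (hlim.eventually_lt_const (half_pos hε)))).exists
    refine ⟨f (φ k), hf _, hf1 _, ?_⟩
    have hG : Measurable fun p : Sph d × ℝ => f (φ k) p.1 := (hf _).comp measurable_fst
    have h1 := abs_le.1 (hF (fun p => f (φ k) p.1) hG (fun p => hf1 _ _) _ _ hk1)
    have h2 := abs_le.1 (hF (fun p => f (φ k) p.1) hG (fun p => hf1 _ _) _ _ hk2)
    have h3 := hgap (φ k)
    rw [integral_map (measurable_pathX_right _ _).aemeasurable (hf _).aestronglyMeasurable,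
      integral_map (measurable_pathX_right _ _).aemeasurable (hf _).aestronglyMeasurable]
    simp only [chainOp] at h3
    linarith [h1.1, h1.2, h2.1, h2.2]
  refine ⟨θ, hθ0, hθ1, fun f hf D hD x y => ?_⟩
  have hD0 : 0 ≤ D := by simpa using hD x x
  rcases hD0.eq_or_lt with rfl | hDpos
  · simpa using chainOp_sub_le (Q := Q) l hf hD x y
  -- `f` is an affine function of a function `g` with values in `[-1, 1]`.
  have hbdd : BddAbove (Set.range f) := ⟨f x + D, by rintro _ ⟨z, rfl⟩; linarith [hD z x]⟩
  have : Nonempty (Sph d) := ⟨x⟩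
  set c := (⨆ z, f z) - D / 2 with hc
  set g : Sph d → ℝ := fun z => (f z - c) / (D / 2) with hg
  have hg1 : ∀ z, |g z| ≤ 1 := fun z => by
    have h1 : f z ≤ ⨆ z, f z := le_ciSup hbdd z
    have h2 : (⨆ z, f z) ≤ f z + D := ciSup_le fun u => by linarith [hD u z]
    rw [hg, abs_div, abs_of_pos (half_pos hDpos), div_le_one (half_pos hDpos)]
    exact abs_le.2 ⟨by linarith, by linarith⟩
  have hgm : Measurable g := (hf.sub_const c).div_const _
  have hfg : ∀ z, chainOp Q l f z = c + D / 2 * chainOp Q l g z := fun z => by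
    have h1 : ∀ z, f z = c + D / 2 * g z := fun z => by
      simp only [hg]
      field_simp
      ring
    simp only [chainOp]
    simp only [h1 (pathX _ _ _)]
    rw [integral_add (integrable_const _) ((integrable_comp_pathX l hgm hg1 z).const_mul _),
      integral_const_mul]
    simp
  rw [hfg, hfg]
  have := mul_le_mul_of_nonneg_left (hθ g hgm hg1 x y) (half_pos hDpos).le
  linarith

end Omega

end RCA

namespace RCA
variable {d : ℕ} {a σ : Fin (d + 1) → ℝ} {ρ : Measure ℝ}

/-! ### The invariant law -/

lemma tendsto_pow_div_atTop {θ : ℝ} (h0 : 0 ≤ θ) (h1 : θ < 1) {l : ℕ} (hl : l ≠ 0) :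
    Tendsto (fun n : ℕ => θ ^ (n / l)) atTop (𝓝 0) :=
  (tendsto_pow_atTop_nhds_zero_of_lt_one h0 h1).comp (Nat.tendsto_div_const_atTop hl)

section Chain

variable {K : Kernel (Sph d) (Sph d × ℝ)} [IsMarkovKernel K]
  {Q : Kernel (Sph d) (ℕ → Sph d × ℝ)} [IsMarkovKernel Q] {l : ℕ} {θ : ℝ}

/-- The expectations of `f(x_n)` converge to a constant, uniformly and exponentially fast. -/
lemma IsChain.exists_chainOp_limit (hQ : IsChain K Q) (hl : l ≠ 0) (hθ0 : 0 ≤ θ) (hθ1 : θ < 1)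
    (hθ : ∀ f : Sph d → ℝ, Measurable f → ∀ D : ℝ, (∀ x y, f x - f y ≤ D) →
      ∀ x y, chainOp Q l f x - chainOp Q l f y ≤ θ * D)
    {f : Sph d → ℝ} (hf : Measurable f) {C : ℝ} (hC : ∀ x, |f x| ≤ C) :
    ∃ c : ℝ, ∀ n x, |chainOp Q n f x - c| ≤ θ ^ (n / l) * (2 * C) := by
  have hD : ∀ x y, f x - f y ≤ 2 * C := fun x y => by
    have h1 := (abs_le.1 (hC x)).2
    have h2 := (abs_le.1 (hC y)).1
    linarith
  have hgap : ∀ n m x y, |chainOp Q (m + n) f x - chainOp Q n f y| ≤ θ ^ (n / l) * (2 * C) := by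
    intro n m x y
    rw [hQ.chainOp_add m n hf hC]
    have h1 := hQ.chainOp_sub_le_pow hθ hf hD n
    have hm := measurable_chainOp (Q := Q) n hf
    have hb := abs_chainOp_le (Q := Q) n hf hC
    have h2 := chainOp_le (Q := Q) m hm hb (c := chainOp Q n f y + θ ^ (n / l) * (2 * C))
      (fun z => by linarith [h1 z y]) x
    have h3 := le_chainOp (Q := Q) m hm hb (c := chainOp Q n f y - θ ^ (n / l) * (2 * C))
      (fun z => by linarith [h1 y z]) x
    exact abs_le.2 ⟨by linarith, by linarith⟩
  have hlim0 : Tendsto (fun n : ℕ => θ ^ (n / l) * (2 * C)) atTop (𝓝 0) := by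
    simpa using (tendsto_pow_div_atTop hθ0 hθ1 hl).mul_const (2 * C)
  have hcs : CauchySeq fun n => chainOp Q n f (basePoint d) := by
    refine cauchySeq_of_le_tendsto_0' (fun n => θ ^ (n / l) * (2 * C)) (fun n m hnm => ?_) hlim0
    obtain ⟨k, rfl⟩ := Nat.exists_eq_add_of_le' hnm
    rw [dist_comm, Real.dist_eq]
    exact hgap n k _ _
  obtain ⟨c, hc⟩ := cauchySeq_tendsto_of_complete hcs
  refine ⟨c, fun n x => ?_⟩
  have h1 : Tendsto (fun m => |chainOp Q (m + n) f (basePoint d) - chainOp Q n f x|) atTop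
      (𝓝 |c - chainOp Q n f x|) :=
    (((tendsto_add_atTop_iff_nat n).2 hc).sub_const _).abs
  rw [abs_sub_comm]
  exact le_of_tendsto' h1 fun m => hgap n m _ _

/-- A chain which contracts oscillations and is Feller at time `l` has an invariant law, to which
the laws of `x_n` converge exponentially fast in total variation. -/
lemma IsChain.exists_invariant (hQ : IsChain K Q) (hl : l ≠ 0) (hθ0 : 0 ≤ θ) (hθ1 : θ < 1)
    (hθ : ∀ f : Sph d → ℝ, Measurable f → ∀ D : ℝ, (∀ x y, f x - f y ≤ D) →
      ∀ x y, chainOp Q l f x - chainOp Q l f y ≤ θ * D)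
    (hfeller : ∀ f : Sph d → ℝ, Continuous f → Continuous (chainOp Q l f)) :
    ∃ π : Measure (Sph d), IsProbabilityMeasure π ∧
      ∀ f : Sph d → ℝ, Measurable f → ∀ C : ℝ, (∀ x, |f x| ≤ C) →
        (∫ x, f x ∂π = ∫ x, chainOp Q l f x ∂π) ∧
        ∀ n x, |chainOp Q n f x - ∫ y, f y ∂π| ≤ θ ^ (n / l) * (2 * C) := by
  have hprob : ∀ n, IsProbabilityMeasure ((Q (basePoint d)).map fun w => pathX (basePoint d) w n) :=
    fun n => Measure.isProbabilityMeasure_map (measurable_pathX_right _ _).aemeasurable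
  set μ : ℕ → ProbabilityMeasure (Sph d) := fun n => ⟨_, hprob n⟩ with hμ
  have hμint : ∀ n (f : Sph d → ℝ), Measurable f →
      ∫ x, f x ∂(μ n : Measure (Sph d)) = chainOp Q n f (basePoint d) := fun n f hf =>
    integral_map (measurable_pathX_right _ _).aemeasurable hf.aestronglyMeasurable
  -- a limit point of the laws of `x_n`, along an ultrafilter
  obtain ⟨π, hπ⟩ : ∃ π : ProbabilityMeasure (Sph d), Tendsto μ (hyperfilter ℕ : Filter ℕ) (𝓝 π) :=
    ⟨_, (Ultrafilter.map μ (hyperfilter ℕ)).le_nhds_lim⟩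
  have hle : (hyperfilter ℕ : Filter ℕ) ≤ atTop := Nat.hyperfilter_le_atTop
  have hlim0 : ∀ C : ℝ, Tendsto (fun n : ℕ => θ ^ (n / l) * (2 * C)) atTop (𝓝 0) := fun C => by
    simpa using (tendsto_pow_div_atTop hθ0 hθ1 hl).mul_const (2 * C)
  have hconv : ∀ {f : Sph d → ℝ} {C c : ℝ}, (∀ n x, |chainOp Q n f x - c| ≤ θ ^ (n / l) * (2 * C)) →
      ∀ x, Tendsto (fun n => chainOp Q n f x) atTop (𝓝 c) := fun {f C c} hc x => by
    rw [tendsto_iff_dist_tendsto_zero]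
    exact squeeze_zero (fun _ => dist_nonneg) (fun n => hc n x) (hlim0 C)
  have hcont : ∀ f : Sph d → ℝ, Continuous f → ∀ c C : ℝ,
      (∀ n x, |chainOp Q n f x - c| ≤ θ ^ (n / l) * (2 * C)) →
        ∫ x, f x ∂(π : Measure (Sph d)) = c := fun f hf c C hc => by
    have h1 := ProbabilityMeasure.tendsto_iff_forall_integral_tendsto.1 hπ
      (BoundedContinuousFunction.mkOfCompact ⟨f, hf⟩)
    refine tendsto_nhds_unique h1 (Tendsto.mono_left ?_ hle)
    refine (hconv hc (basePoint d)).congr fun n => ?_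
    exact (hμint n f hf.measurable).symm
  have hbind : ∀ f : Sph d → ℝ, Measurable f → ∀ C : ℝ, (∀ x, |f x| ≤ C) →
      ∫ x, f x ∂(((π : Measure (Sph d)) ⊗ₘ Q).map fun p => pathX p.1 p.2 l) =
        ∫ x, chainOp Q l f x ∂(π : Measure (Sph d)) := fun f hf C hC => by
    have hi : Integrable (fun p => f (pathX p.1 p.2 l)) ((π : Measure (Sph d)) ⊗ₘ Q) :=
      Integrable.of_bound (hf.comp (measurable_pathX l)).aestronglyMeasurable C
        (ae_of_all _ fun _ => hC _)
    rw [integral_map (measurable_pathX l).aemeasurable hf.aestronglyMeasurable,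
      Measure.integral_compProd hi]
    rfl
  -- The limit law is only known to give the limits of `E f(x_n)` for continuous `f`. Invariance
  -- under the transition by `l` steps extends this to measurable `f`.
  have hinv : ((π : Measure (Sph d)) ⊗ₘ Q).map (fun p => pathX p.1 p.2 l) = π := by
    have : IsProbabilityMeasure (((π : Measure (Sph d)) ⊗ₘ Q).map fun p => pathX p.1 p.2 l) :=
      Measure.isProbabilityMeasure_map (measurable_pathX l).aemeasurable
    refine ext_of_forall_integral_eq_of_IsFiniteMeasure fun f => ?_
    have hfm := f.continuous.measurable
    obtain ⟨c, hc⟩ := hQ.exists_chainOp_limit hl hθ0 hθ1 hθ hfm f.norm_coe_le_norm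
    rw [hbind f hfm _ f.norm_coe_le_norm, hcont f f.continuous c _ hc]
    obtain ⟨c', hc'⟩ := hQ.exists_chainOp_limit hl hθ0 hθ1 hθ (measurable_chainOp l hfm)
      (abs_chainOp_le (Q := Q) l hfm f.norm_coe_le_norm)
    rw [hcont _ (hfeller f f.continuous) c' _ hc']
    have h1 := hconv hc' (basePoint d)
    simp only [← hQ.chainOp_add _ l hfm f.norm_coe_le_norm] at h1
    exact tendsto_nhds_unique h1 ((tendsto_add_atTop_iff_nat l).2 (hconv hc (basePoint d)))
  have hinv' : ∀ f : Sph d → ℝ, Measurable f → ∀ C : ℝ, (∀ x, |f x| ≤ C) →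
      ∫ x, f x ∂(π : Measure (Sph d)) = ∫ x, chainOp Q l f x ∂(π : Measure (Sph d)) :=
    fun f hf C hC => by
      rw [← hbind f hf C hC, hinv]
  refine ⟨π, inferInstance, fun f hf C hC => ⟨hinv' f hf C hC, ?_⟩⟩
  obtain ⟨c, hc⟩ := hQ.exists_chainOp_limit hl hθ0 hθ1 hθ hf hC
  suffices hfc : ∫ x, f x ∂(π : Measure (Sph d)) = c by rwa [hfc]
  have hiter : ∀ k, ∫ x, f x ∂(π : Measure (Sph d)) =
      ∫ x, chainOp Q (l * k) f x ∂(π : Measure (Sph d)) := by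
    intro k
    induction k with
    | zero => simp [chainOp, pathX]
    | succ k ih =>
      rw [ih, hinv' _ (measurable_chainOp _ hf) C (abs_chainOp_le _ hf hC)]
      refine integral_congr_ae (ae_of_all _ fun x => ?_)
      rw [← hQ.chainOp_add l _ hf hC, mul_add, mul_one, add_comm]
  have hk : ∀ k, |∫ x, f x ∂(π : Measure (Sph d)) - c| ≤ θ ^ k * (2 * C) := by
    intro k
    have hi : Integrable (chainOp Q (l * k) f) (π : Measure (Sph d)) :=
      Integrable.of_bound (measurable_chainOp _ hf).aestronglyMeasurable C
        (ae_of_all _ (abs_chainOp_le _ hf hC))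
    have h1 : ∫ x, f x ∂(π : Measure (Sph d)) - c =
        ∫ x, (chainOp Q (l * k) f x - c) ∂(π : Measure (Sph d)) := by
      rw [integral_sub hi (integrable_const c), ← hiter k]
      simp
    rw [h1, ← Real.norm_eq_abs]
    refine (norm_integral_le_of_norm_le_const (C := θ ^ k * (2 * C))
        (ae_of_all _ fun x => ?_)).trans
      (by simp)
    have := hc (l * k) x
    rwa [Nat.mul_div_cancel_left _ (Nat.pos_of_ne_zero hl)] at this
  have hz : |∫ x, f x ∂(π : Measure (Sph d)) - c| ≤ 0 := by
    refine ge_of_tendsto' (x := atTop) (f := fun k : ℕ => θ ^ k * (2 * C)) ?_ hk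
    simpa using (tendsto_pow_atTop_nhds_zero_of_lt_one hθ0 hθ1).mul_const (2 * C)
  exact sub_eq_zero.1 (abs_nonpos_iff.1 hz)

end Chain

open scoped Pointwise in
/-- A set of directions is null for the surface measure iff the cone over it is null. -/
lemma toSphere_eq_zero_iff_cone {A : Set (Sph d)} (hA : MeasurableSet A) :
    (volume : Measure (EuclideanSpace ℝ (Fin (d + 1)))).toSphere A = 0 ↔
      volume {z : EuclideanSpace ℝ (Fin (d + 1)) | z ≠ 0 ∧ direction (basePoint d) z ∈ A} = 0 := by
  rw [Measure.toSphere_apply' _ hA, mul_eq_zero, or_iff_right (by simp)]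
  constructor
  · intro h0
    have hcov : {z : EuclideanSpace ℝ (Fin (d + 1)) | z ≠ 0 ∧ direction (basePoint d) z ∈ A} ⊆
        ⋃ n : ℕ, ((n : ℝ) + 1) • (Set.Ioo (0 : ℝ) 1 •
          ((↑) '' A : Set (EuclideanSpace ℝ (Fin (d + 1))))) := by
      rintro z ⟨hz, hzA⟩
      obtain ⟨n, hn⟩ := exists_nat_gt ‖z‖
      have hn1 : (0 : ℝ) < (n : ℝ) + 1 := by positivity
      refine Set.mem_iUnion.2 ⟨n, Set.mem_smul_set.2 ⟨(‖z‖ / ((n : ℝ) + 1)) •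
        (direction (basePoint d) z : EuclideanSpace ℝ (Fin (d + 1))), ?_, ?_⟩⟩
      · refine Set.smul_mem_smul ⟨div_pos (norm_pos_iff.2 hz) hn1, ?_⟩ ⟨_, hzA, rfl⟩
        rw [div_lt_one hn1]
        linarith
      · rw [smul_smul, mul_div_cancel₀ _ hn1.ne', norm_smul_direction]
    refine measure_mono_null hcov (measure_iUnion_null fun n => ?_)
    rw [Measure.addHaar_smul, h0, mul_zero]
  · refine fun h0 => measure_mono_null ?_ h0
    intro z hz
    obtain ⟨r, hr, _, ⟨y, hy, rfl⟩, rfl⟩ := Set.mem_smul.1 hz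
    refine ⟨smul_ne_zero hr.1.ne' (ne_zero_of_mem_unit_sphere y), ?_⟩
    rwa [direction_smul _ hr.1, direction_coe]

section Omega

variable {Ω : Type*} {η : ℕ → Fin (d + 1) → Ω → ℝ} [MeasurableSpace Ω] {P : Measure Ω}
  [IsProbabilityMeasure P] {lam : ℝ} {h : Sph d → ℝ} {Q : Kernel (Sph d) (ℕ → Sph d × ℝ)}

lemma IsTiltedLaw.chainOp_eq_zero_iff (hQ : IsTiltedLaw a σ η P lam h Q)
    (N : IsNoise η P ρ) (H : NoiseLaw a σ ρ) (hlam : 0 < lam) (T : IsFixedTilt a σ ρ lam h) {l : ℕ}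
    (hl : 4 * d + 2 ≤ l) {A : Set (Sph d)} (hA : MeasurableSet A) (x : Sph d) :
    chainOp Q l (A.indicator 1) x = 0 ↔
      (volume : Measure (EuclideanSpace ℝ (Fin (d + 1)))).toSphere A = 0 := by
  have h1 := hQ.integral_eq_zero_iff N H hlam T hl (G := fun p => A.indicator 1 p.1) (B := 1)
    ((measurable_one.indicator hA).comp measurable_fst)
    (fun p => Set.indicator_nonneg (fun _ _ => zero_le_one) _) (fun p => by
      by_cases hp : p.1 ∈ A <;> simp [hp]) x
  refine h1.trans ?_
  rw [toSphere_eq_zero_iff_cone hA, ae_iff]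
  have h2 : {z | ¬ tiltLift lam h (fun p => A.indicator 1 p.1) z = 0} =
      {z : EuclideanSpace ℝ (Fin (d + 1)) | z ≠ 0 ∧ direction (basePoint d) z ∈ A} := by
    ext z
    simp only [Set.mem_ofPred_eq, tiltLift, mul_eq_zero, not_or, (T.pos _).ne', not_false_eq_true,
      true_and, Set.indicator_apply_eq_zero, Pi.one_apply, one_ne_zero, imp_false, not_not,
      Real.rpow_eq_zero (norm_nonneg z) hlam.ne', norm_eq_zero, ne_eq]
  rw [h2]

/-- The tilted chain converges exponentially fast in total variation to an invariant law, which is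
equivalent to the surface measure because all laws of `x_l` are. -/
theorem IsTiltedLaw.exists_invariant (hQ : IsTiltedLaw a σ η P lam h Q)
    (N : IsNoise η P ρ) (H : NoiseLaw a σ ρ) (hlam : 0 < lam) (T : IsFixedTilt a σ ρ lam h) :
    ∃ (π : Measure (Sph d)) (l : ℕ) (θ : ℝ), IsProbabilityMeasure π ∧ l ≠ 0 ∧ 0 ≤ θ ∧ θ < 1 ∧
      π ≪ (volume : Measure (EuclideanSpace ℝ (Fin (d + 1)))).toSphere ∧
      (volume : Measure (EuclideanSpace ℝ (Fin (d + 1)))).toSphere ≪ π ∧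
      ∀ f : Sph d → ℝ, Measurable f → ∀ C : ℝ, (∀ x, |f x| ≤ C) →
        ∀ n x, |chainOp Q n f x - ∫ y, f y ∂π| ≤ θ ^ (n / l) * (2 * C) := by
  have := hQ.isMarkov
  obtain ⟨K, hK, hKQ⟩ := hQ.exists_isChain N H hlam.le T
  set l := 4 * d + 2 with hl
  obtain ⟨θ, hθ0, hθ1, hθ⟩ := hQ.exists_contraction N H hlam T (l := l) le_rfl
  have hfeller : ∀ f : Sph d → ℝ, Continuous f → Continuous (chainOp Q l f) := fun f hf => by
    obtain ⟨C, hC⟩ := isCompact_univ.exists_bound_of_continuousOn hf.continuousOn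
    exact hQ.continuous_integral N H hlam.le T l
      (f := fun u => f (u ⟨l - 1, by omega⟩).1) (by fun_prop) (fun u => hC _ (Set.mem_univ _))
  obtain ⟨π, hπ, hinv⟩ := hKQ.exists_invariant (by omega) hθ0 hθ1 hθ hfeller
  have hind : ∀ (A : Set (Sph d)) x, |A.indicator (1 : Sph d → ℝ) x| ≤ 1 := fun A x => by
    by_cases hx : x ∈ A <;> simp [hx]
  have hval : ∀ A : Set (Sph d), MeasurableSet A →
      (π A = 0 ↔ ∫ x, chainOp Q l (A.indicator 1) x ∂π = 0) := fun A hA => by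
    rw [← (hinv _ (measurable_one.indicator hA) 1 (hind A)).1, integral_indicator_one hA,
      measureReal_eq_zero_iff]
  refine ⟨π, l, θ, hπ, by omega, hθ0, hθ1, ?_, ?_, fun f hf C hC => (hinv f hf C hC).2⟩
  · refine Measure.AbsolutelyContinuous.mk fun A hA hA0 => ?_
    rw [hval A hA]
    have h1 : ∀ x, chainOp Q l (A.indicator 1) x = 0 := fun x =>
      (hQ.chainOp_eq_zero_iff N H hlam T le_rfl hA x).2 hA0
    simp [h1]
  · refine Measure.AbsolutelyContinuous.mk fun A hA hA0 => ?_
    rw [hval A hA] at hA0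
    have hm := measurable_one (α := ℝ).indicator hA
    have h0 : ∀ x, 0 ≤ chainOp Q l (A.indicator 1) x := fun x =>
      integral_nonneg fun w => Set.indicator_nonneg (fun _ _ => zero_le_one) _
    have hi : Integrable (chainOp Q l (A.indicator 1)) π :=
      Integrable.of_bound (measurable_chainOp l hm).aestronglyMeasurable 1
        (ae_of_all _ (abs_chainOp_le l hm (hind A)))
    have hae := (integral_eq_zero_iff_of_nonneg h0 hi).1 hA0
    obtain ⟨x, hx⟩ := hae.exists
    exact (hQ.chainOp_eq_zero_iff N H hlam T le_rfl hA x).1 hx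

/-- Convergence in total variation, in terms of `tvDist`. -/
lemma tendsto_tvDist {Q : Kernel (Sph d) (ℕ → Sph d × ℝ)} [IsMarkovKernel Q] {π : Measure (Sph d)}
    {l : ℕ} {θ : ℝ} (hl : l ≠ 0) (hθ0 : 0 ≤ θ) (hθ1 : θ < 1)
    (hconv : ∀ f : Sph d → ℝ, Measurable f → ∀ C : ℝ, (∀ x, |f x| ≤ C) →
        ∀ n x, |chainOp Q n f x - ∫ y, f y ∂π| ≤ θ ^ (n / l) * (2 * C)) (x : Sph d) :
    Tendsto (fun n : ℕ => tvDist ((Q x).map fun w => pathX x w n) π) atTop (𝓝 0) := by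
  have hlim0 : Tendsto (fun n : ℕ => θ ^ (n / l) * (2 * 1)) atTop (𝓝 0) := by
    simpa using (tendsto_pow_div_atTop hθ0 hθ1 hl).mul_const (2 * 1 : ℝ)
  have hb : ∀ n, ∀ r ∈ {r : ℝ | ∃ f : Sph d → ℝ, Measurable f ∧ (∀ y, |f y| ≤ 1) ∧
      r = ∫ y, f y ∂((Q x).map fun w => pathX x w n) - ∫ y, f y ∂π}, r ≤ θ ^ (n / l) * (2 * 1) := by
    rintro n r ⟨f, hf, hf1, rfl⟩
    rw [integral_map (measurable_pathX_right x n).aemeasurable hf.aestronglyMeasurable]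
    exact (le_abs_self _).trans (hconv f hf 1 hf1 n x)
  refine squeeze_zero (fun n => ?_) (fun n => ?_) hlim0
  · exact le_csSup ⟨_, hb n⟩ ⟨fun _ => 0, measurable_const, by simp, by simp⟩
  · exact csSup_le ⟨_, ⟨fun _ => 0, measurable_const, by simp, rfl⟩⟩ (hb n)

end Omega

end RCA

namespace RCA
variable {d : ℕ} {a σ : Fin (d + 1) → ℝ} {ρ : Measure ℝ}

/-! ### The law of large numbers -/

lemma ae_tendsto_zero_of_lintegral_le {X : Type*} [MeasurableSpace X] {μ : Measure X}
    {Z : ℕ → X → ℝ} (hZ : ∀ n, Measurable (Z n)) (h0 : ∀ n x, 0 ≤ Z n x) {c : ℕ → ℝ}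
    (hc : Summable c) (hle : ∀ n, ∫⁻ x, ENNReal.ofReal (Z n x) ∂μ ≤ ENNReal.ofReal (c n)) :
    ∀ᵐ x ∂μ, Tendsto (fun n => Z n x) atTop (𝓝 0) := by
  have hm : ∀ n, Measurable fun x => ENNReal.ofReal (Z n x) := fun n => (hZ n).ennreal_ofReal
  have h1 : ∫⁻ x, ∑' n, ENNReal.ofReal (Z n x) ∂μ ≠ ⊤ := by
    rw [lintegral_tsum fun n => (hm n).aemeasurable]
    exact ne_top_of_le_ne_top hc.tsum_ofReal_ne_top (ENNReal.tsum_le_tsum hle)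
  filter_upwards [ae_lt_top (Measurable.tsum hm) h1] with x hx
  have h2 := (ENNReal.tendsto_toReal ENNReal.zero_ne_top).comp
    (ENNReal.tendsto_atTop_zero_of_tsum_ne_top hx.ne)
  simpa [Function.comp_def, ENNReal.toReal_ofReal (h0 _ x)] using h2

/-- A strong law of large numbers under second moment bounds: along squares by summability of the
second moments, and between squares by a crude bound. -/
lemma ae_tendsto_sum_div_zero {X : Type*} [MeasurableSpace X] {μ : Measure X} {Y : ℕ → X → ℝ}
    (hY : ∀ k, Measurable (Y k)) {C : ℝ} (hC : 0 ≤ C)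
    (hY2 : ∀ k, ∫⁻ x, ENNReal.ofReal (Y k x ^ 2) ∂μ ≤ ENNReal.ofReal C)
    (hS : ∀ n : ℕ, ∫⁻ x, ENNReal.ofReal ((∑ k ∈ Finset.range n, Y k x) ^ 2) ∂μ ≤
      ENNReal.ofReal (C * n)) :
    ∀ᵐ x ∂μ, Tendsto (fun n : ℕ => (∑ k ∈ Finset.range n, Y k x) / n) atTop (𝓝 0) := by
  have hsum : ∀ c : ℝ, Summable fun n : ℕ => c * (1 / (n : ℝ) ^ 2) := fun c =>
    (Real.summable_one_div_nat_pow.2 one_lt_two).mul_left c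
  have hSm : ∀ n, Measurable fun x => ∑ k ∈ Finset.range n, Y k x := fun n =>
    Finset.measurable_sum _ fun k _ => hY k
  have hAm : ∀ n m, Measurable fun x => ∑ j ∈ Finset.range m, |Y (n + j) x| := fun n m =>
    Finset.measurable_sum _ fun k _ => (hY _).abs
  have h1 := ae_tendsto_zero_of_lintegral_le (μ := μ)
    (Z := fun n x => ((∑ k ∈ Finset.range (n ^ 2), Y k x) / (n : ℝ) ^ 2) ^ 2)
    (fun n => ((hSm _).div_const _).pow_const 2) (fun n x => sq_nonneg _) (hsum C) (fun n => by
      have h2 : ∀ x, ENNReal.ofReal (((∑ k ∈ Finset.range (n ^ 2), Y k x) / (n : ℝ) ^ 2) ^ 2) =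
          ENNReal.ofReal (1 / ((n : ℝ) ^ 2) ^ 2) *
            ENNReal.ofReal ((∑ k ∈ Finset.range (n ^ 2), Y k x) ^ 2) := fun x => by
        rw [← ENNReal.ofReal_mul (by positivity)]
        congr 1
        ring
      simp only [h2]
      rw [lintegral_const_mul _ ((hSm _).pow_const 2).ennreal_ofReal]
      refine (mul_le_mul_right (hS _) _).trans ?_
      rw [← ENNReal.ofReal_mul (by positivity)]
      refine ENNReal.ofReal_le_ofReal (le_of_eq ?_)
      rcases Nat.eq_zero_or_pos n with rfl | hn
      · simp
      · push_cast
        field_simp)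
  have h2 := ae_tendsto_zero_of_lintegral_le (μ := μ)
    (Z := fun n x => ((∑ j ∈ Finset.range (2 * n + 1), |Y (n ^ 2 + j) x|) / (n : ℝ) ^ 2) ^ 2)
    (fun n => ((hAm _ _).div_const _).pow_const 2) (fun n x => sq_nonneg _) (hsum (9 * C))
    (fun n => by
      have h3 : ∀ x, ENNReal.ofReal
          (((∑ j ∈ Finset.range (2 * n + 1), |Y (n ^ 2 + j) x|) / (n : ℝ) ^ 2) ^ 2) ≤
          ENNReal.ofReal ((2 * n + 1) / ((n : ℝ) ^ 2) ^ 2) *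
            ∑ j ∈ Finset.range (2 * n + 1), ENNReal.ofReal (Y (n ^ 2 + j) x ^ 2) := fun x => by
        rw [← ENNReal.ofReal_sum_of_nonneg fun _ _ => sq_nonneg _,
          ← ENNReal.ofReal_mul (by positivity)]
        refine ENNReal.ofReal_le_ofReal ?_
        have h4 := sq_sum_le_card_mul_sum_sq (s := Finset.range (2 * n + 1))
          (f := fun j => |Y (n ^ 2 + j) x|)
        simp only [Finset.card_range, sq_abs] at h4
        push_cast at h4
        rw [div_pow, div_mul_eq_mul_div]
        exact div_le_div_of_nonneg_right h4 (by positivity)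
      refine (lintegral_mono h3).trans ?_
      rw [lintegral_const_mul _ (Finset.measurable_sum _ fun j _ =>
        ((hY _).pow_const 2).ennreal_ofReal),
        lintegral_finsetSum _ fun j _ => ((hY _).pow_const 2).ennreal_ofReal]
      refine (mul_le_mul_right (Finset.sum_le_card_nsmul _ _ _ fun j _ => hY2 _) _).trans ?_
      rw [Finset.card_range, nsmul_eq_mul, ← ENNReal.ofReal_natCast,
        ← ENNReal.ofReal_mul (by positivity), ← ENNReal.ofReal_mul (by positivity)]
      refine ENNReal.ofReal_le_ofReal ?_
      rcases Nat.eq_zero_or_pos n with rfl | hn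
      · simp
      · have hn1 : (1 : ℝ) ≤ n := by exact_mod_cast hn
        have h5 : (2 * (n : ℝ) + 1) * (2 * n + 1) ≤ 9 * (n : ℝ) ^ 2 := by nlinarith
        push_cast
        rw [div_mul_eq_mul_div, ← mul_assoc, mul_one_div, div_le_div_iff₀ (by positivity)
          (by positivity)]
        have h6 : 0 ≤ C * (n : ℝ) ^ 2 := by positivity
        nlinarith [mul_le_mul_of_nonneg_right h5 h6])
  filter_upwards [h1, h2] with x hx1 hx2
  have hx1' : Tendsto (fun n : ℕ => |(∑ k ∈ Finset.range (n ^ 2), Y k x) / (n : ℝ) ^ 2|) atTop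
      (𝓝 0) := by
    have := hx1.sqrt
    simpa [Real.sqrt_sq_eq_abs] using this
  have hx2' : Tendsto (fun n : ℕ =>
      |(∑ j ∈ Finset.range (2 * n + 1), |Y (n ^ 2 + j) x|) / (n : ℝ) ^ 2|) atTop (𝓝 0) := by
    have := hx2.sqrt
    simpa [Real.sqrt_sq_eq_abs] using this
  have hsqrt : Tendsto Nat.sqrt atTop atTop :=
    tendsto_atTop_atTop.2 fun b => ⟨b * b, fun k hk => Nat.le_sqrt.2 hk⟩
  have hlim := (hx1'.add hx2').comp hsqrt
  rw [add_zero] at hlim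
  refine squeeze_zero_norm' ?_ hlim
  filter_upwards [eventually_ge_atTop 1] with k hk
  -- `k` lies between the squares of `n` and `n + 1`, and the terms between them are bounded by the
  -- sum of their absolute values.
  set n := Nat.sqrt k with hn
  have hn1 : 1 ≤ n := Nat.le_sqrt.2 (by simpa using hk)
  have hle : n ^ 2 ≤ k := Nat.sqrt_le' k
  have hlt : k ≤ n ^ 2 + (2 * n + 1) := by
    have := Nat.lt_succ_sqrt' k
    rw [← hn] at this
    nlinarith
  obtain ⟨j, hkj⟩ := Nat.exists_eq_add_of_le hle
  have hj : j ≤ 2 * n + 1 := by omega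
  have hnpos : (0 : ℝ) < (n : ℝ) ^ 2 := by positivity
  have hnk : (n : ℝ) ^ 2 ≤ (k : ℝ) := by exact_mod_cast hle
  have hr : Finset.range k = Finset.range (n ^ 2 + j) := by rw [← hkj]
  have h3 : |∑ k ∈ Finset.range k, Y k x| ≤ |∑ k ∈ Finset.range (n ^ 2), Y k x| +
      ∑ i ∈ Finset.range (2 * n + 1), |Y (n ^ 2 + i) x| := by
    rw [hr, Finset.sum_range_add]
    refine (abs_add_le _ _).trans (add_le_add le_rfl ((Finset.abs_sum_le_sum_abs _ _).trans ?_))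
    exact Finset.sum_le_sum_of_subset_of_nonneg (Finset.range_mono hj) fun _ _ _ => abs_nonneg _
  have h4 : 0 ≤ ∑ i ∈ Finset.range (2 * n + 1), |Y (n ^ 2 + i) x| :=
    Finset.sum_nonneg fun _ _ => abs_nonneg _
  change ‖_ / _‖ ≤ |(∑ k ∈ Finset.range (n ^ 2), Y k x) / (n : ℝ) ^ 2| +
    |(∑ j ∈ Finset.range (2 * n + 1), |Y (n ^ 2 + j) x|) / (n : ℝ) ^ 2|
  rw [Real.norm_eq_abs, abs_div, abs_div, abs_div, abs_of_pos hnpos, abs_of_nonneg h4, ← add_div,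
    abs_of_pos (hnpos.trans_le hnk)]
  exact div_le_div₀ (add_nonneg (abs_nonneg _) h4) h3 hnpos hnk

lemma sum_pow_div_le {θ : ℝ} (h0 : 0 ≤ θ) (h1 : θ < 1) {l : ℕ} (hl : l ≠ 0) (n : ℕ) :
    ∑ k ∈ Finset.range n, θ ^ (k / l) ≤ l * (1 - θ)⁻¹ := by
  have hlpos : 0 < l := Nat.pos_of_ne_zero hl
  have h2 : ∀ m, ∑ k ∈ Finset.range (l * m), θ ^ (k / l) =
      l * ∑ j ∈ Finset.range m, θ ^ j := by
    intro m
    induction m with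
    | zero => simp
    | succ m ih =>
      rw [mul_add, mul_one, Finset.sum_range_add, ih, Finset.sum_range_succ, mul_add]
      congr 1
      have h3 : ∀ i ∈ Finset.range l, θ ^ ((l * m + i) / l) = θ ^ m := fun i hi => by
        rw [Nat.mul_add_div hlpos, Nat.div_eq_of_lt (Finset.mem_range.1 hi), add_zero]
      rw [Finset.sum_congr rfl h3]
      simp
  calc ∑ k ∈ Finset.range n, θ ^ (k / l) ≤ ∑ k ∈ Finset.range (l * n), θ ^ (k / l) :=
        Finset.sum_le_sum_of_subset_of_nonneg (Finset.range_mono (Nat.le_mul_of_pos_left n hlpos))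
          fun _ _ _ => pow_nonneg h0 _
    _ = l * ∑ j ∈ Finset.range n, θ ^ j := h2 n
    _ ≤ l * (1 - θ)⁻¹ := by
        refine mul_le_mul_of_nonneg_left ?_ (Nat.cast_nonneg _)
        rw [← tsum_geometric_of_lt_one h0 h1]
        exact (summable_geometric_of_lt_one h0 h1).sum_le_tsum _ fun _ _ => pow_nonneg h0 _

section Chain

variable {K : Kernel (Sph d) (Sph d × ℝ)} [IsMarkovKernel K]
  {Q : Kernel (Sph d) (ℕ → Sph d × ℝ)} [IsMarkovKernel Q]

lemma IsChain.lintegral_incr_sq_le (hQ : IsChain K Q) {B : ℝ}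
    (hB : ∀ x, ∫⁻ w, ENNReal.ofReal ((w 0).2 ^ 2) ∂(Q x) ≤ ENNReal.ofReal B) (x : Sph d) (k : ℕ) :
    ∫⁻ w, ENNReal.ofReal ((w k).2 ^ 2) ∂(Q x) ≤ ENNReal.ofReal B := by
  have h1 := hQ.lintegral_markov x k (F := fun q => ENNReal.ofReal ((q.2 0).2 ^ 2)) (by fun_prop)
  simp only [add_zero] at h1
  rw [h1]
  refine (lintegral_mono fun w => hB _).trans ?_
  simp

lemma IsChain.memLp_incr (hQ : IsChain K Q) {B : ℝ}
    (hB : ∀ x, ∫⁻ w, ENNReal.ofReal ((w 0).2 ^ 2) ∂(Q x) ≤ ENNReal.ofReal B) (x : Sph d) (k : ℕ) :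
    MemLp (fun w : ℕ → Sph d × ℝ => (w k).2) 2 (Q x) := by
  have hm : Measurable fun w : ℕ → Sph d × ℝ => (w k).2 := by fun_prop
  rw [memLp_two_iff_integrable_sq hm.aestronglyMeasurable]
  refine (lintegral_ofReal_ne_top_iff_integrable (hm.pow_const 2).aestronglyMeasurable
    (ae_of_all _ fun w => sq_nonneg _)).1 ?_
  exact ne_top_of_le_ne_top ENNReal.ofReal_ne_top (hQ.lintegral_incr_sq_le hB x k)

/-- The variance of `v_n` grows at most linearly, for a chain with uniformly bounded second moments
of the increments that forgets its starting point exponentially fast. -/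
lemma IsChain.exists_integral_sq_le (hQ : IsChain K Q) {B : ℝ} (hB0 : 0 ≤ B)
    (hB : ∀ x, ∫⁻ w, ENNReal.ofReal ((w 0).2 ^ 2) ∂(Q x) ≤ ENNReal.ofReal B)
    {π : Measure (Sph d)} {l : ℕ} {θ : ℝ} (hl : l ≠ 0) (hθ0 : 0 ≤ θ) (hθ1 : θ < 1)
    (hconv : ∀ f : Sph d → ℝ, Measurable f → ∀ C : ℝ, (∀ x, |f x| ≤ C) →
        ∀ n x, |chainOp Q n f x - ∫ y, f y ∂π| ≤ θ ^ (n / l) * (2 * C)) :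
    ∃ β C : ℝ, 0 ≤ C ∧ ∀ (n : ℕ) x, ∫ w, (pathV w n - n * β) ^ 2 ∂(Q x) ≤ C * n := by
  have hsq : ∀ x, ∫ w, (w 0).2 ^ 2 ∂(Q x) ≤ B := fun x => by
    rw [integral_eq_lintegral_of_nonneg_ae (ae_of_all _ fun w => sq_nonneg _)
      (by fun_prop : Measurable fun w : ℕ → Sph d × ℝ => (w 0).2 ^ 2).aestronglyMeasurable]
    exact ENNReal.toReal_le_of_le_ofReal hB0 (hB x)
  have hint : ∀ x k, Integrable (fun w : ℕ → Sph d × ℝ => (w k).2) (Q x) := fun x k =>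
    (hQ.memLp_incr hB x k).integrable (by norm_num)
  set g : Sph d → ℝ := fun x => ∫ w, (w 0).2 ∂(Q x) with hg
  have hgm : Measurable g := by
    have h1 : Measurable fun p : Sph d × (ℕ → Sph d × ℝ) => (p.2 0).2 := by fun_prop
    exact (h1.stronglyMeasurable.integral_kernel_prod_right' (κ := Q)).measurable
  have hgb : ∀ x, |g x| ≤ 1 + B := fun x => by
    rw [← Real.norm_eq_abs]
    refine (norm_integral_le_integral_norm _).trans ?_
    have h1 : ∫ w, ‖(w 0).2‖ ∂(Q x) ≤ ∫ w, (1 + (w 0).2 ^ 2) ∂(Q x) := by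
      refine integral_mono (hint x 0).norm
        ((integrable_const 1).add (hQ.memLp_incr hB x 0).integrable_sq) fun w => ?_
      simp only [Real.norm_eq_abs]
      nlinarith [sq_abs (w 0).2, sq_nonneg (|(w 0).2| - 1), abs_nonneg (w 0).2]
    rw [integral_add (integrable_const 1) (hQ.memLp_incr hB x 0).integrable_sq] at h1
    have h2 := hsq x
    simp only [integral_const, probReal_univ, smul_eq_mul, mul_one] at h1
    linarith
  have hmean : ∀ x k, ∫ w, (w k).2 ∂(Q x) = chainOp Q k g x := fun x k => by
    have h1 := hQ.integral_markov x k (F := fun q => (q.2 0).2) (by fun_prop)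
      (by simpa using hint x k)
    simp only [add_zero] at h1
    exact h1
  set β := ∫ y, g y ∂π with hβ
  set A := l * (1 - θ)⁻¹ * (2 * (1 + B)) with hA
  have hA0 : 0 ≤ A := by
    have : 0 ≤ (1 - θ)⁻¹ := inv_nonneg.2 (by linarith)
    positivity
  have hVm : ∀ n, Measurable fun w : ℕ → Sph d × ℝ => pathV w n := measurable_pathV
  have hVL : ∀ x (n : ℕ), MemLp (fun w : ℕ → Sph d × ℝ => pathV w n - n * β) 2 (Q x) := fun x n =>
    (memLp_finsetSum _ fun k _ => hQ.memLp_incr hB x k).sub (memLp_const _)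
  -- The means `E v_n - n β` are bounded, uniformly in the starting point, since the deviations of
  -- `E u_k` from `β` are summable.
  have hm : ∀ (n : ℕ) x, |∫ w, (pathV w n - n * β) ∂(Q x)| ≤ A := fun n x => by
    have h1 : ∫ w, (pathV w n - n * β) ∂(Q x) =
        ∑ k ∈ Finset.range n, (chainOp Q k g x - β) := by
      have hVi : Integrable (fun w : ℕ → Sph d × ℝ => pathV w n) (Q x) :=
        integrable_finsetSum _ fun k _ => hint x k
      rw [integral_sub hVi (integrable_const _)]
      simp only [pathV]
      rw [integral_finsetSum _ fun k _ => hint x k]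
      simp [hmean]
    rw [h1]
    refine (Finset.abs_sum_le_sum_abs _ _).trans ?_
    refine (Finset.sum_le_sum fun k _ => hconv g hgm (1 + B) hgb k x).trans ?_
    rw [← Finset.sum_mul]
    exact mul_le_mul_of_nonneg_right (sum_pow_div_le hθ0 hθ1 hl n) (by positivity)
  set B' := 2 * B + 2 * β ^ 2 with hB'
  have hY : ∀ x, ∫ w, ((w 0).2 - β) ^ 2 ∂(Q x) ≤ B' := fun x => by
    have h1 : ∫ w, ((w 0).2 - β) ^ 2 ∂(Q x) ≤ ∫ w, (2 * (w 0).2 ^ 2 + 2 * β ^ 2) ∂(Q x) := by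
      refine integral_mono ((hQ.memLp_incr hB x 0).sub (memLp_const β)).integrable_sq
        (((hQ.memLp_incr hB x 0).integrable_sq.const_mul 2).add (integrable_const _)) fun w => ?_
      simp only
      nlinarith [sq_nonneg ((w 0).2 + β)]
    rw [integral_add ((hQ.memLp_incr hB x 0).integrable_sq.const_mul 2) (integrable_const _),
      integral_const_mul] at h1
    simp only [integral_const, probReal_univ, smul_eq_mul, one_mul] at h1
    linarith [hsq x]
  have hC0 : 0 ≤ B' * (1 + A) + A := by positivity
  refine ⟨β, B' * (1 + A) + A, hC0, fun n => ?_⟩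
  induction n with
  | zero => intro x; simp [pathV]
  | succ n ih =>
    intro x
    have hF : Measurable fun q : (Fin 1 → Sph d × ℝ) × (ℕ → Sph d × ℝ) =>
        ((q.1 0).2 - β + (pathV q.2 n - n * β)) ^ 2 := by
      have : Measurable fun q : (Fin 1 → Sph d × ℝ) × (ℕ → Sph d × ℝ) => pathV q.2 n :=
        (hVm n).comp measurable_snd
      exact ((by fun_prop : Measurable fun q : (Fin 1 → Sph d × ℝ) × (ℕ → Sph d × ℝ) =>
        (q.1 0).2 - β).add (this.sub_const _)).pow_const 2
    have hs : ∀ w : ℕ → Sph d × ℝ, (w 0).2 - β + (pathV (fun k => w (1 + k)) n - n * β) =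
        pathV w (n + 1) - (n + 1 : ℕ) * β := fun w => by
      simp only [pathV, Finset.sum_range_succ']
      push_cast
      simp only [add_comm 1]
      ring
    have h1 := hQ.integral_markov x 1 hF (by
      simp only [Fin.val_zero, hs]
      exact (hVL x (n + 1)).integrable_sq)
    simp only [Fin.val_zero, hs] at h1
    rw [h1]
    have hyL : Integrable (fun w : ℕ → Sph d × ℝ => (1 + A) * ((w 0).2 - β) ^ 2) (Q x) :=
      ((hQ.memLp_incr hB x 0).sub (memLp_const β)).integrable_sq.const_mul _
    -- Conditionally on the first step, the cross term is controlled by the bound on the means.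
    have h2 : ∀ w : ℕ → Sph d × ℝ,
        ∫ w', ((w 0).2 - β + (pathV w' n - n * β)) ^ 2 ∂(Q (pathX x w 1)) ≤
          (1 + A) * ((w 0).2 - β) ^ 2 + (A + (B' * (1 + A) + A) * n) := fun w => by
      set y := (w 0).2 - β with hy
      set z := pathX x w 1 with hz
      have h3 : ∀ w' : ℕ → Sph d × ℝ, (y + (pathV w' n - n * β)) ^ 2 =
          y ^ 2 + 2 * y * (pathV w' n - n * β) + (pathV w' n - n * β) ^ 2 := fun w' => by ring
      simp only [h3]
      have hi1 : Integrable (fun w' : ℕ → Sph d × ℝ => pathV w' n - n * β) (Q z) :=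
        (hVL z n).integrable (by norm_num)
      have hi2 : Integrable (fun w' : ℕ → Sph d × ℝ => y ^ 2 + 2 * y * (pathV w' n - n * β))
          (Q z) :=
        (integrable_const _).add (hi1.const_mul _)
      rw [integral_add hi2 (hVL z n).integrable_sq, integral_add (integrable_const _)
          (hi1.const_mul _), integral_const_mul]
      simp only [integral_const, probReal_univ, smul_eq_mul, one_mul]
      have h4 := ih z
      have h5 : 2 * y * ∫ w', (pathV w' n - n * β) ∂(Q z) ≤ 2 * |y| * A := by
        refine (le_abs_self _).trans ?_
        rw [abs_mul, abs_mul, abs_two]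
        exact mul_le_mul_of_nonneg_left (hm n z) (by positivity)
      have h6 : 2 * |y| * A ≤ A * y ^ 2 + A := by
        nlinarith [mul_nonneg hA0 (sq_nonneg (|y| - 1)), sq_abs y]
      linarith
    have h7 : ∫ w, ∫ w', ((w 0).2 - β + (pathV w' n - n * β)) ^ 2 ∂(Q (pathX x w 1)) ∂(Q x) ≤
        ∫ w, ((1 + A) * ((w 0).2 - β) ^ 2 + (A + (B' * (1 + A) + A) * n)) ∂(Q x) :=
      integral_mono_of_nonneg (ae_of_all _ fun w => integral_nonneg fun w' => sq_nonneg _)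
        (hyL.add (integrable_const _)) (ae_of_all _ h2)
    refine h7.trans ?_
    have h8 : ∫ w, ((1 + A) * ((w 0).2 - β) ^ 2 + (A + (B' * (1 + A) + A) * n)) ∂(Q x) =
        (1 + A) * (∫ w, ((w 0).2 - β) ^ 2 ∂(Q x)) + (A + (B' * (1 + A) + A) * n) := by
      rw [integral_add hyL (integrable_const _)]
      refine congrArg₂ _ (integral_const_mul _ _) ?_
      simp
    rw [h8]
    have h9 := mul_le_mul_of_nonneg_left (hY x) (show 0 ≤ 1 + A by linarith)
    push_cast
    nlinarith

/-- The law of large numbers for `v_n`. -/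
lemma IsChain.exists_tendsto_pathV_div (hQ : IsChain K Q) {B : ℝ} (hB0 : 0 ≤ B)
    (hB : ∀ x, ∫⁻ w, ENNReal.ofReal ((w 0).2 ^ 2) ∂(Q x) ≤ ENNReal.ofReal B)
    {π : Measure (Sph d)} {l : ℕ} {θ : ℝ} (hl : l ≠ 0) (hθ0 : 0 ≤ θ) (hθ1 : θ < 1)
    (hconv : ∀ f : Sph d → ℝ, Measurable f → ∀ C : ℝ, (∀ x, |f x| ≤ C) →
        ∀ n x, |chainOp Q n f x - ∫ y, f y ∂π| ≤ θ ^ (n / l) * (2 * C)) :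
    ∃ β : ℝ, ∀ x, ∀ᵐ w ∂(Q x), Tendsto (fun n : ℕ => pathV w n / n) atTop (𝓝 β) := by
  obtain ⟨β, C, hC0, hC⟩ := hQ.exists_integral_sq_le hB0 hB hl hθ0 hθ1 hconv
  refine ⟨β, fun x => ?_⟩
  have hsum : ∀ (w : ℕ → Sph d × ℝ) (n : ℕ), ∑ k ∈ Finset.range n, ((w k).2 - β) =
      pathV w n - n * β := fun w n => by simp [pathV]
  have hVL : ∀ (n : ℕ), MemLp (fun w : ℕ → Sph d × ℝ => pathV w n - n * β) 2 (Q x) := fun n =>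
    (memLp_finsetSum _ fun k _ => hQ.memLp_incr hB x k).sub (memLp_const _)
  have h1 := ae_tendsto_sum_div_zero (μ := Q x) (Y := fun k w => (w k).2 - β)
    (fun k => by fun_prop) (C := max C (2 * B + 2 * β ^ 2)) (hC0.trans (le_max_left _ _))
    (fun k => ?_) (fun n => ?_)
  · filter_upwards [h1] with w hw
    simp only [hsum] at hw
    have h2 := hw.add_const β
    rw [zero_add] at h2
    refine h2.congr' ?_
    filter_upwards [eventually_ge_atTop 1] with n hn
    have : (n : ℝ) ≠ 0 := by positivity
    field_simp
    ring
  · have hL := hQ.memLp_incr hB x k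
    have h2 : ∀ w : ℕ → Sph d × ℝ, ENNReal.ofReal (((w k).2 - β) ^ 2) ≤
        2 * ENNReal.ofReal ((w k).2 ^ 2) + ENNReal.ofReal (2 * β ^ 2) := fun w => by
      rw [← ENNReal.ofReal_ofNat 2, ← ENNReal.ofReal_mul (by norm_num),
        ← ENNReal.ofReal_add (by positivity) (by positivity)]
      refine ENNReal.ofReal_le_ofReal ?_
      nlinarith [sq_nonneg ((w k).2 + β)]
    refine (lintegral_mono h2).trans ?_
    rw [lintegral_add_right _ measurable_const, lintegral_const_mul _ (by fun_prop)]
    simp only [lintegral_const, measure_univ, mul_one]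
    refine (add_le_add_left (mul_le_mul_right (hQ.lintegral_incr_sq_le hB x k) 2) _).trans ?_
    rw [← ENNReal.ofReal_ofNat 2, ← ENNReal.ofReal_mul (by norm_num),
      ← ENNReal.ofReal_add (by positivity) (by positivity)]
    exact ENNReal.ofReal_le_ofReal (le_max_right _ _)
  · simp only [hsum]
    rw [← ofReal_integral_eq_lintegral_ofReal (hVL n).integrable_sq
        (ae_of_all _ fun _ => sq_nonneg _)]
    exact ENNReal.ofReal_le_ofReal ((hC n x).trans
      (mul_le_mul_of_nonneg_right (le_max_left _ _) (Nat.cast_nonneg _)))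

end Chain

section Omega

variable {Ω : Type*} {η : ℕ → Fin (d + 1) → Ω → ℝ} [MeasurableSpace Ω] {P : Measure Ω}
  [IsProbabilityMeasure P] {lam : ℝ} {h : Sph d → ℝ} {Q : Kernel (Sph d) (ℕ → Sph d × ℝ)}

lemma rpow_mul_log_sq_le {lam t : ℝ} (hlam : 0 < lam) (ht : 0 ≤ t) :
    t ^ lam * Real.log t ^ 2 ≤ (2 / lam) ^ 2 + t ^ (lam + 2) := by
  have h0 : 0 ≤ t ^ (lam + 2) := Real.rpow_nonneg ht _
  rcases ht.eq_or_lt with rfl | hpos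
  · rw [Real.zero_rpow hlam.ne', zero_mul]
    positivity
  · rcases le_total t 1 with h1 | h1
    · have h2 := (Real.abs_log_mul_self_rpow_lt t (lam / 2) hpos h1 (half_pos hlam)).le
      have h3 : t ^ lam * Real.log t ^ 2 = |Real.log t * t ^ (lam / 2)| ^ 2 := by
        rw [sq_abs, mul_pow, ← Real.rpow_natCast (t ^ (lam / 2)) 2, ← Real.rpow_mul ht]
        norm_num
        ring
      rw [h3]
      have h4 := pow_le_pow_left₀ (abs_nonneg _) h2 2
      have h5 : 1 / (lam / 2) = 2 / lam := by field_simp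
      rw [h5] at h4
      linarith
    · have h2 : Real.log t ^ 2 ≤ t ^ 2 :=
        pow_le_pow_left₀ (Real.log_nonneg h1) (Real.log_le_self ht) 2
      have h3 : t ^ (lam + 2) = t ^ lam * t ^ 2 := by
        rw [Real.rpow_add hpos]
        norm_num
      rw [h3]
      nlinarith [mul_le_mul_of_nonneg_left h2 (Real.rpow_nonneg ht lam), sq_nonneg (2 / lam)]

lemma IsTiltedLaw.exists_lintegral_incr_sq_le (hQ : IsTiltedLaw a σ η P lam h Q)
    (N : IsNoise η P ρ) (H : NoiseLaw a σ ρ) (hlam : 0 < lam) (T : IsFixedTilt a σ ρ lam h) :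
    ∃ B : ℝ, 0 ≤ B ∧ ∀ x, ∫⁻ w, ENNReal.ofReal ((w 0).2 ^ 2) ∂(Q x) ≤ ENNReal.ofReal B := by
  obtain ⟨C, hC⟩ := T.exists_bound
  have hC0 : 0 ≤ C := (abs_nonneg _).trans (hC (basePoint d))
  obtain ⟨D, hD⟩ := isCompact_univ.exists_bound_of_continuousOn
    (T.cont.inv₀ fun x => (T.pos x).ne').continuousOn
  have hD' : ∀ x, (h x)⁻¹ ≤ D := fun x => (le_abs_self _).trans (hD x (Set.mem_univ x))
  have hi : Integrable (fun ω => C * ((2 / lam) ^ 2 + matNorm (matProd a σ η 1 ω) ^ (lam + 2))) P :=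
    ((integrable_const _).add
      (N.integrable_matNorm_matProd H (by linarith : (0 : ℝ) ≤ lam + 2) 1)).const_mul C
  have h0 : ∀ ω, 0 ≤ C * ((2 / lam) ^ 2 + matNorm (matProd a σ η 1 ω) ^ (lam + 2)) := fun ω =>
    mul_nonneg hC0 (add_nonneg (sq_nonneg _) (Real.rpow_nonneg (matNorm_nonneg _) _))
  set M := ∫ ω, C * ((2 / lam) ^ 2 + matNorm (matProd a σ η 1 ω) ^ (lam + 2)) ∂P with hM
  have hD0 : 0 ≤ D := (inv_nonneg.2 (T.pos (basePoint d)).le).trans (hD' _)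
  refine ⟨D * M, mul_nonneg hD0 (integral_nonneg h0), fun x => ?_⟩
  have h1 := hQ.findim x 1 (fun u => ENNReal.ofReal ((u 0).2 ^ 2)) (by fun_prop)
  simp only [Fin.val_zero] at h1
  rw [h1, ENNReal.ofReal_mul hD0]
  refine mul_le_mul' (ENNReal.ofReal_le_ofReal (hD' x)) ?_
  rw [hM, ofReal_integral_eq_lintegral_ofReal hi (ae_of_all _ h0)]
  refine lintegral_mono fun ω => ?_
  rw [← ENNReal.ofReal_mul (mul_nonneg (Real.rpow_nonneg (norm_nonneg _) _) (T.pos _).le)]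
  refine ENNReal.ofReal_le_ofReal ?_
  have h2 : logIncr a σ η x 0 ω =
      Real.log ‖rowMul (x : EuclideanSpace ℝ (Fin (d + 1))) (matProd a σ η 1 ω)‖ := by
    simp [logIncr, matProd, dirChain]
  rw [h2]
  set t := ‖rowMul (x : EuclideanSpace ℝ (Fin (d + 1))) (matProd a σ η 1 ω)‖ with ht
  have ht0 : 0 ≤ t := norm_nonneg _
  have h3 : t ^ (lam + 2) ≤ matNorm (matProd a σ η 1 ω) ^ (lam + 2) :=
    Real.rpow_le_rpow ht0 (norm_rowMul_matProd_le x 1 ω) (by linarith)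
  calc t ^ lam * h (dirChain a σ η x 1 ω) * Real.log t ^ 2
      = h (dirChain a σ η x 1 ω) * (t ^ lam * Real.log t ^ 2) := by ring
    _ ≤ C * ((2 / lam) ^ 2 + t ^ (lam + 2)) :=
        mul_le_mul ((le_abs_self _).trans (hC _)) (rpow_mul_log_sq_le hlam ht0)
          (mul_nonneg (Real.rpow_nonneg ht0 _) (sq_nonneg _)) hC0
    _ ≤ _ := mul_le_mul_of_nonneg_left (by linarith) hC0

/-- Under the tilted law, `E exp (-(lam - 2) v_n)` is comparable to `E |x' Π_n|²`, which decays
exponentially because the eigenvalues of `E (A ⊗ A)` have modulus less than one. Hence `v_n` grows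
at least linearly. -/
lemma IsTiltedLaw.exists_eventually_le_pathV (hQ : IsTiltedLaw a σ η P lam h Q)
    (N : IsNoise η P ρ) (H : NoiseLaw a σ ρ) (hD0 : CondD0 a σ η P) (hlam : 2 < lam)
    (T : IsFixedTilt a σ ρ lam h) :
    ∃ b : ℝ, 0 < b ∧ ∀ x, ∀ᵐ w ∂(Q x), ∀ᶠ n : ℕ in atTop, b * n ≤ pathV w n := by
  obtain ⟨C, hC⟩ := T.exists_bound
  have hC0 : 0 ≤ C := (abs_nonneg _).trans (hC (basePoint d))
  obtain ⟨r, C₂, hr0, hr1, hC₂⟩ := N.exists_second_moment_le H hD0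
  -- The intermediate rate `s` between `r` and `1` turns the decay of the expectations into an
  -- almost sure statement.
  set s := Real.sqrt r with hs
  have hs0 : 0 < s := Real.sqrt_pos.2 hr0
  have hs1 : s < 1 := by rw [hs, Real.sqrt_lt' one_pos]; simpa using hr1
  have hss : s * s = r := Real.mul_self_sqrt hr0.le
  have hlog : Real.log s < 0 := Real.log_neg hs0 hs1
  have hl2 : 0 < lam - 2 := by linarith
  refine ⟨-Real.log s / (lam - 2), div_pos (neg_pos.2 hlog) hl2, fun x => ?_⟩
  have hlint : ∀ n, ∫⁻ w, ENNReal.ofReal (Real.exp (-(lam - 2) * pathV w n)) ∂(Q x) ≤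
      ENNReal.ofReal ((h x)⁻¹ * (C * (C₂ * r ^ n))) := fun n => by
    have hF : Measurable fun u : Fin n → Sph d × ℝ =>
        ENNReal.ofReal (Real.exp (-(lam - 2) * ∑ k, (u k).2)) := by fun_prop
    have h1 := hQ.findim x n _ hF
    simp only [pathV, ← Fin.sum_univ_eq_sum_range]
    rw [h1, ENNReal.ofReal_mul (inv_nonneg.2 (T.pos x).le)]
    refine mul_le_mul' le_rfl ?_
    have hi : Integrable (fun ω => C * matNorm (matProd a σ η n ω) ^ (2 : ℝ)) P :=
      (N.integrable_matNorm_matProd H (by norm_num) n).const_mul C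
    have h0 : ∀ ω, 0 ≤ C * matNorm (matProd a σ η n ω) ^ (2 : ℝ) := fun ω =>
      mul_nonneg hC0 (Real.rpow_nonneg (matNorm_nonneg _) _)
    have h2 : ∫ ω, C * matNorm (matProd a σ η n ω) ^ (2 : ℝ) ∂P ≤ C * (C₂ * r ^ n) := by
      rw [integral_const_mul]
      exact mul_le_mul_of_nonneg_left (hC₂ n) hC0
    refine le_trans ?_ (ENNReal.ofReal_le_ofReal h2)
    rw [ofReal_integral_eq_lintegral_ofReal hi (ae_of_all _ h0)]
    refine lintegral_mono fun ω => ?_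
    rw [← ENNReal.ofReal_mul (mul_nonneg (Real.rpow_nonneg (norm_nonneg _) _) (T.pos _).le)]
    refine ENNReal.ofReal_le_ofReal ?_
    set t := ‖rowMul (x : EuclideanSpace ℝ (Fin (d + 1))) (matProd a σ η n ω)‖ with ht
    by_cases hz : rowMul (x : EuclideanSpace ℝ (Fin (d + 1))) (matProd a σ η n ω) = 0
    · rw [ht, hz, norm_zero, Real.zero_rpow (by linarith), zero_mul, zero_mul]
      exact h0 ω
    · -- Here `t = exp v_n`, so that the weight `t ^ lam` leaves `t ^ 2`.
      have htpos : 0 < t := norm_pos_iff.2 hz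
      have h3 : ∑ k : Fin n, logIncr a σ η x k ω = Real.log t := by
        rw [Fin.sum_univ_eq_sum_range (fun k => logIncr a σ η x k ω)]
        exact sum_logIncr x hz
      have h4 : t ^ lam * Real.exp (-(lam - 2) * Real.log t) = t ^ (2 : ℝ) := by
        have h5 : Real.exp (-(lam - 2) * Real.log t) = t ^ (-(lam - 2)) := by
          rw [Real.rpow_def_of_pos htpos, mul_comm]
        rw [h5, ← Real.rpow_add htpos]
        congr 1
        ring
      simp only [h3]
      calc t ^ lam * h (dirChain a σ η x n ω) * Real.exp (-(lam - 2) * Real.log t)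
          = h (dirChain a σ η x n ω) * t ^ (2 : ℝ) := by rw [← h4]; ring
        _ ≤ C * matNorm (matProd a σ η n ω) ^ (2 : ℝ) :=
            mul_le_mul ((le_abs_self _).trans (hC _)) (Real.rpow_le_rpow htpos.le
              (norm_rowMul_matProd_le x n ω) (by norm_num)) (Real.rpow_nonneg htpos.le _) hC0
  have hae := ae_tendsto_zero_of_lintegral_le (μ := Q x)
    (Z := fun n w => (s⁻¹) ^ n * Real.exp (-(lam - 2) * pathV w n))
    (fun n => ((measurable_pathV n).const_mul _).exp.const_mul _)
    (fun n w => by positivity)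
    (c := fun n => ((h x)⁻¹ * (C * C₂)) * s ^ n)
    ((summable_geometric_of_lt_one hs0.le hs1).mul_left _) (fun n => by
      have h6 : ∀ w : ℕ → Sph d × ℝ,
          ENNReal.ofReal ((s⁻¹) ^ n * Real.exp (-(lam - 2) * pathV w n)) =
          ENNReal.ofReal ((s⁻¹) ^ n) * ENNReal.ofReal (Real.exp (-(lam - 2) * pathV w n)) :=
        fun w => ENNReal.ofReal_mul (by positivity)
      simp only [h6]
      rw [lintegral_const_mul _ ((measurable_pathV n).const_mul _).exp.ennreal_ofReal]
      refine (mul_le_mul_right (hlint n) _).trans ?_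
      rw [← ENNReal.ofReal_mul (by positivity)]
      refine ENNReal.ofReal_le_ofReal (le_of_eq ?_)
      rw [← hss, mul_pow, inv_pow]
      field_simp)
  filter_upwards [hae] with w hw
  filter_upwards [hw.eventually_lt_const one_pos] with n hn
  have h7 : Real.exp (-(lam - 2) * pathV w n) < Real.exp (n * Real.log s) := by
    rw [Real.exp_nat_mul, Real.exp_log hs0]
    rw [inv_pow, inv_mul_lt_iff₀ (by positivity), mul_one] at hn
    exact hn
  have h8 := Real.exp_lt_exp.1 h7
  rw [div_mul_eq_mul_div, div_le_iff₀ hl2]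
  linarith

theorem IsTiltedLaw.condC2 (hQ : IsTiltedLaw a σ η P lam h Q) (N : IsNoise η P ρ)
    (H : NoiseLaw a σ ρ) (hD0 : CondD0 a σ η P) (hlam : 2 < lam) (T : IsFixedTilt a σ ρ lam h) :
    CondC2 Q := by
  have := hQ.isMarkov
  have hlam0 : 0 < lam := by linarith
  obtain ⟨K, hK, hKQ⟩ := hQ.exists_isChain N H hlam0.le T
  obtain ⟨π, l, θ, hπ, hl, hθ0, hθ1, hac, hca, hconv⟩ := hQ.exists_invariant N H hlam0 T
  refine ⟨⟨π, hπ, hac, hca, tendsto_tvDist hl hθ0 hθ1 hconv⟩, ?_⟩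
  obtain ⟨B, hB0, hB⟩ := hQ.exists_lintegral_incr_sq_le N H hlam0 T
  obtain ⟨β, hβ⟩ := hKQ.exists_tendsto_pathV_div hB0 hB hl hθ0 hθ1 hconv
  obtain ⟨b, hb, hbV⟩ := hQ.exists_eventually_le_pathV N H hD0 hlam T
  refine ⟨β, lt_of_lt_of_le hb ?_, hβ⟩
  obtain ⟨w, hw1, hw2⟩ := ((hβ (basePoint d)).and (hbV (basePoint d))).exists
  refine ge_of_tendsto hw1 ?_
  filter_upwards [hw2, eventually_ge_atTop 1] with n hn hn1
  rw [le_div_iff₀ (by positivity)]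
  exact hn

end Omega

end RCA

namespace RCA
variable {d : ℕ} {a σ : Fin (d + 1) → ℝ} {ρ : Measure ℝ}

/-! ### The noise law and the conclusion -/

section Omega

variable {Ω : Type*} {η : ℕ → Fin (d + 1) → Ω → ℝ} [MeasurableSpace Ω] {P : Measure Ω}
  [IsProbabilityMeasure P]

lemma IsNoise.isTiltFunction_iff (N : IsNoise η P ρ) (H : NoiseLaw a σ ρ) {lam : ℝ}
    (hlam : 0 ≤ lam) {h : Sph d → ℝ} :
    IsTiltFunction a σ η P lam h ↔ IsFixedTilt a σ ρ lam h := by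
  have hint : Continuous h → ∀ x : Sph d,
      ∫ ω, ‖rowMul (x : EuclideanSpace ℝ (Fin (d + 1))) (coeffMat a σ η 0 ω)‖ ^ lam *
        h (direction x (rowMul (x : EuclideanSpace ℝ (Fin (d + 1))) (coeffMat a σ η 0 ω))) ∂P =
      tiltOp a σ ρ lam h x := fun hc x => by
    obtain ⟨C, hC⟩ := isCompact_univ.exists_bound_of_continuousOn (f := h) hc.continuousOn
    have h1 := N.integral_tilt H hlam hc.measurable (fun y => hC y (Set.mem_univ y)) x 1
    simpa [matProd, dirChain] using h1
  constructor
  · rintro ⟨hc, hp, hf⟩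
    exact ⟨hc, hp, fun x => by rw [← hint hc, hf]⟩
  · rintro ⟨hc, hp, hf⟩
    exact ⟨hc, hp, fun x => by rw [hint hc, hf]⟩

/-- The common law of the noise variables. The moment condition on `α_{11}` forces `σ 0 > 0`. -/
lemma exists_noiseLaw (hσ : ∀ i, 0 ≤ σ i) (hη : ∀ n i, Measurable (η n i)) (hD1 : CondD1 η P)
    (hD2 : CondD2 a σ η P) (hq : 0 < a (Fin.last d) ^ 2 + σ (Fin.last d) ^ 2) :
    ∃ ρ : Measure ℝ, IsNoise η P ρ ∧ NoiseLaw a σ ρ ∧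
      ∃ p : ℝ, 1 ≤ p ∧ 1 < |σ 0| ^ p * ∫ t, |t| ^ p ∂ρ := by
  obtain ⟨hind, ⟨φ, hφc, hφ0, hφs, -, hlaw⟩, hmom⟩ := hD1
  obtain ⟨m, hm, -, hm1⟩ := hD2
  have hσ0 : 0 < σ 0 := by
    refine lt_of_le_of_ne (hσ 0) fun h0 => ?_
    have h1 : ∀ ω, (coeff a σ η 0 0 ω - a 0) ^ (2 * m) = 0 := fun ω => by
      simp only [coeff, ← h0, zero_mul, add_zero, sub_self]
      exact zero_pow (by omega)
    simp only [h1, integral_zero] at hm1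
    linarith
  refine ⟨volume.withDensity fun t => ENNReal.ofReal (φ t), ⟨hη, hind, hlaw⟩,
    ⟨?_, ⟨φ, hφc, hφ0, hφs, rfl⟩, fun k => ?_, hσ0, ?_⟩, 2 * m, ?_, ?_⟩
  · rw [← hlaw 0 0]
    exact Measure.isProbabilityMeasure_map (hη 0 0).aemeasurable
  · rw [← hlaw 0 0]
    exact (integrable_map_measure (by fun_prop) (hη 0 0).aemeasurable).2 (hmom 0 0 k)
  · by_contra! hcon
    rw [hcon.1, hcon.2] at hq
    simp at hq
  · have : (1 : ℝ) ≤ m := by exact_mod_cast hm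
    linarith
  · rw [← hlaw 0 0, integral_map (hη 0 0).aemeasurable
      (by fun_prop : Measurable fun t : ℝ => |t| ^ (2 * (m : ℝ))).aestronglyMeasurable,
      ← integral_const_mul]
    refine hm1.trans_eq (integral_congr_ae (ae_of_all _ fun ω => ?_))
    have h1 : (2 * (m : ℝ)) = ((2 * m : ℕ) : ℝ) := by push_cast; ring
    simp only [coeff, add_sub_cancel_left]
    rw [← Real.mul_rpow (abs_nonneg _) (abs_nonneg _), ← abs_mul, h1, Real.rpow_natCast,
      (even_two_mul m).pow_abs]

end Omega

end RCA

theorem proposition4p3 {Ω : Type*} [MeasurableSpace Ω] (P : Measure Ω) [IsProbabilityMeasure P]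
    (d : ℕ) (a σ : Fin (d + 1) → ℝ) (hσ : ∀ i, 0 ≤ σ i)
    (η : ℕ → Fin (d + 1) → Ω → ℝ) (hη : ∀ n i, Measurable (η n i))
    (hmean : ∀ n i, ∫ ω, η n i ω ∂P = 0) (hvar : ∀ n i, ∫ ω, η n i ω ^ 2 ∂P = 1)
    (hD0 : RCA.CondD0 a σ η P) (hD1 : RCA.CondD1 η P) (hD2 : RCA.CondD2 a σ η P)
    (hq : 0 < a (Fin.last d) ^ 2 + σ (Fin.last d) ^ 2) :
    (∃! lam : ℝ, 0 < lam ∧ RCA.KappaEq a σ η P lam 1) ∧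
    ∀ lam : ℝ, 0 < lam → RCA.KappaEq a σ η P lam 1 →
      (∃ h : RCA.Sph d → ℝ, RCA.IsTiltFunction a σ η P lam h) ∧
      ∀ h : RCA.Sph d → ℝ, RCA.IsTiltFunction a σ η P lam h →
        (∃! Pt : Kernel (RCA.Sph d) (ℕ → RCA.Sph d × ℝ), RCA.IsTiltedLaw a σ η P lam h Pt) ∧
        ∀ Pt : Kernel (RCA.Sph d) (ℕ → RCA.Sph d × ℝ), RCA.IsTiltedLaw a σ η P lam h Pt →
          RCA.CondC1 Pt ∧ RCA.CondC2 Pt ∧ RCA.CondC3 Pt ∧ RCA.CondC4 Pt := by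
  obtain ⟨ρ, N, H, p, hp, hp1⟩ := RCA.exists_noiseLaw hσ hη hD1 hD2 hq
  refine ⟨N.existsUnique_exponent H hD0 hp hp1, fun lam hlam hκ => ⟨?_, fun h hh => ?_⟩⟩
  · obtain ⟨g, hgc, hgp, hgf⟩ := N.exists_fixed H hlam hκ
    exact ⟨g, (N.isTiltFunction_iff H hlam.le).2 ⟨hgc, hgp, hgf⟩⟩
  have T := (N.isTiltFunction_iff H hlam.le).1 hh
  have hlam2 : 2 < lam := N.two_lt_of_kappaEq_one H hD0 hlam hκ
  obtain ⟨-, Q, -, -, hQ⟩ := T.exists_tiltedLaw N H hlam.le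
  refine ⟨⟨Q, hQ, fun Q' hQ' => hQ'.ext hQ⟩, fun Pt hPt => ⟨?_, ?_, ?_, ?_⟩⟩
  · exact hPt.condC1 N H hlam.le T
  · exact hPt.condC2 N H hD0 hlam2 T
  · exact hPt.condC3 N H hlam T
  · exact hPt.condC4 N H hlam T
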